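/- Consider the class $\mathscr S$ of equations $$i\psi_t+\psi_{xx}+S(t,x,|\psi|)\,\psi=0,\qquad S_\rho\ne0,\quad \rho=|\psi|,$$ for a complex function $\psi\neq 0$ of real variables $t,x$, where the arbitrary element $S$ is a smooth complex-valued function of $(t,x,\rho)$ on a domain (nonempty connected open set) of the half-space $\rho>0$, with $S_\rho$ nowhere zero there. Let $\mathscr F'$ be the class of equations $i\psi_t+\psi_{xx}+F(t,x,\psi,\psi^*)=0$ with $F$ an arbitrary smooth complex-valued function on a domain. Point transformations are local diffeomorphisms (smooth in the real sense) between open sets of the space of $(t,x,\psi)$. For two equations of a class with arbitrary elements $\theta,\tilde\theta$, let $\mathrm T(\theta,\tilde\theta)$ be the set of point transformations, defined on open subsets of the domains of the equations, whose second prolongation maps the equation of $\theta$, viewed as a submanifold of the second-order jet space, to that of $\tilde\theta$; put $G_\theta=\mathrm T(\theta,\theta)$. The equivalence group $G^\sim$ of the class is the pseudogroup of point transformations $\Phi$ of the space of $(t,x,\psi,\theta)$ that are projectable to $(t,x,\psi)$ and such that, locally, for every $\theta$ in the class the transformed arbitrary element $\Phi\theta$ is in the class and $\Phi|_{(t,x,\psi)}\in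 \mathrm T(\theta,\Phi\theta)$. The class is called normalized if for all $\theta,\tilde\theta$ in it and all $\varphi\in\mathrm T(\theta,\tilde\theta)$ there is $\Phi\in G^\sim$ with $\tilde\theta=\Phi\theta$ (on the image of $\varphi$) and $\varphi=\Phi|_{(t,x,\psi)}$; it is called strongly normalized if, in addition, $G^\sim|_{(t,x,\psi)}=\prod_\theta G_\theta$, i.e. the projections of the elements of $G^\sim$ are exactly the point transformations that near every point of their domain are finite compositions of elements of the pseudogroups $G_\theta$, $\theta$ in the class. **Theorem.** The class $\mathscr S$ is strongly normalized. In terms of $F=S\psi$, $\psi\ne0$, its equivalence group $G^\sim_{\mathscr S}$ is the subgroup of $G^\sim_{\mathscr F'}$ defined by $\Phi^0=0$, that is, it consists of those elements of $G^\sim_{\mathscr F'}$ (over $\psi\neq0$) whose $(t,x,\psi)$-components have locally the form given in the first line below, without an additional summand $\Phi^0(t,x)$ in $\tilde\psi$. In terms of $S$, the group $G^\sim_{\mathscr S}$ is formed by the projectable point transformations of $(t,x,\psi,S)$, $\psi\ne 0$, that near every point of their domain have the form $$\tilde t=T(t),\quad \tilde x=\varepsilon x|T_t|^{1/2}+X(t),\quad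 \tilde\psi=\hat\psi\exp\left(\frac i8\frac{T_{tt}}{|T_t|}x^2+\frac i2\frac{\varepsilon\varepsilon'X_t}{|T_t|^{1/2}}x+\Theta(t)+i\Psi(t)\right),$$ $$\tilde S=\frac{\hat S}{|T_t|}+\frac{2T_{ttt}T_t-3T_{tt}^2}{16\varepsilon'T_t^3}x^2+\frac{\varepsilon\varepsilon'}{2|T_t|^{1/2}}\left(\frac{X_t}{T_t}\right)_{\!t}x+\frac{\Psi_t-i\Theta_t}{T_t}-\frac{X_t^2+iT_{tt}}{4T_t^2},$$ where $T,X,\Theta,\Psi$ are smooth real-valued functions of $t$, $T_t\ne0$, $\varepsilon=\pm1$, $\varepsilon'=\operatorname{sign}T_t$, and $\hat\beta=\beta$ if $T_t>0$, $\hat\beta=\beta^*$ if $T_t<0$. Conversely, for all smooth real-valued functions $T,X,\Theta,\Psi$ on an open interval $I$ with $T_t\ne0$ on $I$, and $\varepsilon=\pm1$, these formulas define an element of $G^\sim_{\mathscr S}$ with domain $\{t\in I,\ x\in\mathbb R,\ \psi\in\mathbb C\setminus\{0\},\ S\in\mathbb C\}$. -/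

import Mathlib

open scoped ContDiff Topology

namespace NLS

/-! ### Spaces of variables, point transformations, jets -/

/-- The space of the variables `(t, x, ψ)`. The conjugate variable `ψ*` is not a separate coordinate:
smoothness in `(ψ, ψ*)` is real smoothness in `ψ ∈ ℂ`. -/
abbrev Base : Type := ℝ × ℝ × ℂ

/-- The space of `(t, x, ψ)` together with the value of the (complex) arbitrary element. -/
abbrev Ext : Type := Base × ℂ

/-- A (locally defined) point transformation: a smooth diffeomorphism between open sets. -/
def IsPointTransf {E : Type} [NormedAddCommGroup E] [NormedSpace ℝ E]
    (φ : OpenPartialHomeomorph E E) : Prop :=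
  ContDiffOn ℝ ∞ φ φ.source ∧ ContDiffOn ℝ ∞ φ.symm φ.target

/-- Coordinates of the second-order jet space of complex functions of `(t, x)`. -/
@[ext] structure Jet2 where
  t : ℝ
  x : ℝ
  u : ℂ
  ut : ℂ
  ux : ℂ
  utt : ℂ
  utx : ℂ
  uxx : ℂ

/-- The point `(t, x, ψ)` below a jet. -/
def Jet2.pt (j : Jet2) : Base := (j.t, j.x, j.u)

/-- The partial derivatives with respect to `t` and `x`. -/
noncomputable def dt (f : ℝ × ℝ → ℂ) (p : ℝ × ℝ) : ℂ := fderiv ℝ f p (1, 0)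
noncomputable def dx (f : ℝ × ℝ → ℂ) (p : ℝ × ℝ) : ℂ := fderiv ℝ f p (0, 1)

/-- The second-order jet of the function `ψ = f(t, x)` at the point `p`. -/
noncomputable def jet (f : ℝ × ℝ → ℂ) (p : ℝ × ℝ) : Jet2 where
  t := p.1
  x := p.2
  u := f p
  ut := dt f p
  ux := dx f p
  utt := dt (dt f) p
  utx := dt (dx f) p
  uxx := dx (dx f) p

/-- The second prolongation of `φ` takes the jet `j` to the jet `j'`: `φ` maps the graph of a function
representing `j` (locally) into the graph of a function representing `j'`. -/
def Prolongs (φ : OpenPartialHomeomorph Base Base) (j j' : Jet2) : Prop :=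
  ∃ (f g : ℝ × ℝ → ℂ) (p q : ℝ × ℝ),
    ContDiffAt ℝ ∞ f p ∧ ContDiffAt ℝ ∞ g q ∧ jet f p = j ∧ jet g q = j' ∧
    (p.1, p.2, f p) ∈ φ.source ∧ φ (p.1, p.2, f p) = (q.1, q.2, g q) ∧
    ∀ᶠ p' in 𝓝 p, ∃ q' : ℝ × ℝ, φ (p'.1, p'.2, f p') = (q'.1, q'.2, g q')

/-! ### Classes of equations and their transformations -/

/-- A value of the arbitrary element: a function of `(t, x, ψ)` on a set `dom`. -/
structure ArbElt where
  dom : Set Base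
  val : Base → ℂ

/-- A class of second-order equations `L(j, θ(t, x, ψ)) = 0` for one complex function of `(t, x)`
with one complex arbitrary element `θ`, which runs through `elts`. The variables `(t, x, ψ)` run
through `space`. -/
structure EqClass where
  space : Set Base
  L : Jet2 → ℂ → ℂ
  elts : Set ArbElt

/-- The equation with the arbitrary element `θ`, as a subset of the jet space. -/
def EqClass.manifold (C : EqClass) (θ : ArbElt) : Set Jet2 :=
  {j | j.pt ∈ θ.dom ∧ C.L j (θ.val j.pt) = 0}

/-- The set `T(θ, θ')` of point transformations mapping the equation of `θ` to that of `θ'`. -/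
def EqClass.admTransf (C : EqClass) (θ θ' : ArbElt) : Set (OpenPartialHomeomorph Base Base) :=
  {φ | IsPointTransf φ ∧ φ.source ⊆ θ.dom ∧ φ.target ⊆ θ'.dom ∧
    ∀ j j', Prolongs φ j j' → (j ∈ C.manifold θ ↔ j' ∈ C.manifold θ')}

/-- The point transformation `Φ` of `(t, x, ψ, θ)` is projectable to `(t, x, ψ)`, with projection
`φ`. -/
def ProjectsTo (Φ : OpenPartialHomeomorph Ext Ext) (φ : OpenPartialHomeomorph Base Base) : Prop :=
  IsPointTransf φ ∧ φ.source = Prod.fst '' Φ.source ∧ ∀ w ∈ Φ.source, (Φ w).1 = φ w.1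

/-- The (usual) equivalence group, a pseudogroup of locally defined point transformations `Φ` of
`(t, x, ψ, θ)` that are projectable to `(t, x, ψ)`: for every `θ` in the class, the transformed
arbitrary element `Φθ`, whose graph is the image of the graph of `θ`, is again (locally) in the class,
and the projection of `Φ` is an admissible transformation from `θ` to `Φθ`. -/
def EqClass.equivGroup (C : EqClass) : Set (OpenPartialHomeomorph Ext Ext) :=
  {Φ | IsPointTransf Φ ∧ (∀ w ∈ Φ.source, w.1 ∈ C.space) ∧
    ∃ φ, ProjectsTo Φ φ ∧
      ∀ θ ∈ C.elts, ∀ z ∈ θ.dom, (z, θ.val z) ∈ Φ.source →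
        ∃ θ' ∈ C.elts, ∃ W : Set Base, IsOpen W ∧ z ∈ W ∧
          φ.restr W ∈ C.admTransf θ θ' ∧
          ∀ z' ∈ W, (z', θ.val z') ∈ Φ.source ∧ θ'.val (φ z') = (Φ (z', θ.val z')).2}

/-- Every admissible transformation `(θ, θ', φ)` is induced by an element of the equivalence group. -/
def EqClass.Normalized (C : EqClass) : Prop :=
  ∀ θ ∈ C.elts, ∀ θ' ∈ C.elts, ∀ φ ∈ C.admTransf θ θ',
    ∃ Φ ∈ C.equivGroup, ProjectsTo Φ φ ∧
      ∀ z ∈ φ.source, (z, θ.val z) ∈ Φ.source ∧ (Φ (z, θ.val z)).2 = θ'.val (φ z)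

/-- The projection of the equivalence group to the variables `(t, x, ψ)`. -/
def EqClass.equivGroupProj (C : EqClass) : Set (OpenPartialHomeomorph Base Base) :=
  {φ | ∃ Φ ∈ C.equivGroup, ProjectsTo Φ φ}

/-- The product of the point symmetry pseudogroups `G_θ = T(θ, θ)`, `θ` in the class: the point
transformations that coincide, near every point of their domain, with a finite composition of
point symmetries of equations of the class. -/
def EqClass.symProduct (C : EqClass) : Set (OpenPartialHomeomorph Base Base) :=
  {φ | IsPointTransf φ ∧ ∀ z ∈ φ.source, ∃ l : List (OpenPartialHomeomorph Base Base),
    l ≠ [] ∧ (∀ e ∈ l, ∃ θ ∈ C.elts, e ∈ C.admTransf θ θ) ∧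
    z ∈ (l.foldr (fun e e' => e.trans e') (OpenPartialHomeomorph.refl Base)).source ∧
    ∀ᶠ z' in 𝓝 z, φ z' = l.foldr (fun e e' => e.trans e') (OpenPartialHomeomorph.refl Base) z'}

/-- Strong normalization. -/
def EqClass.StronglyNormalized (C : EqClass) : Prop :=
  C.Normalized ∧ C.equivGroupProj = C.symProduct

/-! ### The two classes of nonlinear Schrödinger equations -/

/-- The class of equations `iψ_t + ψ_xx + F(t, x, ψ, ψ*) = 0`, `F` smooth on a domain. -/
noncomputable def classF' : EqClass where
  space := Set.univ
  L := fun j F => Complex.I * j.ut + j.uxx + F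
  elts := {θ | IsOpen θ.dom ∧ IsConnected θ.dom ∧ ContDiffOn ℝ ∞ θ.val θ.dom}

/-- The class of equations `iψ_t + ψ_xx + S(t, x, |ψ|) ψ = 0`, `S_ρ ≠ 0`, where `S` is a smooth
complex function of `(t, x, ρ)` on a domain of the half-space `ρ > 0`. -/
noncomputable def classS : EqClass where
  space := {z | z.2.2 ≠ 0}
  L := fun j S => Complex.I * j.ut + j.uxx + S * j.u
  elts := {θ | ∃ (Ω : Set (ℝ × ℝ × ℝ)) (S : ℝ × ℝ × ℝ → ℂ),
    IsOpen Ω ∧ IsConnected Ω ∧ (∀ y ∈ Ω, 0 < y.2.2) ∧ ContDiffOn ℝ ∞ S Ω ∧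
    (∀ y ∈ Ω, deriv (fun ρ : ℝ => S (y.1, y.2.1, ρ)) y.2.2 ≠ 0) ∧
    θ.dom = {z | (z.1, z.2.1, ‖z.2.2‖) ∈ Ω} ∧
    ∀ z ∈ θ.dom, θ.val z = S (z.1, z.2.1, ‖z.2.2‖)}

/-! ### The explicit transformations -/

/-- `β̂`: equal to `β` if `T_t > 0` and to `β*` if `T_t < 0`, where `τ = T_t`. -/
noncomputable def hat (τ : ℝ) (β : ℂ) : ℂ := if 0 < τ then β else (starRingEnd ℂ) β

/-- The transformation of `(t, x, ψ)` with parameters `T, X, Θ, Ψ, Φ⁰, ε`; here `ε' = sign T_t`. -/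
noncomputable def baseMap (T X Θ Ψ : ℝ → ℝ) (Φ0 : ℝ → ℝ → ℂ) (ε : ℝ) (z : Base) : Base :=
  let t := z.1
  let x := z.2.1
  let T1 := deriv T t
  let T2 := iteratedDeriv 2 T t
  let X1 := deriv X t
  let ε' := Real.sign T1
  (T t,
   ε * x * √|T1| + X t,
   hat T1 z.2.2 *
      Complex.exp (Complex.I * ((1 / 8 * (T2 / |T1|) * x ^ 2
        + 1 / 2 * (ε * ε' * X1 / √|T1|) * x : ℝ) : ℂ) + (Θ t : ℂ) + Complex.I * (Ψ t : ℂ))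
    + Φ0 t x)

/-- The transformed value of the arbitrary element `S`. -/
noncomputable def sMap (T X Θ Ψ : ℝ → ℝ) (ε : ℝ) (w : Ext) : ℂ :=
  let t := w.1.1
  let x := w.1.2.1
  let T1 := deriv T t
  let T2 := iteratedDeriv 2 T t
  let T3 := iteratedDeriv 3 T t
  let X1 := deriv X t
  let ε' := Real.sign T1
  hat T1 w.2 / (|T1| : ℝ)
    + (((2 * T3 * T1 - 3 * T2 ^ 2) / (16 * ε' * T1 ^ 3) * x ^ 2 : ℝ) : ℂ)
    + ((ε * ε' / (2 * √|T1|) * deriv (fun s => deriv X s / deriv T s) t * x : ℝ) : ℂ)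
    + (((deriv Ψ t : ℝ) : ℂ) - Complex.I * ((deriv Θ t : ℝ) : ℂ)) / (T1 : ℂ)
    - (((X1 ^ 2 : ℝ) : ℂ) + Complex.I * (T2 : ℂ)) / ((4 * T1 ^ 2 : ℝ) : ℂ)

/-- The transformation of `(t, x, ψ, S)` with parameters `T, X, Θ, Ψ, ε`. -/
noncomputable def equivMap (T X Θ Ψ : ℝ → ℝ) (ε : ℝ) (w : Ext) : Ext :=
  (baseMap T X Θ Ψ 0 ε w.1, sMap T X Θ Ψ ε w)

/-- The requirements on the parameters near the time `t`. -/
def ParamsAt (T X Θ Ψ : ℝ → ℝ) (ε t : ℝ) : Prop :=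
  (∀ᶠ s in 𝓝 t, ContDiffAt ℝ ∞ T s ∧ ContDiffAt ℝ ∞ X s ∧ ContDiffAt ℝ ∞ Θ s ∧
    ContDiffAt ℝ ∞ Ψ s) ∧ deriv T t ≠ 0 ∧ (ε = 1 ∨ ε = -1)

/-- Near every point of its domain, `Φ` has the explicit form with some `T, X, Θ, Ψ, ε`. -/
def HasEquivForm (Φ : OpenPartialHomeomorph Ext Ext) : Prop :=
  ∀ w ∈ Φ.source, ∃ (T X Θ Ψ : ℝ → ℝ) (ε : ℝ), ParamsAt T X Θ Ψ ε w.1.1 ∧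
    ∀ᶠ w' in 𝓝 w, Φ w' = equivMap T X Θ Ψ ε w'

/-- Near every point of its domain, the `(t, x, ψ)`-part of `Φ` has the form `baseMap` with
`Φ⁰ = 0`. -/
def VanishingΦ0 (Φ : OpenPartialHomeomorph Ext Ext) : Prop :=
  ∀ w ∈ Φ.source, ∃ (T X Θ Ψ : ℝ → ℝ) (ε : ℝ), ParamsAt T X Θ Ψ ε w.1.1 ∧
    ∀ᶠ w' in 𝓝 w, (Φ w').1 = baseMap T X Θ Ψ 0 ε w'.1

/-- The change of the arbitrary element `F = S ψ`. -/
def toF (w : Ext) : Ext := (w.1, w.2 * w.1.2.2)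

/-- `Φ`, acting on `(t, x, ψ, S)` with `ψ ≠ 0`, becomes `Φ'` in terms of `F = S ψ`. -/
def CorrespondsInF (Φ Φ' : OpenPartialHomeomorph Ext Ext) : Prop :=
  (∀ w ∈ Φ.source, w.1.2.2 ≠ 0) ∧ Φ'.source = toF '' Φ.source ∧
    ∀ w ∈ Φ.source, Φ' (toF w) = toF (Φ w)

end NLS

/-! An admissible transformation is classified from the action of its second prolongation on jets of
quadratic polynomials. Above a given point the derivatives `ψ_t`, `ψ_x`, `ψ_tt` are free and the
equation fixes `ψ_xx`, so varying the free ones splits the condition that the image jet solves the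
new equation. Write the transformation as `(τ, ξ, ψ̃)`. Varying `ψ_tt` gives `τ = τ(t)`
(`AdmAt.time`). Varying `ψ_t` gives `ξ_ψ = 0`, `ξ_x² = |τ_t|`, and complex linearity or
antilinearity of `ψ̃` in `ψ` to first order, according to the sign of `τ_t` (`AdmAt.space`). A
second difference in `ψ_x` kills the second `ψ`-derivative (`AdmAt.quadratic`). Integrating over a
ball yields `τ = T(t)`, `ξ = ε|T_t|^{1/2} x + X(t)`, `ψ̃ = k(t,x) ψ̂ + y(t,x)`
(`InfForm.exists_affine`).

Substituting this form (`prolong_affine`, `AdmAt.affine_eq`), the absence of a term in `ψ_x` becomes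
a linear differential equation for `k` in `x`. Its solutions are the exponentials of the theorem, up
to a factor depending on `t`, whose logarithm is `Θ + iΨ`. The summand `y` vanishes because the
nonlinearity is radial in `ψ` before and after the transformation: `y` would move the centre of
symmetry, which forces `S_ρ = 0` (`shift_eq_zero`). This gives `hasBaseForm_of_admTransf`.

Conversely, `prolong_baseMap` shows that an explicit transformation multiplies the left-hand side of
the equation by a nonzero factor, up to conjugation, when `S` is replaced by `sMap`. Hence every
such transformation lifts uniquely to `S` and preserves the class (`exists_transformed_elt`,
`exists_lift`). Normalization and the description of the equivalence group follow, since every point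
of the space of `(t,x,ψ,S)` with `ψ ≠ 0` lies on the graph of some arbitrary element.

Strong normalization needs each explicit transformation to be locally a product of symmetries. If it
moves the time of a point, take `S = ρ` near the old time, the transformed function near the new
time, and interpolate by a cutoff in `t`: the transformation is then locally a symmetry
(`exists_symmetry`). The general case is reduced to this one by a time shift, and shifts are
symmetries of the equation with `S = ρ`. -/

namespace NLS

/-! ### Calculus: derivatives along curves and constancy along segments. -/

section Calculus
variable {E F G : Type*} [NormedAddCommGroup E] [NormedSpace ℝ E] [NormedAddCommGroup F]
  [NormedSpace ℝ F] [NormedAddCommGroup G] [NormedSpace ℝ G]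

theorem smooth_differentiableAt {f : E → F} {x : E} (h : ContDiffAt ℝ ∞ f x) :
    DifferentiableAt ℝ f x := h.differentiableAt (by simp)

theorem smooth_eventually {f : E → F} {x : E} (h : ContDiffAt ℝ ∞ f x) :
    ∀ᶠ y in 𝓝 x, DifferentiableAt ℝ f y := by
  -- `ContDiffAt ℝ ∞` at a point is not an open condition, as the neighbourhoods may shrink with the
  -- order; order one is open and suffices.
  have h1 : ContDiffAt ℝ 1 f x := h.of_le (by norm_cast)
  filter_upwards [h1.eventually (by simp)] with y hy using hy.differentiableAt (by simp)

theorem smooth_fderiv {f : E → F} {x : E} (h : ContDiffAt ℝ ∞ f x) :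
    ContDiffAt ℝ ∞ (fderiv ℝ f) x := h.fderiv_right (m := ∞) (by simp)

theorem smooth_fderiv_apply {f : E → F} {x : E} (h : ContDiffAt ℝ ∞ f x) (v : E) :
    ContDiffAt ℝ ∞ (fun y => fderiv ℝ f y v) x := (smooth_fderiv h).clm_apply contDiffAt_const

theorem smooth_deriv {f : ℝ → F} {x : ℝ} (h : ContDiffAt ℝ ∞ f x) :
    ContDiffAt ℝ ∞ (deriv f) x := by
  simpa [fderiv_apply_one_eq_deriv] using smooth_fderiv_apply h (1 : ℝ)

theorem fderiv_fderiv_apply {f : E → F} {x : E} (h : ContDiffAt ℝ ∞ f x) (v w : E) :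
    fderiv ℝ (fun y => fderiv ℝ f y v) x w = fderiv ℝ (fderiv ℝ f) x w v := by
  rw [fderiv_clm_apply (smooth_differentiableAt (smooth_fderiv h)) (by fun_prop)]
  simp

/-- The second derivative of a function along a curve. -/
theorem deriv_deriv_comp {f : E → F} {γ : ℝ → E} {s : ℝ} (hf : ContDiffAt ℝ ∞ f (γ s))
    (hγ : ContDiffAt ℝ ∞ γ s) :
    deriv (deriv (fun r => f (γ r))) s =
      fderiv ℝ (fderiv ℝ f) (γ s) (deriv γ s) (deriv γ s) +
        fderiv ℝ f (γ s) (deriv (deriv γ) s) := by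
  have h1 : deriv (fun r => f (γ r)) =ᶠ[𝓝 s] fun r => fderiv ℝ f (γ r) (deriv γ r) := by
    filter_upwards [hγ.continuousAt.eventually (smooth_eventually hf), smooth_eventually hγ]
      with r hr hr'
    exact (hr.hasFDerivAt.comp_hasDerivAt r hr'.hasDerivAt).deriv
  rw [h1.deriv_eq]
  have h2 := (smooth_differentiableAt (smooth_fderiv hf)).hasFDerivAt.comp_hasDerivAt s
    (smooth_differentiableAt hγ).hasDerivAt
  have h3 := (smooth_differentiableAt (smooth_deriv hγ)).hasDerivAt
  exact (h2.clm_apply h3).deriv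

theorem deriv_clm_comp (L : E →L[ℝ] F) {γ : ℝ → E} {s : ℝ} (hγ : DifferentiableAt ℝ γ s) :
    deriv (fun r => L (γ r)) s = L (deriv γ s) :=
  (L.hasFDerivAt.comp_hasDerivAt s hγ.hasDerivAt).deriv

theorem deriv_deriv_clm_comp (L : E →L[ℝ] F) {γ : ℝ → E} {s : ℝ} (hγ : ContDiffAt ℝ ∞ γ s) :
    deriv (deriv (fun r => L (γ r))) s = L (deriv (deriv γ) s) := by
  have h1 : deriv (fun r => L (γ r)) =ᶠ[𝓝 s] fun r => L (deriv γ r) := by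
    filter_upwards [smooth_eventually hγ] with r hr
    exact deriv_clm_comp L hr
  rw [h1.deriv_eq, deriv_clm_comp L (smooth_differentiableAt (smooth_deriv hγ))]

/-- A function with vanishing derivatives in the direction of a segment of a convex open set takes
equal values at the endpoints. -/
theorem eq_of_fderiv_eq_zero {f : E → F} {U : Set E} (hU : Convex ℝ U)
    (hf : ∀ z ∈ U, DifferentiableAt ℝ f z) {x y : E} (hx : x ∈ U) (hy : y ∈ U)
    (h : ∀ z ∈ U, fderiv ℝ f z (y - x) = 0) : f x = f y := by
  have hm : ∀ s ∈ Set.Icc (0 : ℝ) 1, AffineMap.lineMap x y s ∈ U := fun s hs =>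
    hU.lineMap_mem hx hy hs
  have hd : ∀ s ∈ Set.Icc (0 : ℝ) 1,
      HasDerivAt (fun s => f (AffineMap.lineMap x y s)) 0 s := by
    intro s hs
    have h1 := (hf _ (hm s hs)).hasFDerivAt.comp_hasDerivAt s
      (AffineMap.hasDerivAt_lineMap (a := x) (b := y) (x := s))
    rwa [h _ (hm s hs)] at h1
  have := constant_of_has_deriv_right_zero (f := fun s => f (AffineMap.lineMap x y s))
    (a := (0 : ℝ)) (b := 1) (fun s hs => (hd s hs).continuousAt.continuousWithinAt)
    (fun s hs => (hd s (Set.Ico_subset_Icc_self hs)).hasDerivWithinAt) 1 (by simp)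
  simpa using this.symm

end Calculus

/-! ### Graphs of functions, their images, and the prolongation formulas. -/

/-- The projection to the independent variables. -/
noncomputable def prj : Base →L[ℝ] ℝ × ℝ :=
  (ContinuousLinearMap.fst ℝ ℝ (ℝ × ℂ)).prod
    ((ContinuousLinearMap.fst ℝ ℝ ℂ).comp (ContinuousLinearMap.snd ℝ ℝ (ℝ × ℂ)))

/-- The projection to the dependent variable. -/
noncomputable def prc : Base →L[ℝ] ℂ :=
  (ContinuousLinearMap.snd ℝ ℝ ℂ).comp (ContinuousLinearMap.snd ℝ ℝ (ℝ × ℂ))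

@[simp] theorem prj_apply (z : Base) : prj z = (z.1, z.2.1) := rfl
@[simp] theorem prc_apply (z : Base) : prc z = z.2.2 := rfl

/-- The parametrization of the graph of a function. -/
def gr (f : ℝ × ℝ → ℂ) (p : ℝ × ℝ) : Base := (p.1, p.2, f p)

theorem smooth_gr {f : ℝ × ℝ → ℂ} {p : ℝ × ℝ} (hf : ContDiffAt ℝ ∞ f p) :
    ContDiffAt ℝ ∞ (gr f) p := contDiffAt_fst.prodMk (contDiffAt_snd.prodMk hf)

theorem fderiv_gr {f : ℝ × ℝ → ℂ} {p : ℝ × ℝ} (hf : DifferentiableAt ℝ f p) (v : ℝ × ℝ) :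
    fderiv ℝ (gr f) p v = (v.1, v.2, fderiv ℝ f p v) := by
  have : HasFDerivAt (gr f) _ p := hasFDerivAt_fst.prodMk (hasFDerivAt_snd.prodMk hf.hasFDerivAt)
  rw [this.fderiv]; rfl

theorem IsPointTransf.contDiffAt {E : Type} [NormedAddCommGroup E] [NormedSpace ℝ E]
    {φ : OpenPartialHomeomorph E E} (h : IsPointTransf φ) {z : E} (hz : z ∈ φ.source) :
    ContDiffAt ℝ ∞ φ z := h.1.contDiffAt (φ.open_source.mem_nhds hz)

theorem IsPointTransf.injective {E : Type} [NormedAddCommGroup E] [NormedSpace ℝ E]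
    {φ : OpenPartialHomeomorph E E} (h : IsPointTransf φ) {z : E} (hz : z ∈ φ.source) :
    Function.Injective (fderiv ℝ φ z) := by
  have h1 := smooth_differentiableAt (h.contDiffAt hz)
  have h2 : DifferentiableAt ℝ φ.symm (φ z) := smooth_differentiableAt
    (h.2.contDiffAt (φ.open_target.mem_nhds (φ.map_source hz)))
  have h3 : (fun y => φ.symm (φ y)) =ᶠ[𝓝 z] id := by
    filter_upwards [φ.open_source.mem_nhds hz] with y hy using φ.left_inv hy
  have h4 := h2.hasFDerivAt.comp z h1.hasFDerivAt
  have h5 := (hasFDerivAt_id (𝕜 := ℝ) z).congr_of_eventuallyEq h3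
  have h6 := h4.unique h5
  intro v w hvw
  have := congrArg (fderiv ℝ φ.symm (φ z)) hvw
  simpa using (DFunLike.congr_fun h6 v).symm.trans (this.trans (DFunLike.congr_fun h6 w))

theorem IsPointTransf.surjective {φ : OpenPartialHomeomorph Base Base} (h : IsPointTransf φ)
    {z : Base} (hz : z ∈ φ.source) : Function.Surjective (fderiv ℝ φ z) :=
  LinearMap.surjective_of_injective (f := (fderiv ℝ φ z : Base →ₗ[ℝ] Base)) (h.injective hz)

theorem IsPointTransf.restr {E : Type} [NormedAddCommGroup E] [NormedSpace ℝ E]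
    {φ : OpenPartialHomeomorph E E} (h : IsPointTransf φ) (W : Set E) :
    IsPointTransf (φ.restr W) := by
  refine ⟨h.1.mono ?_, h.2.mono ?_⟩
  · intro z hz; simp at hz; exact hz.1
  · intro z hz; simp at hz; exact hz.1

/-- A function whose graph is transversal to `φ` has an image under `φ`. -/
theorem exists_image {φ : Base → Base} {f : ℝ × ℝ → ℂ} {p : ℝ × ℝ}
    (hf : ContDiffAt ℝ ∞ f p) (hφ : ContDiffAt ℝ ∞ φ (gr f p))
    (hinj : ∀ v : ℝ × ℝ, prj (fderiv ℝ φ (gr f p) (v.1, v.2, fderiv ℝ f p v)) = 0 → v = 0) :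
    ∃ g : ℝ × ℝ → ℂ, ContDiffAt ℝ ∞ g (prj (φ (gr f p))) ∧
      (∀ᶠ p' in 𝓝 p, φ (gr f p') = gr g (prj (φ (gr f p')))) ∧
      Filter.map (fun p' => prj (φ (gr f p'))) (𝓝 p) = 𝓝 (prj (φ (gr f p))) := by
  set Q : ℝ × ℝ → ℝ × ℝ := fun p' => prj (φ (gr f p')) with hQ
  have hG : ContDiffAt ℝ ∞ (fun p' => φ (gr f p')) p := hφ.comp p (smooth_gr hf)
  have hQs : ContDiffAt ℝ ∞ Q p := prj.contDiff.contDiffAt.comp p hG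
  have hDQ : ∀ v, fderiv ℝ Q p v = prj (fderiv ℝ φ (gr f p) (v.1, v.2, fderiv ℝ f p v)) := by
    intro v
    have h1 : HasFDerivAt Q _ p := prj.hasFDerivAt.comp p
      ((smooth_differentiableAt hφ).hasFDerivAt.comp p
        (smooth_differentiableAt (smooth_gr hf)).hasFDerivAt)
    rw [h1.fderiv]
    simp only [ContinuousLinearMap.comp_apply, fderiv_gr (smooth_differentiableAt hf)]
  have hker : Function.Injective (fderiv ℝ Q p : (ℝ × ℝ) →ₗ[ℝ] ℝ × ℝ) := by
    rw [injective_iff_map_eq_zero]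
    intro v hv
    exact hinj v ((hDQ v).symm.trans hv)
  let e : (ℝ × ℝ) ≃L[ℝ] ℝ × ℝ :=
    (LinearEquiv.ofInjectiveEndo _ hker).toContinuousLinearEquiv
  have he : HasFDerivAt Q (e : (ℝ × ℝ) →L[ℝ] ℝ × ℝ) p := by
    have h1 : (e : (ℝ × ℝ) →L[ℝ] ℝ × ℝ) = fderiv ℝ Q p := ContinuousLinearMap.ext fun v => rfl
    rw [h1]
    exact (smooth_differentiableAt hQs).hasFDerivAt
  have hst := hQs.hasStrictFDerivAt' he (by simp)
  have hinv := hQs.to_localInverse he (by simp)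
  -- The image of the graph is parametrized by its projection `Q` to `(t, x)`, which the inverse
  -- function theorem inverts near `p`.
  refine ⟨fun q => (φ (gr f (hQs.localInverse he (by simp) q))).2.2, ?_, ?_, ?_⟩
  · have hp : hQs.localInverse he (by simp) (Q p) = p := hst.localInverse_apply_image
    have h1 : ContDiffAt ℝ ∞ (fun p' => (φ (gr f p')).2.2)
        (hQs.localInverse he (by simp) (Q p)) := by
      rw [hp]; exact prc.contDiff.contDiffAt.comp p hG
    exact h1.comp _ hinv
  · filter_upwards [hst.eventually_left_inverse] with p' hp'
    have : hQs.localInverse he (by simp) (Q p') = p' := hp'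
    change φ (gr f p') = ((Q p').1, (Q p').2, (φ (gr f (hQs.localInverse he (by simp) (Q p')))).2.2)
    rw [this]
    rfl
  -- `Q` is locally onto, so properties near `p` transfer to properties near the image point;
  -- compositions of prolongations rely on this.
  · exact hst.map_nhds_eq_of_equiv

theorem hasDerivAt_line {E : Type*} [NormedAddCommGroup E] [NormedSpace ℝ E] (p v : E) (s : ℝ) :
    HasDerivAt (fun s : ℝ => p + s • v) v s := by
  simpa using ((hasDerivAt_id s).smul_const v).const_add p

theorem deriv_line {E : Type*} [NormedAddCommGroup E] [NormedSpace ℝ E] (p v : E) :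
    deriv (fun s : ℝ => p + s • v) = fun _ => v := funext fun s => (hasDerivAt_line p v s).deriv

theorem contDiffAt_line {E : Type*} [NormedAddCommGroup E] [NormedSpace ℝ E] (p v : E) (s : ℝ) :
    ContDiffAt ℝ ∞ (fun s : ℝ => p + s • v) s := by fun_prop

theorem tendsto_line {E : Type*} [NormedAddCommGroup E] [NormedSpace ℝ E] (p v : E) :
    Filter.Tendsto (fun s : ℝ => p + s • v) (𝓝 0) (𝓝 p) := by
  simpa using (hasDerivAt_line p v 0).continuousAt.tendsto

/-- The derivatives along a line of the point of the graph of a function. -/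
theorem gr_line {f : ℝ × ℝ → ℂ} {p : ℝ × ℝ} (hf : ContDiffAt ℝ ∞ f p) (v : ℝ × ℝ) :
    deriv (fun s : ℝ => gr f (p + s • v)) 0 = (v.1, v.2, fderiv ℝ f p v) ∧
    deriv (deriv (fun s : ℝ => gr f (p + s • v))) 0 =
      (0, 0, fderiv ℝ (fderiv ℝ f) p v v) := by
  have h0 : ContDiffAt ℝ ∞ f (p + (0 : ℝ) • v) := by simpa using hf
  have hfl : ContDiffAt ℝ ∞ (fun s : ℝ => f (p + s • v)) 0 :=
    ContDiffAt.comp (0 : ℝ) h0 (contDiffAt_line p v 0)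
  have hl : ∀ s, HasDerivAt (fun s : ℝ => (p + s • v).1) v.1 s := fun s =>
    (hasDerivAt_line p v s).fst
  have hl2 : ∀ s, HasDerivAt (fun s : ℝ => (p + s • v).2) v.2 s := fun s =>
    (hasDerivAt_line p v s).snd
  have h1 : deriv (fun s : ℝ => gr f (p + s • v)) =ᶠ[𝓝 0]
      fun s => (v.1, v.2, deriv (fun s : ℝ => f (p + s • v)) s) := by
    filter_upwards [smooth_eventually hfl] with s hs
    exact ((hl s).prodMk ((hl2 s).prodMk hs.hasDerivAt)).deriv
  have h2 : deriv (fun s : ℝ => f (p + s • v)) 0 = fderiv ℝ f p v := by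
    have := (smooth_differentiableAt h0).hasFDerivAt.comp_hasDerivAt (0 : ℝ)
      (hasDerivAt_line p v 0)
    simp only [zero_smul, add_zero] at this
    exact this.deriv
  refine ⟨by rw [h1.self_of_nhds]; simp only [h2], ?_⟩
  rw [h1.deriv_eq]
  have h3 := (smooth_differentiableAt (smooth_deriv hfl)).hasDerivAt
  rw [((hasDerivAt_const (0 : ℝ) v.1).prodMk ((hasDerivAt_const (0 : ℝ) v.2).prodMk h3)).deriv,
    deriv_deriv_comp (γ := fun s : ℝ => p + s • v) h0 (contDiffAt_line p v 0), deriv_line]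
  simp

/-- `φ` maps the graph of `f` near `p` into the graph of `g`. -/
structure Maps (φ : Base → Base) (f g : ℝ × ℝ → ℂ) (p : ℝ × ℝ) : Prop where
  smooth_left : ContDiffAt ℝ ∞ f p
  smooth_map : ContDiffAt ℝ ∞ φ (gr f p)
  smooth_right : ContDiffAt ℝ ∞ g (prj (φ (gr f p)))
  eventually_eq : ∀ᶠ p' in 𝓝 p, φ (gr f p') = gr g (prj (φ (gr f p')))

theorem Maps.fderiv_eq {φ : Base → Base} {f g : ℝ × ℝ → ℂ} {p : ℝ × ℝ} (h : Maps φ f g p)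
    (v : ℝ × ℝ) :
    (fderiv ℝ φ (gr f p) (v.1, v.2, fderiv ℝ f p v)).2.2 =
      fderiv ℝ g (prj (φ (gr f p))) (prj (fderiv ℝ φ (gr f p) (v.1, v.2, fderiv ℝ f p v))) := by
  have h1 : HasFDerivAt (fun p' => φ (gr f p')) _ p :=
    (smooth_differentiableAt h.smooth_map).hasFDerivAt.comp p
      (smooth_differentiableAt (smooth_gr h.smooth_left)).hasFDerivAt
  have h2 := prc.hasFDerivAt.comp p h1
  have h3 := (smooth_differentiableAt h.smooth_right).hasFDerivAt.comp p (prj.hasFDerivAt.comp p h1)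
  have h4 : (fun p' => prc (φ (gr f p'))) =ᶠ[𝓝 p] fun p' => g (prj (φ (gr f p'))) := by
    filter_upwards [h.eventually_eq] with p' hp'
    rw [hp']; simp [gr]
  have h5 := DFunLike.congr_fun (h2.unique (h3.congr_of_eventuallyEq h4)) v
  simpa only [ContinuousLinearMap.comp_apply,
    fderiv_gr (smooth_differentiableAt h.smooth_left), prc_apply] using h5

/-- The second prolongation formula. -/
theorem Maps.fderiv_fderiv_eq {φ : Base → Base} {f g : ℝ × ℝ → ℂ} {p : ℝ × ℝ}
    (h : Maps φ f g p) (v : ℝ × ℝ) {V W : Base} {y : ℝ × ℝ}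
    (hV : V = (v.1, v.2, fderiv ℝ f p v)) (hy : y = prj (fderiv ℝ φ (gr f p) V))
    (hW : W = fderiv ℝ (fderiv ℝ φ) (gr f p) V V +
      fderiv ℝ φ (gr f p) (0, 0, fderiv ℝ (fderiv ℝ f) p v v)) :
    fderiv ℝ (fderiv ℝ g) (prj (φ (gr f p))) y y =
      W.2.2 - fderiv ℝ g (prj (φ (gr f p))) (prj W) := by
  -- The identity between the image curve and the graph of `g` is restricted to a line through `p`
  -- and differentiated twice; only diagonal values of the second derivatives are needed.
  obtain ⟨e1, e2⟩ := gr_line h.smooth_left v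
  have hg0 : gr f (p + (0 : ℝ) • v) = gr f p := by simp
  have hφ0 : ContDiffAt ℝ ∞ φ (gr f (p + (0 : ℝ) • v)) := by rw [hg0]; exact h.smooth_map
  have hgl : ContDiffAt ℝ ∞ (fun s : ℝ => gr f (p + s • v)) 0 :=
    ContDiffAt.comp (0 : ℝ) (smooth_gr (by simpa using h.smooth_left)) (contDiffAt_line p v 0)
  have hΓ : ContDiffAt ℝ ∞ (fun s : ℝ => φ (gr f (p + s • v))) 0 := ContDiffAt.comp (0 : ℝ) hφ0 hgl
  have d1 : deriv (fun s : ℝ => φ (gr f (p + s • v))) 0 = fderiv ℝ φ (gr f p) V := by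
    have := (smooth_differentiableAt hφ0).hasFDerivAt.comp_hasDerivAt (0 : ℝ)
      (smooth_differentiableAt hgl).hasDerivAt
    rw [e1, hg0, ← hV] at this
    exact this.deriv
  have d2 : deriv (deriv (fun s : ℝ => φ (gr f (p + s • v)))) 0 = W := by
    rw [deriv_deriv_comp hφ0 hgl, e1, e2, hg0, hW, ← hV]
  have hQ : ContDiffAt ℝ ∞ (fun s : ℝ => prj (φ (gr f (p + s • v)))) 0 :=
    prj.contDiff.contDiffAt.comp (0 : ℝ) hΓ
  have hg1 : ContDiffAt ℝ ∞ g (prj (φ (gr f (p + (0 : ℝ) • v)))) := by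
    rw [hg0]; exact h.smooth_right
  have h4 : (fun s : ℝ => prc (φ (gr f (p + s • v)))) =ᶠ[𝓝 0]
      fun s => g (prj (φ (gr f (p + s • v)))) := by
    filter_upwards [(tendsto_line p v).eventually h.eventually_eq] with s hs
    rw [hs]; simp [gr]
  have h5 := h4.deriv.deriv_eq
  rw [deriv_deriv_clm_comp prc hΓ, deriv_deriv_comp (γ := fun s : ℝ => prj (φ (gr f (p + s • v)))) hg1 hQ, deriv_deriv_clm_comp prj hΓ,
    deriv_clm_comp prj (smooth_differentiableAt hΓ), d1, d2, hg0, ← hy] at h5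
  simp only [prc_apply] at h5
  rw [h5]; ring

/-! ### Quadratic polynomials as test functions. -/

/-- A quadratic polynomial as a representative of a jet. -/
noncomputable def qpoly (p : ℝ × ℝ) (u a b α c : ℂ) (r : ℝ × ℝ) : ℂ :=
  u + a * (r.1 - p.1 : ℝ) + b * (r.2 - p.2 : ℝ) + α / 2 * ((r.1 - p.1) ^ 2 : ℝ) +
    c / 2 * ((r.2 - p.2) ^ 2 : ℝ)

/-- The linear form `(v₁, v₂) ↦ a v₁ + b v₂`. -/
noncomputable def lform (a b : ℂ) : ℝ × ℝ →L[ℝ] ℂ :=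
  (ContinuousLinearMap.fst ℝ ℝ ℝ).smulRight a + (ContinuousLinearMap.snd ℝ ℝ ℝ).smulRight b

@[simp] theorem lform_apply (a b : ℂ) (v : ℝ × ℝ) : lform a b v = a * v.1 + b * v.2 := by
  simp [lform, mul_comm]

theorem hasFDerivAt_qpoly (p : ℝ × ℝ) (u a b α c : ℂ) (r : ℝ × ℝ) :
    HasFDerivAt (qpoly p u a b α c)
      (lform (a + α * (r.1 - p.1 : ℝ)) (b + c * (r.2 - p.2 : ℝ))) r := by
  have h1 : HasFDerivAt (fun r : ℝ × ℝ => r.1 - p.1) (ContinuousLinearMap.fst ℝ ℝ ℝ) r :=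
    hasFDerivAt_fst.sub_const _
  have h2 : HasFDerivAt (fun r : ℝ × ℝ => r.2 - p.2) (ContinuousLinearMap.snd ℝ ℝ ℝ) r :=
    hasFDerivAt_snd.sub_const _
  have o1 := Complex.ofRealCLM.hasFDerivAt.comp r h1
  have o2 := Complex.ofRealCLM.hasFDerivAt.comp r h2
  have o3 := Complex.ofRealCLM.hasFDerivAt.comp r (h1.pow 2)
  have o4 := Complex.ofRealCLM.hasFDerivAt.comp r (h2.pow 2)
  have := (((o1.const_mul a).const_add u).add (o2.const_mul b)).add (o3.const_mul (α / 2)) |>.add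
    (o4.const_mul (c / 2))
  refine HasFDerivAt.congr_fderiv this ?_
  ext <;> simp <;> ring

theorem contDiff_qpoly (p : ℝ × ℝ) (u a b α c : ℂ) : ContDiff ℝ ∞ (qpoly p u a b α c) := by
  have h1 : ContDiff ℝ ∞ (fun x : ℝ => (x : ℂ)) := Complex.ofRealCLM.contDiff
  unfold qpoly
  have h2 : ∀ F : ℝ × ℝ → ℝ, ContDiff ℝ ∞ F → ContDiff ℝ ∞ (fun r => ((F r : ℝ) : ℂ)) :=
    fun F hF => h1.comp hF
  have h3 := h2 (fun r => r.1 - p.1) (by fun_prop)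
  have h4 := h2 (fun r => r.2 - p.2) (by fun_prop)
  have h5 := h2 (fun r => (r.1 - p.1) ^ 2) (by fun_prop)
  have h6 := h2 (fun r => (r.2 - p.2) ^ 2) (by fun_prop)
  fun_prop

theorem qpoly_self (p : ℝ × ℝ) (u a b α c : ℂ) : qpoly p u a b α c p = u := by simp [qpoly]

theorem gr_qpoly (p : ℝ × ℝ) (u a b α c : ℂ) : gr (qpoly p u a b α c) p = (p.1, p.2, u) := by
  simp [gr, qpoly_self]

theorem fderiv_qpoly (p : ℝ × ℝ) (u a b α c : ℂ) :
    fderiv ℝ (qpoly p u a b α c) p = lform a b := by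
  rw [(hasFDerivAt_qpoly p u a b α c p).fderiv]; simp

theorem fderiv_fderiv_qpoly (p : ℝ × ℝ) (u a b α c : ℂ) (v w : ℝ × ℝ) :
    fderiv ℝ (fderiv ℝ (qpoly p u a b α c)) p v w = α * v.1 * w.1 + c * v.2 * w.2 := by
  rw [← fderiv_fderiv_apply (contDiff_qpoly p u a b α c).contDiffAt]
  have h : (fun r => fderiv ℝ (qpoly p u a b α c) r w) =
      qpoly p (lform a b w) (α * w.1) (c * w.2) 0 0 := by
    ext1 r
    rw [(hasFDerivAt_qpoly p u a b α c r).fderiv]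
    simp [qpoly]; ring
  rw [h, fderiv_qpoly]; simp; ring

theorem jet_qpoly (p : ℝ × ℝ) (u a b α c : ℂ) :
    jet (qpoly p u a b α c) p = ⟨p.1, p.2, u, a, b, α, 0, c⟩ := by
  have h := (contDiff_qpoly p u a b α c).contDiffAt (x := p)
  have e : ∀ v w, fderiv ℝ (fun r => fderiv ℝ (qpoly p u a b α c) r w) p v =
      α * v.1 * w.1 + c * v.2 * w.2 := fun v w => by
    rw [fderiv_fderiv_apply h, fderiv_fderiv_qpoly]
  simp only [jet, Jet2.mk.injEq]
  unfold dt dx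
  simp [e, qpoly_self, fderiv_qpoly]

/-! ### Pointwise determining equations of admissible transformations. -/

/-- Every prolongation of `φ` at the point `z` maps solutions of `iψ_t + ψ_xx + F = 0` to solutions of
`iψ_t + ψ_xx + F' = 0`. -/
def AdmAt (φ : OpenPartialHomeomorph Base Base) (z : Base) (F F' : ℂ) : Prop :=
  ∀ j j', Prolongs φ j j' → j.pt = z → Complex.I * j.ut + j.uxx + F = 0 →
    Complex.I * j'.ut + j'.uxx + F' = 0

theorem Maps.prolongs {φ : OpenPartialHomeomorph Base Base} {f g : ℝ × ℝ → ℂ} {p : ℝ × ℝ}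
    (h : Maps φ f g p) (hz : gr f p ∈ φ.source) :
    Prolongs φ (jet f p) (jet g (prj (φ (gr f p)))) :=
  ⟨f, g, p, prj (φ (gr f p)), h.smooth_left, h.smooth_right, rfl, rfl, hz, h.eventually_eq.self_of_nhds,
    h.eventually_eq.mono fun p' hp' => ⟨prj (φ (gr f p')), hp'⟩⟩

/-- The splitting of a vector along the coordinate directions. -/
theorem clm_split {E : Type*} [NormedAddCommGroup E] [NormedSpace ℝ E] (A : Base →L[ℝ] E)
    (v₁ v₂ : ℝ) (a b : ℂ) :
    A (v₁, v₂, a * v₁ + b * v₂) = v₁ • A (1, 0, a) + v₂ • A (0, 1, b) := by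
  rw [← map_smul, ← map_smul, ← map_add]
  congr 1
  ext <;> (simp; try ring)

theorem clm_add {E : Type*} [NormedAddCommGroup E] [NormedSpace ℝ E] (A : Base →L[ℝ] E)
    (t x : ℝ) (a b : ℂ) : A (t, x, a + b) = A (t, x, a) + A (0, 0, b) := by
  rw [← map_add]; simp

theorem clm_split' {E : Type*} [NormedAddCommGroup E] [NormedSpace ℝ E] (A : Base →L[ℝ] E)
    (t x : ℝ) (a : ℂ) : A (t, x, a) = t • A (1, 0, 0) + x • A (0, 1, 0) + A (0, 0, a) := by
  rw [← map_smul, ← map_smul, ← map_add, ← map_add]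
  simp

/-- The tested jets have free `ψ_t = a`, `ψ_x = b`, `ψ_tt = α`, zero `ψ_tx`, and the value of `ψ_xx`
dictated by the equation. The condition `hΔ` says that the image of the tangent plane of the graph
projects isomorphically to the `(t, x)`-plane, so that the image is again a graph. `D` and `gxx` are
the first derivative and the second `x`-derivative of the image function. Only directions sent to
the new `x`-axis matter for second derivatives, since the new equation contains no others. -/
theorem AdmAt.test {φ : OpenPartialHomeomorph Base Base} (hφ : IsPointTransf φ) {z : Base}
    (hz : z ∈ φ.source) {F F' : ℂ} (h : AdmAt φ z F F') {A : Base →L[ℝ] Base}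
    (hA : A = fderiv ℝ φ z) {B : Base →L[ℝ] Base →L[ℝ] Base}
    (hB : B = fderiv ℝ (fderiv ℝ φ) z) (a b α : ℂ)
    (hΔ : (A (1, 0, a)).1 * (A (0, 1, b)).2.1 - (A (0, 1, b)).1 * (A (1, 0, a)).2.1 ≠ 0) :
    ∃ (D : ℝ × ℝ →L[ℝ] ℂ) (gxx : ℂ),
      (∀ v : ℝ × ℝ, (A (v.1, v.2, a * v.1 + b * v.2)).2.2 =
        D (prj (A (v.1, v.2, a * v.1 + b * v.2)))) ∧
      (∀ (v : ℝ × ℝ) (k : ℝ) (V W : Base), V = (v.1, v.2, a * v.1 + b * v.2) →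
        prj (A V) = (0, k) →
        W = B V V + A (0, 0, α * v.1 ^ 2 + (-Complex.I * a - F) * v.2 ^ 2) →
        k ^ 2 * gxx = W.2.2 - D (prj W)) ∧
      Complex.I * D (1, 0) + gxx + F' = 0 := by
  set f := qpoly (z.1, z.2.1) z.2.2 a b α (-Complex.I * a - F) with hf
  set p : ℝ × ℝ := (z.1, z.2.1) with hp
  have hgr : gr f p = z := gr_qpoly _ _ _ _ _ _
  have hfs : ContDiffAt ℝ ∞ f p := (contDiff_qpoly _ _ _ _ _ _).contDiffAt
  have hDf : fderiv ℝ f p = lform a b := fderiv_qpoly _ _ _ _ _ _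
  have hφs : ContDiffAt ℝ ∞ φ (gr f p) := by rw [hgr]; exact hφ.contDiffAt hz
  obtain ⟨g, hg, hev, -⟩ := exists_image hfs hφs (by
    intro v hv
    rw [hgr, hDf, ← hA, lform_apply, clm_split] at hv
    have h1 := congrArg Prod.fst hv
    have h2 := congrArg Prod.snd hv
    simp only [prj_apply, Prod.fst_add, Prod.smul_fst, Prod.snd_add, Prod.smul_snd, smul_eq_mul,
      Prod.fst_zero, Prod.snd_zero] at h1 h2
    have e1 : v.1 * ((A (1, 0, a)).1 * (A (0, 1, b)).2.1 - (A (0, 1, b)).1 * (A (1, 0, a)).2.1)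
      = 0 := by linear_combination (A (0, 1, b)).2.1 * h1 - (A (0, 1, b)).1 * h2
    have e2 : v.2 * ((A (1, 0, a)).1 * (A (0, 1, b)).2.1 - (A (0, 1, b)).1 * (A (1, 0, a)).2.1)
      = 0 := by linear_combination (A (1, 0, a)).1 * h2 - (A (1, 0, a)).2.1 * h1
    exact Prod.ext ((mul_eq_zero.1 e1).resolve_right hΔ) ((mul_eq_zero.1 e2).resolve_right hΔ))
  have hM : Maps φ f g p := ⟨hfs, hφs, hg, hev⟩
  have hpr := hM.prolongs (by rw [hgr]; exact hz)
  have hsol := h _ _ hpr (by rw [jet_qpoly]; rfl) (by rw [jet_qpoly]; simp only; ring)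
  set q := prj (φ (gr f p)) with hq
  have hxx : (jet g q).uxx = fderiv ℝ (fderiv ℝ g) q (0, 1) (0, 1) := by
    rw [← fderiv_fderiv_apply hg]; rfl
  refine ⟨fderiv ℝ g q, fderiv ℝ (fderiv ℝ g) q (0, 1) (0, 1), ?_, ?_, ?_⟩
  · intro v
    have := hM.fderiv_eq v
    rwa [← hq, hDf, hgr, ← hA, lform_apply] at this
  · intro v k V W hV hk hW
    have := hM.fderiv_fderiv_eq v (V := V) (W := W) (y := (0, k)) (by rw [hV, hDf, lform_apply])
      (by rw [hgr, ← hA, hk]) (by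
        rw [hgr, ← hA, ← hB, hW, hf, fderiv_fderiv_qpoly]
        congr 4; ring)
    rw [← this]
    have hk' : ((0 : ℝ), k) = k • ((0 : ℝ), (1 : ℝ)) := by simp
    rw [hk', map_smul, map_smul, _root_.smul_apply]
    simp only [Complex.real_smul]
    ring
  · rw [hxx] at hsol; exact hsol

/-- Admissibility forces `τ_x + τ_ψ ψ_x = 0`. -/
theorem AdmAt.time_dir {φ : OpenPartialHomeomorph Base Base} (hφ : IsPointTransf φ) {z : Base}
    (hz : z ∈ φ.source) {F F' : ℂ} (h : AdmAt φ z F F') {A : Base →L[ℝ] Base}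
    (hA : A = fderiv ℝ φ z) (a b : ℂ)
    (hΔ : (A (1, 0, a)).1 * (A (0, 1, b)).2.1 - (A (0, 1, b)).1 * (A (1, 0, a)).2.1 ≠ 0) :
    (A (0, 1, b)).1 = 0 := by
  -- The two test jets differ only in `ψ_tt`. Their images have the same first derivatives, hence by
  -- the new equation also the same second `x`-derivative.
  obtain ⟨D, g0, h1, h2, h3⟩ := h.test hφ hz hA rfl a b 0 hΔ
  obtain ⟨D', g1, k1, k2, k3⟩ := h.test hφ hz hA rfl a b 1 hΔ
  set δ := (A (1, 0, a)).1 * (A (0, 1, b)).2.1 - (A (0, 1, b)).1 * (A (1, 0, a)).2.1 with hδ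
  have hsurj : ∀ y : ℝ × ℝ, ∃ v : ℝ × ℝ, prj (A (v.1, v.2, a * v.1 + b * v.2)) = y := by
    intro y
    refine ⟨((y.1 * (A (0, 1, b)).2.1 - y.2 * (A (0, 1, b)).1) / δ,
      (y.2 * (A (1, 0, a)).1 - y.1 * (A (1, 0, a)).2.1) / δ), ?_⟩
    rw [clm_split]
    ext
    · simp; field_simp; rw [hδ]; ring
    · simp; field_simp; rw [hδ]; ring
  have hD : D' = D := by
    ext1
    all_goals
      ext1
      simp only [ContinuousLinearMap.comp_apply]
      obtain ⟨v, hv⟩ := hsurj (1, 0)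
      obtain ⟨w, hw⟩ := hsurj (0, 1)
      have e1 := (k1 v).symm.trans (h1 v)
      have e2 := (k1 w).symm.trans (h1 w)
      rw [hv] at e1
      rw [hw] at e2
      simpa
  subst hD
  have hg : g1 = g0 := by linear_combination k3 - h3
  -- For the direction `v` sent to the new `x`-axis, comparing the two second derivatives leaves
  -- only the image `X` of the vertical vector with entry `v.1²`; it must be tangent to the image
  -- graph.
  obtain ⟨v, hv⟩ := hsurj (0, 1)
  have e0 := h2 v 1 _ _ rfl hv rfl
  have e1 := k2 v 1 _ _ rfl hv rfl
  rw [add_comm (1 * (v.1 : ℂ) ^ 2), clm_add A] at e1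
  simp only [zero_mul, zero_add] at e0
  rw [← add_assoc] at e1
  rw [hg, e0] at e1
  simp only [Prod.snd_add, map_add] at e1
  set X := A (0, 0, 1 * (v.1 : ℂ) ^ 2) with hX
  have e2 : X.2.2 = D' (prj X) := by linear_combination -e1
  -- A vector tangent to the image graph comes from a vector tangent to the original one. Since `X`
  -- also comes from a vertical vector, injectivity forces `v.1 = 0`: the new `x`-axis corresponds
  -- to the old one.
  obtain ⟨w, hw⟩ := hsurj (prj X)
  have e3 : A (w.1, w.2, a * w.1 + b * w.2) = X := by
    have := h1 w
    rw [hw, ← e2] at this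
    have h4 := congrArg Prod.fst hw
    have h5 := congrArg Prod.snd hw
    exact Prod.ext h4 (Prod.ext h5 this)
  have e4 : ((w.1, w.2, a * w.1 + b * w.2) : Base) = (0, 0, 1 * (v.1 : ℂ) ^ 2) :=
    hφ.injective hz (by rw [← hA]; exact e3)
  simp only [Prod.mk.injEq] at e4
  obtain ⟨w1, w2, w3⟩ := e4
  rw [w1, w2] at w3
  have hv1 : v.1 = 0 := by simpa using w3.symm
  have hv2 := congrArg Prod.fst hv
  have hv3 := congrArg Prod.snd hv
  rw [clm_split, hv1] at hv2 hv3
  simp at hv2 hv3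
  rcases hv2 with h' | h'
  · rw [h'] at hv3; simp at hv3
  · exact h'

/-- Admissibility forces `τ` to depend on `t` only. -/
theorem AdmAt.time {φ : OpenPartialHomeomorph Base Base} (hφ : IsPointTransf φ) {z : Base}
    (hz : z ∈ φ.source) {F F' : ℂ} (h : AdmAt φ z F F') (x : ℝ) (u : ℂ) :
    (fderiv ℝ φ z (0, x, u)).1 = 0 := by
  obtain ⟨A, hA⟩ : ∃ A, A = fderiv ℝ φ z := ⟨_, rfl⟩
  rw [← hA]
  have hdir := h.time_dir hφ hz hA
  obtain ⟨v, hv⟩ := hφ.surjective hz (1, 0, 0)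
  obtain ⟨w, hw⟩ := hφ.surjective hz (0, 1, 0)
  rw [← hA] at hv hw
  -- If every plane were non-transversal, all coefficients of this polynomial in `(a, b)` would
  -- vanish. They represent the minors of the `t`- and `x`-rows of the derivative, which would then
  -- be dependent, contrary to surjectivity.
  have hex : ∃ a b, (A (1, 0, a)).1 * (A (0, 1, b)).2.1 -
      (A (0, 1, b)).1 * (A (1, 0, a)).2.1 ≠ 0 := by
    by_contra! hne
    have hne' : ∀ a b : ℂ, ((A (1, 0, 0)).1 + (A (0, 0, a)).1) * ((A (0, 1, 0)).2.1 + (A (0, 0, b)).2.1)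
      - ((A (0, 1, 0)).1 + (A (0, 0, b)).1) * ((A (1, 0, 0)).2.1 + (A (0, 0, a)).2.1) = 0 := by
      intro a b
      have := hne a b
      rw [clm_split' A 1 0 a, clm_split' A 0 1 b] at this
      simpa using this
    have z0 := hne' 0 0
    have za : ∀ a : ℂ, (A (0, 0, a)).1 * (A (0, 1, 0)).2.1 -
        (A (0, 1, 0)).1 * (A (0, 0, a)).2.1 = 0 := by
      intro a
      have := hne' a 0
      have e0 : A (0, 0, (0 : ℂ)) = 0 := map_zero A
      rw [e0] at this z0
      simp at this z0
      linear_combination this - z0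
    have zb : ∀ b : ℂ, (A (1, 0, 0)).1 * (A (0, 0, b)).2.1 -
        (A (0, 0, b)).1 * (A (1, 0, 0)).2.1 = 0 := by
      intro b
      have := hne' 0 b
      have e0 : A (0, 0, (0 : ℂ)) = 0 := map_zero A
      rw [e0] at this z0
      simp at this z0
      linear_combination this - z0
    have zab : ∀ a b : ℂ, (A (0, 0, a)).1 * (A (0, 0, b)).2.1 -
        (A (0, 0, b)).1 * (A (0, 0, a)).2.1 = 0 := by
      intro a b
      have e0 : A (0, 0, (0 : ℂ)) = 0 := map_zero A
      rw [e0] at z0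
      simp at z0
      linear_combination hne' a b - za a - zb b - z0
    have e0 : A (0, 0, (0 : ℂ)) = 0 := map_zero A
    rw [e0] at z0
    simp at z0
    rw [show v = (v.1, v.2.1, v.2.2) from rfl, clm_split'] at hv
    rw [show w = (w.1, w.2.1, w.2.2) from rfl, clm_split'] at hw
    have v1 := congrArg (fun y => y.1) hv
    have v2 := congrArg (fun y => y.2.1) hv
    have w1 := congrArg (fun y => y.1) hw
    have w2 := congrArg (fun y => y.2.1) hw
    simp only [Prod.fst_add, Prod.smul_fst, Prod.snd_add, Prod.smul_snd, smul_eq_mul]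
      at v1 v2 w1 w2
    have key : (v.1 * (A (1, 0, 0)).1 + v.2.1 * (A (0, 1, 0)).1 + (A (0, 0, v.2.2)).1) *
      (w.1 * (A (1, 0, 0)).2.1 + w.2.1 * (A (0, 1, 0)).2.1 + (A (0, 0, w.2.2)).2.1) -
      (w.1 * (A (1, 0, 0)).1 + w.2.1 * (A (0, 1, 0)).1 + (A (0, 0, w.2.2)).1) *
      (v.1 * (A (1, 0, 0)).2.1 + v.2.1 * (A (0, 1, 0)).2.1 + (A (0, 0, v.2.2)).2.1) = 0 := by
      linear_combination (v.1 * w.2.1 - v.2.1 * w.1) * z0 + v.1 * zb w.2.2 - w.1 * zb v.2.2 +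
        w.2.1 * za v.2.2 - v.2.1 * za w.2.2 + zab v.2.2 w.2.2
    rw [v1, v2, w1, w2] at key
    norm_num at key
  obtain ⟨a, b, hab⟩ := hex
  have hb := hdir a b hab
  -- The determinant is affine in `b`, so its nonzero value at `b` is the mean of the values at `b +
  -- c` and `b - c`. At least one of these is nonzero, and either choice yields `τ_ψ c = 0`.
  have hu : ∀ c : ℂ, (A (0, 0, c)).1 = 0 := by
    intro c
    have hsplit : ∀ c : ℂ, (A (1, 0, a)).1 * (A (0, 1, b + c)).2.1 -
        (A (0, 1, b + c)).1 * (A (1, 0, a)).2.1 ≠ 0 → (A (0, 0, c)).1 = 0 := by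
      intro c hc
      have := hdir a (b + c) hc
      rw [clm_add] at this
      simpa [hb] using this
    by_cases hc : (A (1, 0, a)).1 * (A (0, 1, b + c)).2.1 -
        (A (0, 1, b + c)).1 * (A (1, 0, a)).2.1 = 0
    · have hn : A (0, 0, -c) = -A (0, 0, c) := by rw [← map_neg]; simp
      have := hsplit (-c) (by
        intro hc'
        rw [clm_add] at hc hc'
        rw [hn] at hc'
        simp only [Prod.fst_add, Prod.snd_add, Prod.fst_neg, Prod.snd_neg] at hc hc'
        apply hab
        linear_combination (hc + hc') / 2)
      rw [hn] at this
      simpa using this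
    · exact hsplit c hc
  have hx : (A (0, 1, 0)).1 = 0 := by
    rw [clm_split'] at hb
    simpa [hu b] using hb
  rw [clm_split']
  simp [hx, hu u]

/-- Differentiates a first-order restriction that holds on a neighbourhood. It removes the second
derivatives of `τ` and `ξ` once `τ` depends on `t` only and `ξ` does not depend on `ψ`. -/
theorem fst_fderiv_fderiv {φ : Base → Base} {z : Base} (hφ : ContDiffAt ℝ ∞ φ z) {L : Base →L[ℝ] ℝ}
    {V : Base} {k : ℝ} (h : ∀ᶠ z' in 𝓝 z, L (fderiv ℝ φ z' V) = k) (W : Base) :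
    L (fderiv ℝ (fderiv ℝ φ) z W V) = 0 := by
  rw [← fderiv_fderiv_apply hφ]
  have h1 : HasFDerivAt (fun y => L (fderiv ℝ φ y V)) _ z :=
    L.hasFDerivAt.comp z (smooth_differentiableAt (smooth_fderiv_apply hφ V)).hasFDerivAt
  have h2 : (fun y => L (fderiv ℝ φ y V)) =ᶠ[𝓝 z] fun _ => k := h
  have h3 := h1.unique ((hasFDerivAt_const k z).congr_of_eventuallyEq h2)
  exact DFunLike.congr_fun h3 W

/-- The coordinates `t` and `x` as linear forms. -/
noncomputable def prt : Base →L[ℝ] ℝ := ContinuousLinearMap.fst ℝ ℝ (ℝ × ℂ)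
noncomputable def prx : Base →L[ℝ] ℝ :=
  (ContinuousLinearMap.fst ℝ ℝ ℂ).comp (ContinuousLinearMap.snd ℝ ℝ (ℝ × ℂ))

@[simp] theorem prt_apply (z : Base) : prt z = z.1 := rfl
@[simp] theorem prx_apply (z : Base) : prx z = z.2.1 := rfl


/-- Testing admissibility with the jets that have the given `ψ_t` and `ψ_x`, when `τ = τ(t)`. -/
theorem AdmAt.test_time {φ : OpenPartialHomeomorph Base Base} (hφ : IsPointTransf φ) {z : Base}
    (hz : z ∈ φ.source) {F F' : ℂ} (h : AdmAt φ z F F')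
    (hev : ∀ᶠ z' in 𝓝 z, ∀ x u, (fderiv ℝ φ z' (0, x, u)).1 = 0) {A : Base →L[ℝ] Base}
    (hA : A = fderiv ℝ φ z) {B : Base →L[ℝ] Base →L[ℝ] Base}
    (hB : B = fderiv ℝ (fderiv ℝ φ) z) (a b : ℂ) (hT : (A (1, 0, 0)).1 ≠ 0)
    (hP : (A (0, 1, b)).2.1 ≠ 0) :
    ∃ gt gx gxx : ℂ, (A (0, 1, b)).2.2 = (A (0, 1, b)).2.1 * gx ∧
      (A (1, 0, a)).2.2 = (A (1, 0, 0)).1 * gt + (A (1, 0, a)).2.1 * gx ∧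
      (A (0, 1, b)).2.1 ^ 2 * gxx = (B (0, 1, b) (0, 1, b)).2.2 -
        (B (0, 1, b) (0, 1, b)).2.1 * gx + ((A (0, 0, -Complex.I * a - F)).2.2 -
        (A (0, 0, -Complex.I * a - F)).2.1 * gx) ∧
      Complex.I * gt + gxx + F' = 0 := by
  have h0 : ∀ x u, (A (0, x, u)).1 = 0 := by rw [hA]; exact hev.self_of_nhds
  have ht : ∀ a, (A (1, 0, a)).1 = (A (1, 0, 0)).1 := by
    intro a
    rw [clm_split']
    simp [h0]
  obtain ⟨D, gxx, h1, h2, h3⟩ := h.test hφ hz hA hB a b 0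
    (by rw [ht, h0]; simpa using ⟨hT, hP⟩)
  have hD : ∀ s r : ℝ, D (s, r) = s * D (1, 0) + r * D (0, 1) := by
    intro s r
    have : ((s, r) : ℝ × ℝ) = s • ((1 : ℝ), (0 : ℝ)) + r • ((0 : ℝ), (1 : ℝ)) := by simp
    rw [this, map_add, map_smul, map_smul, Complex.real_smul, Complex.real_smul]
  refine ⟨D (1, 0), D (0, 1), gxx, ?_, ?_, ?_, h3⟩
  · have := h1 (0, 1)
    simp only [Complex.ofReal_zero, Complex.ofReal_one, mul_zero, mul_one, zero_add] at this
    rw [this, prj_apply, hD, h0]; simp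
  · have := h1 (1, 0)
    simp only [Complex.ofReal_zero, Complex.ofReal_one, mul_zero, mul_one, add_zero] at this
    rw [this, prj_apply, hD, ht]
  · have := h2 (0, 1) (A (0, 1, b)).2.1 (0, 1, b) _ (by simp) (by simp [h0]) rfl
    rw [this, prj_apply, hD]
    have hB0 : (B (0, 1, b) (0, 1, b)).1 = 0 := by
      rw [hB]
      exact fst_fderiv_fderiv (L := prt) (hφ.contDiffAt hz) (hev.mono fun z' hz' => hz' 1 b) _
    simp only [Complex.ofReal_zero, Complex.ofReal_one, Prod.fst_add, Prod.snd_add, hB0, h0]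
    simp
    ring

theorem AdmAt.time_ne {φ : OpenPartialHomeomorph Base Base} (hφ : IsPointTransf φ) {z : Base}
    (hz : z ∈ φ.source) (h0 : ∀ x u, (fderiv ℝ φ z (0, x, u)).1 = 0) :
    (fderiv ℝ φ z (1, 0, 0)).1 ≠ 0 := by
  intro hT
  obtain ⟨v, hv⟩ := hφ.surjective hz (1, 0, 0)
  rw [show v = (v.1, v.2.1, v.2.2) from rfl, clm_split'] at hv
  have := congrArg Prod.fst hv
  simp [h0, hT] at this

/-- Let `T = τ_t`, `P = ξ_x + ξ_ψ b`, and let `M(a)` be the `ψ̃`-component of the image of the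
vertical vector `a`, corrected by the slope of the image graph. Changing `ψ_t` by `a` changes `ψ_xx`
by `-ia`, and comparison gives `T M(ia) = i P² M(a)` whenever `P ≠ 0`. The cases `a = 1` and `a = i`
give `T² = P⁴`. Hence `P (P² - |T|)` vanishes for all `b`, which excludes a dependence of `P` on
`b`, so `ξ_ψ = 0`. Then `M` is the plain `ψ`-derivative, and the relation expresses its linearity or
antilinearity over `ℂ`. -/
theorem AdmAt.space {φ : OpenPartialHomeomorph Base Base} (hφ : IsPointTransf φ) {z : Base}
    (hz : z ∈ φ.source) {F F' : ℂ} (h : AdmAt φ z F F')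
    (hev : ∀ᶠ z' in 𝓝 z, ∀ x u, (fderiv ℝ φ z' (0, x, u)).1 = 0) {A : Base →L[ℝ] Base}
    (hA : A = fderiv ℝ φ z) :
    (∀ u, (A (0, 0, u)).2.1 = 0) ∧ (A (0, 1, 0)).2.1 ^ 2 = |(A (1, 0, 0)).1| ∧
    (∀ u, (A (1, 0, 0)).1 * (A (0, 0, Complex.I * u)).2.2 =
      Complex.I * |(A (1, 0, 0)).1| * (A (0, 0, u)).2.2) ∧ (A (0, 0, 1)).2.2 ≠ 0 := by
  have h0 : ∀ x u, (A (0, x, u)).1 = 0 := by rw [hA]; exact hev.self_of_nhds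
  have hT : (A (1, 0, 0)).1 ≠ 0 := by
    rw [hA]; exact AdmAt.time_ne hφ hz hev.self_of_nhds
  have hAinj : Function.Injective A := by rw [hA]; exact hφ.injective hz
  set T := (A (1, 0, 0)).1 with hTdef
  have key : ∀ b : ℂ, (A (0, 1, b)).2.1 ≠ 0 → ∃ gx : ℂ,
      (∀ a, (A (0, 0, a)).2.2 - (A (0, 0, a)).2.1 * gx = 0 → a = 0) ∧
      ∀ a, T * ((A (0, 0, Complex.I * a)).2.2 - (A (0, 0, Complex.I * a)).2.1 * gx) =
        Complex.I * (A (0, 1, b)).2.1 ^ 2 * ((A (0, 0, a)).2.2 - (A (0, 0, a)).2.1 * gx) := by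
    intro b hP
    obtain ⟨gt, gx, gxx, e1, e2, e3, e4⟩ := h.test_time hφ hz hev hA rfl 0 b hT hP
    have hPc : ((A (0, 1, b)).2.1 : ℂ) ≠ 0 := by exact_mod_cast hP
    refine ⟨gx, ?_, ?_⟩
    -- `M(a) = 0` would make the image of a vertical vector proportional to the image of a tangent
    -- vector of the graph, so injectivity gives `a = 0`.
    · intro a ha
      have h1 : (A (0, 1, b)).2.1 • A (0, 0, a) = (A (0, 0, a)).2.1 • A (0, 1, b) := by
        refine Prod.ext (by simp [h0]) (Prod.ext (by simp; ring) ?_)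
        simp only [Prod.smul_snd, Complex.real_smul]
        linear_combination (A (0, 1, b)).2.1 * ha - (A (0, 0, a)).2.1 * e1
      rw [← map_smul, ← map_smul] at h1
      have h2 := hAinj h1
      simp only [Prod.smul_mk, Prod.mk.injEq, Complex.real_smul, smul_eq_mul] at h2
      obtain ⟨-, h3, h4⟩ := h2
      have h5 : (A (0, 0, a)).2.1 = 0 := by linarith
      rw [h5] at h4
      simpa [hP] using h4
    · intro a
      obtain ⟨gt', gx', gxx', f1, f2, f3, f4⟩ := h.test_time hφ hz hev hA rfl a b hT hP
      have hgx : gx' = gx := mul_left_cancel₀ hPc (f1.symm.trans e1)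
      subst hgx
      have n1 : A (1, 0, a) = A (1, 0, 0) + A (0, 0, a) := by rw [← map_add]; simp
      have n2 : A (0, 0, -Complex.I * a - F) = A (0, 0, -Complex.I * 0 - F) -
          A (0, 0, Complex.I * a) := by rw [← map_sub]; simp; ring_nf
      rw [n1] at f2
      rw [n2] at f3
      simp only [Prod.fst_add, Prod.snd_add, Prod.fst_sub, Prod.snd_sub, Complex.ofReal_add,
        Complex.ofReal_sub] at f2 f3
      linear_combination T * (f3 - e3) + T * (A (0, 1, b)).2.1 ^ 2 * (e4 - f4) +
        Complex.I * (A (0, 1, b)).2.1 ^ 2 * (e2 - f2)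
  have hP4 : ∀ b : ℂ, (A (0, 1, b)).2.1 ≠ 0 → (A (0, 1, b)).2.1 ^ 2 = |T| := by
    intro b hP
    obtain ⟨gx, hM, hR⟩ := key b hP
    have m1 := hR 1
    have mI := hR Complex.I
    have hM1 : (A (0, 0, 1)).2.2 - (A (0, 0, 1)).2.1 * gx ≠ 0 := fun h => one_ne_zero (hM 1 h)
    have hneg : A (0, 0, Complex.I * Complex.I) = -A (0, 0, 1) := by rw [← map_neg]; simp
    rw [hneg] at mI
    rw [mul_one] at m1
    simp only [Prod.fst_neg, Prod.snd_neg, Complex.ofReal_neg] at mI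
    have h4 : ((T : ℂ) ^ 2 - ((A (0, 1, b)).2.1 : ℂ) ^ 4) *
        ((A (0, 0, 1)).2.2 - (A (0, 0, 1)).2.1 * gx) = 0 := by
      linear_combination -T * mI - Complex.I * (A (0, 1, b)).2.1 ^ 2 * m1 -
        ((A (0, 1, b)).2.1 : ℂ) ^ 4 * ((A (0, 0, 1)).2.2 - (A (0, 0, 1)).2.1 * gx) * Complex.I_sq
    have h5 := (mul_eq_zero.1 h4).resolve_right hM1
    have h6 : T ^ 2 = ((A (0, 1, b)).2.1 ^ 2) ^ 2 := by
      have : ((T ^ 2 - (A (0, 1, b)).2.1 ^ 4 : ℝ) : ℂ) = 0 := by push_cast; exact h5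
      have := Complex.ofReal_eq_zero.1 this
      linarith
    rw [← abs_of_nonneg (sq_nonneg (A (0, 1, b)).2.1)]
    exact (sq_eq_sq_iff_abs_eq_abs _ _).1 h6.symm
  have hcub : ∀ b : ℂ, (A (0, 1, b)).2.1 * ((A (0, 1, b)).2.1 ^ 2 - |T|) = 0 := by
    intro b
    by_cases hb : (A (0, 1, b)).2.1 = 0
    · simp [hb]
    · rw [hP4 b hb]; ring
  have hu : ∀ u, (A (0, 0, u)).2.1 = 0 := by
    intro u
    have hs : ∀ s : ℝ, (A (0, 1, s * u)).2.1 = (A (0, 1, 0)).2.1 + s * (A (0, 0, u)).2.1 := by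
      intro s
      have : ((0, 1, s * u) : Base) = (0, 1, 0) + s • (0, 0, u) := by simp
      rw [this, map_add, map_smul]; simp
    -- The third difference of a cubic polynomial at `0, 1, 2, 3` is six times its leading
    -- coefficient.
    have c0 := hcub ((0 : ℝ) * u)
    have c1 := hcub ((1 : ℝ) * u)
    have c2 := hcub ((2 : ℝ) * u)
    have c3 := hcub ((3 : ℝ) * u)
    rw [hs] at c0 c1 c2 c3
    have : 6 * (A (0, 0, u)).2.1 ^ 3 = 0 := by linear_combination c3 - 3 * c2 + 3 * c1 - c0
    simpa using this
  have hP0 : (A (0, 1, 0)).2.1 ≠ 0 := by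
    intro hP
    obtain ⟨v, hv⟩ := hφ.surjective hz (0, 1, 0)
    rw [← hA, show v = (v.1, v.2.1, v.2.2) from rfl, clm_split'] at hv
    have v1 := congrArg Prod.fst hv
    have v2 := congrArg (fun y => y.2.1) hv
    simp [h0, hu, hP] at v1 v2
    rcases v1 with v1 | v1
    · simp [v1] at v2
    · exact hT v1
  obtain ⟨gx, hM, hR⟩ := key 0 hP0
  refine ⟨hu, hP4 0 hP0, ?_, ?_⟩
  · intro u
    have := hR u
    rw [hu, hu] at this
    have hc : ((A (0, 1, 0)).2.1 : ℂ) ^ 2 = (|T| : ℝ) := by exact_mod_cast hP4 0 hP0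
    rw [hc] at this
    simpa using this
  · intro h1
    exact one_ne_zero (hM 1 (by rw [h1, hu]; simp))

/-- With `ψ_t = 0` fixed, the slope of the image graph is affine in `b = ψ_x`, and the transformed
equation is quadratic in `b`, the quadratic part coming only from the second `ψ`-derivative of `ψ̃`.
The symmetric second difference at `b, 0, -b` isolates it. -/
theorem AdmAt.quadratic {φ : OpenPartialHomeomorph Base Base} (hφ : IsPointTransf φ) {z : Base}
    (hz : z ∈ φ.source) {F F' : ℂ} (h : AdmAt φ z F F')
    (hev : ∀ᶠ z' in 𝓝 z, ∀ x u, (fderiv ℝ φ z' (0, x, u)).1 = 0)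
    (hev' : ∀ᶠ z' in 𝓝 z, ∀ u, (fderiv ℝ φ z' (0, 0, u)).2.1 = 0) (b : ℂ) :
    (fderiv ℝ (fderiv ℝ φ) z (0, 0, b) (0, 0, b)).2.2 = 0 := by
  obtain ⟨A, hA⟩ : ∃ A, A = fderiv ℝ φ z := ⟨_, rfl⟩
  obtain ⟨B, hB⟩ : ∃ B, B = fderiv ℝ (fderiv ℝ φ) z := ⟨_, rfl⟩
  rw [← hB]
  have h0 : ∀ x u, (A (0, x, u)).1 = 0 := by rw [hA]; exact hev.self_of_nhds
  have hT : (A (1, 0, 0)).1 ≠ 0 := by rw [hA]; exact AdmAt.time_ne hφ hz hev.self_of_nhds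
  obtain ⟨hu, hsq, -, -⟩ := h.space hφ hz hev hA
  have hP : (A (0, 1, 0)).2.1 ≠ 0 := by
    intro h0
    rw [h0] at hsq
    exact hT (abs_eq_zero.1 (by simpa using hsq.symm))
  have hPc : ((A (0, 1, 0)).2.1 : ℂ) ≠ 0 := by exact_mod_cast hP
  have hTc : ((A (1, 0, 0)).1 : ℂ) ≠ 0 := by exact_mod_cast hT
  have hsplit : ∀ c, A (0, 1, c) = A (0, 1, 0) + A (0, 0, c) := by
    intro c; rw [← map_add]; simp
  have hPb : ∀ c, (A (0, 1, c)).2.1 = (A (0, 1, 0)).2.1 := by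
    intro c
    rw [hsplit]; simp [hu]
  have hBx : ∀ V c, (B V (0, 0, c)).2.1 = 0 := by
    intro V c
    rw [hB]
    exact fst_fderiv_fderiv (L := prx) (hφ.contDiffAt hz) (hev'.mono fun z' hz' => hz' c) V
  have hBx' : ∀ c, (B (0, 0, c) (0, 1, 0)).2.1 = 0 := by
    intro c
    have hsym : IsSymmSndFDerivAt ℝ φ z := (hφ.contDiffAt hz).isSymmSndFDerivAt (by simp; norm_cast)
    rw [hB, hsym.eq, ← hB, hBx]
  have hBs : ∀ c, B (0, 1, c) (0, 1, c) = B (0, 1, 0) (0, 1, 0) + B (0, 1, 0) (0, 0, c) +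
      B (0, 0, c) (0, 1, 0) + B (0, 0, c) (0, 0, c) := by
    intro c
    have : ((0, 1, c) : Base) = (0, 1, 0) + (0, 0, c) := by simp
    rw [this, map_add, map_add, _root_.add_apply, _root_.add_apply]
    abel
  -- The slope is kept as an unknown `gx` tied to `c` by a linear relation, while the second
  -- derivative of the image function is eliminated through the new equation.
  have eqn : ∀ c, ∃ gx : ℂ, (A (0, 1, 0)).2.2 + (A (0, 0, c)).2.2 = (A (0, 1, 0)).2.1 * gx ∧
      (A (1, 0, 0)).1 * ((B (0, 1, 0) (0, 1, 0)).2.2 + (B (0, 1, 0) (0, 0, c)).2.2 +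
      (B (0, 0, c) (0, 1, 0)).2.2 + (B (0, 0, c) (0, 0, c)).2.2 -
      (B (0, 1, 0) (0, 1, 0)).2.1 * gx + (A (0, 0, -F)).2.2) +
      (A (0, 1, 0)).2.1 ^ 2 * (Complex.I * ((A (1, 0, 0)).2.2 - (A (1, 0, 0)).2.1 * gx) +
        (A (1, 0, 0)).1 * F') = 0 := by
    intro c
    obtain ⟨gt, gx, gxx, e1, e2, e3, e4⟩ := h.test_time hφ hz hev hA hB 0 c hT
      (by rw [hPb]; exact hP)
    refine ⟨gx, ?_, ?_⟩
    · rw [hPb] at e1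
      rw [← e1, hsplit c]; simp
    · rw [hPb, hBs] at e3
      simp only [Prod.fst_add, Prod.snd_add, hBx, hBx', hu, mul_zero, zero_sub, add_zero,
        Complex.ofReal_zero, zero_mul, sub_zero] at e3
      linear_combination -(A (1, 0, 0)).1 * e3 + (A (0, 1, 0)).2.1 ^ 2 * Complex.I * e2 +
        (A (0, 1, 0)).2.1 ^ 2 * (A (1, 0, 0)).1 * e4
  obtain ⟨g0, p0, q0⟩ := eqn 0
  obtain ⟨g1, p1, q1⟩ := eqn b
  obtain ⟨g2, p2, q2⟩ := eqn (-b)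
  have hn : ((0, 0, -b) : Base) = -(0, 0, b) := by simp
  have hz0 : ((0, 0, (0 : ℂ)) : Base) = 0 := rfl
  rw [hn] at p2 q2
  rw [hz0] at p0 q0
  simp only [map_neg, map_zero, _root_.neg_apply, _root_.zero_apply, Prod.snd_neg, neg_neg,
    Prod.snd_zero, add_zero] at p0 q0 p2 q2
  have hg : g1 + g2 - 2 * g0 = 0 := by
    have : ((A (0, 1, 0)).2.1 : ℂ) * (g1 + g2 - 2 * g0) = 0 := by
      linear_combination 2 * p0 - p1 - p2
    exact (mul_eq_zero.1 this).resolve_left hPc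
  have : ((A (1, 0, 0)).1 : ℂ) * (B (0, 0, b) (0, 0, b)).2.2 = 0 := by
    linear_combination (q1 + q2 - 2 * q0) / 2 + ((A (1, 0, 0)).1 * (B (0, 1, 0) (0, 1, 0)).2.1 +
      (A (0, 1, 0)).2.1 ^ 2 * Complex.I * (A (1, 0, 0)).2.1) / 2 * hg
  exact (mul_eq_zero.1 this).resolve_left hTc

/-! ### The operation `β ↦ β̂` -/

/-- `hat` as a real-linear map. -/
noncomputable def hatL (τ : ℝ) : ℂ →L[ℝ] ℂ :=
  if 0 < τ then ContinuousLinearMap.id ℝ ℂ else Complex.conjCLE.toContinuousLinearMap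

@[simp] theorem hatL_apply (τ : ℝ) (β : ℂ) : hatL τ β = hat τ β := by
  unfold hatL hat; split_ifs <;> simp

theorem hat_mul (τ : ℝ) (a b : ℂ) : hat τ (a * b) = hat τ a * hat τ b := by
  unfold hat; split_ifs <;> simp

theorem hat_add (τ : ℝ) (a b : ℂ) : hat τ (a + b) = hat τ a + hat τ b := by
  unfold hat; split_ifs <;> simp

theorem hat_sub (τ : ℝ) (a b : ℂ) : hat τ (a - b) = hat τ a - hat τ b := by
  unfold hat; split_ifs <;> simp

@[simp] theorem hat_hat (τ : ℝ) (a : ℂ) : hat τ (hat τ a) = a := by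
  unfold hat; split_ifs <;> simp

@[simp] theorem hat_zero (τ : ℝ) : hat τ 0 = 0 := by unfold hat; split_ifs <;> simp

@[simp] theorem hat_one (τ : ℝ) : hat τ 1 = 1 := by unfold hat; split_ifs <;> simp

@[simp] theorem norm_hat (τ : ℝ) (a : ℂ) : ‖hat τ a‖ = ‖a‖ := by unfold hat; split_ifs <;> simp

@[simp] theorem hat_eq_zero {τ : ℝ} {a : ℂ} : hat τ a = 0 ↔ a = 0 := by
  rw [← norm_eq_zero, norm_hat, norm_eq_zero]

theorem hat_ofReal (τ r : ℝ) : hat τ r = r := by unfold hat; split_ifs <;> simp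

theorem hat_I_mul {τ : ℝ} (hτ : τ ≠ 0) (a : ℂ) :
    hat τ (Complex.I * a) = Real.sign τ * Complex.I * hat τ a := by
  unfold hat
  rcases lt_or_gt_of_ne hτ with h | h
  · rw [Real.sign_of_neg h]; simp [h.not_gt]
  · rw [Real.sign_of_pos h]; simp [h]

theorem hat_congr {τ τ' : ℝ} (h : 0 < τ ↔ 0 < τ') : hat τ = hat τ' := by
  funext β; simp only [hat, h]

theorem sign_mul_self_eq_abs {τ : ℝ} : Real.sign τ * τ = |τ| := by
  rcases lt_trichotomy τ 0 with h | h | h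
  · rw [Real.sign_of_neg h, abs_of_neg h]; ring
  · simp [h]
  · rw [Real.sign_of_pos h, abs_of_pos h]; ring

/-! ### Partial derivatives -/

theorem dx_eq_of_hasDerivAt {f : ℝ × ℝ → ℂ} {p : ℝ × ℝ} {d : ℂ} (hf : DifferentiableAt ℝ f p)
    (h : HasDerivAt (fun s => f (p.1, s)) d p.2) : dx f p = d := by
  have h1 : HasDerivAt (fun s : ℝ => ((p.1, s) : ℝ × ℝ)) (0, 1) p.2 :=
    (hasDerivAt_const _ _).prodMk (hasDerivAt_id _)
  exact (HasFDerivAt.comp_hasDerivAt p.2 (f := fun s : ℝ => ((p.1, s) : ℝ × ℝ))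
    hf.hasFDerivAt h1).unique h

theorem dt_eq_of_hasDerivAt {f : ℝ × ℝ → ℂ} {p : ℝ × ℝ} {d : ℂ} (hf : DifferentiableAt ℝ f p)
    (h : HasDerivAt (fun s => f (s, p.2)) d p.1) : dt f p = d := by
  have h1 : HasDerivAt (fun s : ℝ => ((s, p.2) : ℝ × ℝ)) (1, 0) p.1 :=
    (hasDerivAt_id _).prodMk (hasDerivAt_const _ _)
  exact (HasFDerivAt.comp_hasDerivAt p.1 (f := fun s : ℝ => ((s, p.2) : ℝ × ℝ))
    hf.hasFDerivAt h1).unique h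

theorem smooth_dx {f : ℝ × ℝ → ℂ} {p : ℝ × ℝ} (hf : ContDiffAt ℝ ∞ f p) :
    ContDiffAt ℝ ∞ (dx f) p := smooth_fderiv_apply hf (0, 1)

theorem fderiv_add_mul_hat {h f y : ℝ × ℝ → ℂ} {p : ℝ × ℝ} (hh : DifferentiableAt ℝ h p)
    (hf : DifferentiableAt ℝ f p) (hy : DifferentiableAt ℝ y p) (τ : ℝ) (v : ℝ × ℝ) :
    fderiv ℝ (fun p' => h p' * hat τ (f p') + y p') p v =
      fderiv ℝ h p v * hat τ (f p) + h p * hat τ (fderiv ℝ f p v) + fderiv ℝ y p v := by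
  have h1 : HasFDerivAt (fun p' => hat τ (f p')) ((hatL τ).comp (fderiv ℝ f p)) p := by
    have := (hatL τ).hasFDerivAt.comp p hf.hasFDerivAt
    have e : (hatL τ ∘ f) = fun p' => hat τ (f p') := funext fun p' => hatL_apply _ _
    rwa [e] at this
  have h2 : HasFDerivAt (fun p' => h p' * hat τ (f p') + y p') _ p :=
    (hh.hasFDerivAt.mul h1).add hy.hasFDerivAt
  rw [h2.fderiv]
  simp
  ring

theorem dx_dx_add_mul_hat {h f y : ℝ × ℝ → ℂ} {p : ℝ × ℝ} (hh : ContDiffAt ℝ ∞ h p)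
    (hf : ContDiffAt ℝ ∞ f p) (hy : ContDiffAt ℝ ∞ y p) (τ : ℝ) :
    dx (dx (fun p' => h p' * hat τ (f p') + y p')) p =
      dx (dx h) p * hat τ (f p) + 2 * dx h p * hat τ (dx f p) + h p * hat τ (dx (dx f) p) +
        dx (dx y) p := by
  have h1 : dx (fun p' => h p' * hat τ (f p') + y p') =ᶠ[𝓝 p]
      fun p' => dx h p' * hat τ (f p') + (h p' * hat τ (dx f p') + dx y p') := by
    filter_upwards [smooth_eventually hh, smooth_eventually hf, smooth_eventually hy]
      with p' a b c
    simp only [dx, fderiv_add_mul_hat a b c]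
    ring
  have hs : ∀ {k : ℝ × ℝ → ℂ}, ContDiffAt ℝ ∞ k p → DifferentiableAt ℝ k p :=
    smooth_differentiableAt
  have h2 : DifferentiableAt ℝ (fun p' => h p' * hat τ (dx f p') + dx y p') p := by
    have : DifferentiableAt ℝ (fun p' => hatL τ (dx f p')) p :=
      (hatL τ).differentiableAt.comp p (hs (smooth_dx hf))
    simp only [hatL_apply] at this
    exact ((hs hh).mul this).add (hs (smooth_dx hy))
  have h3 := fderiv_add_mul_hat (hs (smooth_dx hh)) (hs hf) h2 τ (0, 1)
  have h4 := fderiv_add_mul_hat (hs hh) (hs (smooth_dx hf)) (hs (smooth_dx hy)) τ (0, 1)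
  rw [h4] at h3
  rw [dx, h1.fderiv_eq, h3]
  simp only [dx]
  ring

/-- The chain rule for the change of independent variables `(t, x) ↦ (T(t), c(t) x + X(t))`. -/
theorem chain_affine {g N : ℝ × ℝ → ℂ} {T c X : ℝ → ℝ} {p q : ℝ × ℝ}
    (hq : q = (T p.1, c p.1 * p.2 + X p.1)) (hg : ContDiffAt ℝ ∞ g q) (hN : ContDiffAt ℝ ∞ N p)
    (hT : DifferentiableAt ℝ T p.1) (hc : DifferentiableAt ℝ c p.1)
    (hX : DifferentiableAt ℝ X p.1)
    (h : ∀ᶠ p' in 𝓝 p, g (T p'.1, c p'.1 * p'.2 + X p'.1) = N p') :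
    dx g q * c p.1 = dx N p ∧
    dt g q * deriv T p.1 + dx g q * (deriv c p.1 * p.2 + deriv X p.1 : ℝ) = dt N p ∧
    dx (dx g) q * c p.1 ^ 2 = dx (dx N) p := by
  have hgd := smooth_differentiableAt hg
  have hD : ∀ s r : ℝ, fderiv ℝ g q (s, r) = s * dt g q + r * dx g q := by
    intro s r
    have : ((s, r) : ℝ × ℝ) = s • ((1 : ℝ), (0 : ℝ)) + r • ((0 : ℝ), (1 : ℝ)) := by simp
    rw [this, map_add, map_smul, map_smul, Complex.real_smul, Complex.real_smul]
    rfl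
  have ht : HasDerivAt (fun s : ℝ => ((T s, c s * p.2 + X s) : ℝ × ℝ))
      (deriv T p.1, deriv c p.1 * p.2 + deriv X p.1) p.1 :=
    hT.hasDerivAt.prodMk ((hc.hasDerivAt.mul_const _).add hX.hasDerivAt)
  have ht' := HasFDerivAt.comp_hasDerivAt p.1 (f := fun s : ℝ => ((T s, c s * p.2 + X s) : ℝ × ℝ))
    (by rw [← hq]; exact hgd.hasFDerivAt) ht
  rw [hD] at ht'
  have hl : Filter.Tendsto (fun s : ℝ => ((s, p.2) : ℝ × ℝ)) (𝓝 p.1) (𝓝 p) :=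
    (continuous_id.prodMk continuous_const).tendsto' _ _ rfl
  have et : dt N p = deriv T p.1 * dt g q + (deriv c p.1 * p.2 + deriv X p.1 : ℝ) * dx g q :=
    dt_eq_of_hasDerivAt (smooth_differentiableAt hN) <| ht'.congr_of_eventuallyEq <| by
      filter_upwards [hl.eventually h] with s hs using hs.symm
  have hline : ∀ᶠ s : ℝ in 𝓝 0, N (p + s • (0, 1)) = g (q + s • (0, c p.1)) := by
    filter_upwards [(tendsto_line p (0, 1)).eventually h] with s hs
    rw [← hs, hq]
    congr 2 <;> simp
    ring
  have hq0 : ContDiffAt ℝ ∞ g (q + (0 : ℝ) • ((0, c p.1) : ℝ × ℝ)) := by simpa using hg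
  have hp0 : ContDiffAt ℝ ∞ N (p + (0 : ℝ) • ((0, 1) : ℝ × ℝ)) := by simpa using hN
  have hline' : (fun s : ℝ => N (p + s • (0, 1))) =ᶠ[𝓝 0] fun s => g (q + s • (0, c p.1)) := hline
  have e1 := hline'.deriv_eq
  have e2 := hline'.deriv.deriv_eq
  have d1 : ∀ {k : ℝ × ℝ → ℂ} {r v : ℝ × ℝ}, ContDiffAt ℝ ∞ k (r + (0 : ℝ) • v) →
      deriv (fun s : ℝ => k (r + s • v)) 0 = fderiv ℝ k r v := by
    intro k r v hk
    have := HasFDerivAt.comp_hasDerivAt (0 : ℝ) (f := fun s : ℝ => r + s • v)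
      (smooth_differentiableAt hk).hasFDerivAt (hasDerivAt_line r v 0)
    simp only [zero_smul, add_zero] at this
    exact this.deriv
  have d2 : ∀ {k : ℝ × ℝ → ℂ} {r v : ℝ × ℝ}, ContDiffAt ℝ ∞ k (r + (0 : ℝ) • v) →
      deriv (deriv (fun s : ℝ => k (r + s • v))) 0 = fderiv ℝ (fderiv ℝ k) r v v := by
    intro k r v hk
    rw [deriv_deriv_comp (γ := fun s : ℝ => r + s • v) hk (contDiffAt_line r v 0), deriv_line]
    simp
  rw [d1 hp0, d1 hq0, hD] at e1
  rw [d2 hp0, d2 hq0] at e2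
  have hxx : ∀ {k : ℝ × ℝ → ℂ} {r : ℝ × ℝ}, ContDiffAt ℝ ∞ k r →
      dx (dx k) r = fderiv ℝ (fderiv ℝ k) r (0, 1) (0, 1) := fun hk =>
    fderiv_fderiv_apply hk (0, 1) (0, 1)
  have hcv : ((0, c p.1) : ℝ × ℝ) = c p.1 • ((0 : ℝ), (1 : ℝ)) := by simp
  refine ⟨?_, ?_, ?_⟩
  · change _ = fderiv ℝ N p (0, 1)
    rw [e1]; simp; ring
  · rw [et]; ring
  · rw [hxx hg, hxx hN, e2, hcv, map_smul, map_smul, _root_.smul_apply]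
    simp only [Complex.real_smul]; ring

/-! ### The equation under transformations affine in `ψ̂`. -/

/-- The linear operator that governs the transformed equation. -/
noncomputable def lop (σ κ : ℝ) (N : ℝ × ℝ → ℂ) (p : ℝ × ℝ) : ℂ :=
  dx (dx N) p + σ * Complex.I * (dt N p - κ * dx N p)

/-- The master identity behind both directions of the classification, with `ψ̃ = h ψ̂ + y` and `κ =
ξ_t / ξ_x`. Conjugation replaces `i` by `-i` exactly when `T_t < 0`, and this sign is compensated by
passing from `T_t` to `|T_t|`. The coefficient of `ψ̂_x` restricts `h`, that of `ψ̂` produces the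
shift of `S`, and `y` contributes an inhomogeneity. -/
theorem prolong_affine {f g h y : ℝ × ℝ → ℂ} {T c X : ℝ → ℝ} {p q : ℝ × ℝ} {κ : ℝ}
    (hq : q = (T p.1, c p.1 * p.2 + X p.1)) (hg : ContDiffAt ℝ ∞ g q) (hf : ContDiffAt ℝ ∞ f p)
    (hh : ContDiffAt ℝ ∞ h p) (hy : ContDiffAt ℝ ∞ y p)
    (hT : DifferentiableAt ℝ T p.1) (hc : DifferentiableAt ℝ c p.1)
    (hX : DifferentiableAt ℝ X p.1) (hT0 : deriv T p.1 ≠ 0) (hcT : c p.1 ^ 2 = |deriv T p.1|)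
    (hκ : κ * c p.1 = deriv c p.1 * p.2 + deriv X p.1)
    (hev : ∀ᶠ p' in 𝓝 p, g (T p'.1, c p'.1 * p'.2 + X p'.1) =
      h p' * hat (deriv T p.1) (f p') + y p') :
    (|deriv T p.1| : ℝ) * (Complex.I * dt g q + dx (dx g) q) =
      h p * hat (deriv T p.1) (Complex.I * dt f p + dx (dx f) p) +
      (2 * dx h p - Real.sign (deriv T p.1) * Complex.I * κ * h p) * hat (deriv T p.1) (dx f p) +
      lop (Real.sign (deriv T p.1)) κ h p * hat (deriv T p.1) (f p) +
      lop (Real.sign (deriv T p.1)) κ y p := by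
  set τ := deriv T p.1 with hτ
  have hN : ContDiffAt ℝ ∞ (fun p' => h p' * hat τ (f p') + y p') p := by
    have : ContDiffAt ℝ ∞ (fun p' => hatL τ (f p')) p :=
      (hatL τ).contDiff.contDiffAt.comp p hf
    simp only [hatL_apply] at this
    exact (hh.mul this).add hy
  obtain ⟨e1, e2, e3⟩ := chain_affine hq hg hN hT hc hX hev
  rw [dx_dx_add_mul_hat hh hf hy] at e3
  have hs : ∀ {k : ℝ × ℝ → ℂ}, ContDiffAt ℝ ∞ k p → DifferentiableAt ℝ k p :=
    smooth_differentiableAt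
  have e4 := fderiv_add_mul_hat (hs hh) (hs hf) (hs hy) τ (0, 1)
  have e5 := fderiv_add_mul_hat (hs hh) (hs hf) (hs hy) τ (1, 0)
  rw [show dx (fun p' => h p' * hat τ (f p') + y p') p = _ from e4] at e1
  rw [show dt (fun p' => h p' * hat τ (f p') + y p') p = _ from e5, ← hκ] at e2
  have hcc : (c p.1 : ℂ) ^ 2 = (|τ| : ℝ) := by exact_mod_cast hcT
  have hτs : ((|τ| : ℝ) : ℂ) = Real.sign τ * τ := by exact_mod_cast sign_mul_self_eq_abs.symm
  rw [hat_add, hat_I_mul hT0, mul_add, ← hcc]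
  nth_rewrite 1 [hcc]
  rw [hτs, mul_comm _ (dx (dx g) q), e3]
  unfold lop
  change dx g q * _ = dx h p * hat τ (f p) + h p * hat τ (dx f p) + dx y p at e1
  change _ = dt h p * hat τ (f p) + h p * hat τ (dt f p) + dt y p at e2
  push_cast at e2
  linear_combination Real.sign τ * Complex.I * e2 - Real.sign τ * Complex.I * κ * e1

theorem iteratedDeriv_two' (T : ℝ → ℝ) : iteratedDeriv 2 T = deriv (deriv T) := by
  rw [iteratedDeriv_succ, iteratedDeriv_one]

theorem iteratedDeriv_three' (T : ℝ → ℝ) : iteratedDeriv 3 T = deriv (deriv (deriv T)) := by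
  rw [iteratedDeriv_succ, iteratedDeriv_two']

/-! ### The parameter functions and the exponential factor. -/

section Params
variable {T X Θ Ψ : ℝ → ℝ} {ε t : ℝ}

theorem ParamsAt.smooth_T (h : ParamsAt T X Θ Ψ ε t) : ContDiffAt ℝ ∞ T t :=
  h.1.self_of_nhds.1
theorem ParamsAt.smooth_X (h : ParamsAt T X Θ Ψ ε t) : ContDiffAt ℝ ∞ X t :=
  h.1.self_of_nhds.2.1
theorem ParamsAt.smooth_Θ (h : ParamsAt T X Θ Ψ ε t) : ContDiffAt ℝ ∞ Θ t :=
  h.1.self_of_nhds.2.2.1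
theorem ParamsAt.smooth_Ψ (h : ParamsAt T X Θ Ψ ε t) : ContDiffAt ℝ ∞ Ψ t :=
  h.1.self_of_nhds.2.2.2

theorem ParamsAt.eps_sq (h : ParamsAt T X Θ Ψ ε t) : ε ^ 2 = 1 := by
  rcases h.2.2 with h | h <;> rw [h] <;> norm_num

theorem ParamsAt.eps_ne (h : ParamsAt T X Θ Ψ ε t) : ε ≠ 0 := by
  rcases h.2.2 with h | h <;> rw [h] <;> norm_num

theorem ParamsAt.eventually (h : ParamsAt T X Θ Ψ ε t) : ∀ᶠ s in 𝓝 t, ParamsAt T X Θ Ψ ε s := by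
  have h1 := (smooth_deriv h.smooth_T).continuousAt.eventually_ne h.2.1
  filter_upwards [h.1.eventually_nhds, h1] with s hs hs' using ⟨hs, hs', h.2.2⟩

theorem sign_eventually {f : ℝ → ℝ} (hf : ContinuousAt f t) (h0 : f t ≠ 0) :
    ∀ᶠ s in 𝓝 t, (0 < f s ↔ 0 < f t) ∧ Real.sign (f s) = Real.sign (f t) := by
  rcases lt_or_gt_of_ne h0 with h | h
  · filter_upwards [hf.eventually_lt_const h] with s hs
    exact ⟨by simp [hs.not_gt, h.not_gt], by rw [Real.sign_of_neg hs, Real.sign_of_neg h]⟩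
  · filter_upwards [hf.eventually_const_lt h] with s hs
    exact ⟨by simp [hs, h], by rw [Real.sign_of_pos hs, Real.sign_of_pos h]⟩

theorem ParamsAt.sign_eventually (h : ParamsAt T X Θ Ψ ε t) :
    ∀ᶠ s in 𝓝 t, (0 < deriv T s ↔ 0 < deriv T t) ∧ Real.sign (deriv T s) = Real.sign (deriv T t) :=
  NLS.sign_eventually (smooth_deriv h.smooth_T).continuousAt h.2.1

theorem ParamsAt.sqrt_pos (h : ParamsAt T X Θ Ψ ε t) : 0 < √|deriv T t| :=
  Real.sqrt_pos.2 (abs_pos.2 h.2.1)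

end Params

/-- The factor of `x` in the transformation of `x`. -/
noncomputable def cfun (T : ℝ → ℝ) (ε t : ℝ) : ℝ := ε * √|deriv T t|

/-- The exponent in the transformation of `ψ`: the coefficients of `x²` and `x`. -/
noncomputable def afun (T : ℝ → ℝ) (t : ℝ) : ℝ := 1 / 8 * (deriv (deriv T) t / |deriv T t|)
noncomputable def bfun (T X : ℝ → ℝ) (ε t : ℝ) : ℝ :=
  1 / 2 * (ε * Real.sign (deriv T t) * deriv X t / √|deriv T t|)

/-- The factor of `ψ̂` in the transformation of `ψ`. -/
noncomputable def efac (T X Θ Ψ : ℝ → ℝ) (ε : ℝ) (p : ℝ × ℝ) : ℂ :=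
  Complex.exp (Complex.I * ((afun T p.1 * p.2 ^ 2 + bfun T X ε p.1 * p.2 : ℝ) : ℂ) + (Θ p.1 : ℂ) +
    Complex.I * (Ψ p.1 : ℂ))

theorem baseMap_eq (T X Θ Ψ : ℝ → ℝ) (ε : ℝ) (z : Base) :
    baseMap T X Θ Ψ 0 ε z = (T z.1, cfun T ε z.1 * z.2.1 + X z.1,
      hat (deriv T z.1) z.2.2 * efac T X Θ Ψ ε (z.1, z.2.1)) := by
  simp only [baseMap, efac, cfun, afun, bfun, iteratedDeriv_two', Pi.zero_apply, add_zero]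
  congr 2
  ring

theorem sMap_eq (T X Θ Ψ : ℝ → ℝ) (ε : ℝ) (z : Base) (s : ℂ) :
    sMap T X Θ Ψ ε (z, s) = hat (deriv T z.1) s / (|deriv T z.1| : ℝ) + sMap T X Θ Ψ ε (z, 0) := by
  simp only [sMap, hat_zero, zero_div]
  ring

theorem norm_efac (T X Θ Ψ : ℝ → ℝ) (ε : ℝ) (p : ℝ × ℝ) :
    ‖efac T X Θ Ψ ε p‖ = Real.exp (Θ p.1) := by
  rw [efac, Complex.norm_exp]
  congr 1
  simp only [Complex.add_re, Complex.mul_re, Complex.I_re, Complex.I_im, Complex.ofReal_re,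
    Complex.ofReal_im]
  ring

theorem efac_ne (T X Θ Ψ : ℝ → ℝ) (ε : ℝ) (p : ℝ × ℝ) : efac T X Θ Ψ ε p ≠ 0 := Complex.exp_ne_zero _

section Params
variable {T X Θ Ψ : ℝ → ℝ} {ε t : ℝ}

theorem ParamsAt.smooth_abs (h : ParamsAt T X Θ Ψ ε t) :
    ContDiffAt ℝ ∞ (fun s => |deriv T s|) t :=
  ContDiffAt.comp t (contDiffAt_abs h.2.1) (smooth_deriv h.smooth_T)

theorem ParamsAt.smooth_sqrt (h : ParamsAt T X Θ Ψ ε t) :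
    ContDiffAt ℝ ∞ (fun s => √|deriv T s|) t :=
  h.smooth_abs.sqrt (abs_pos.2 h.2.1).ne'

theorem ParamsAt.smooth_sign (h : ParamsAt T X Θ Ψ ε t) :
    ContDiffAt ℝ ∞ (fun s => Real.sign (deriv T s)) t :=
  contDiffAt_const.congr_of_eventuallyEq (h.sign_eventually.mono fun _ hs => hs.2)

theorem ParamsAt.smooth_cfun (h : ParamsAt T X Θ Ψ ε t) : ContDiffAt ℝ ∞ (cfun T ε) t :=
  contDiffAt_const.mul h.smooth_sqrt

theorem ParamsAt.smooth_afun (h : ParamsAt T X Θ Ψ ε t) : ContDiffAt ℝ ∞ (afun T) t :=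
  contDiffAt_const.mul ((smooth_deriv (smooth_deriv h.smooth_T)).div h.smooth_abs
    (abs_pos.2 h.2.1).ne')

theorem ParamsAt.smooth_bfun (h : ParamsAt T X Θ Ψ ε t) : ContDiffAt ℝ ∞ (bfun T X ε) t :=
  contDiffAt_const.mul (((contDiffAt_const.mul h.smooth_sign).mul (smooth_deriv h.smooth_X)).div
    h.smooth_sqrt h.sqrt_pos.ne')

theorem smooth_ofReal {E : Type*} [NormedAddCommGroup E] [NormedSpace ℝ E] {f : E → ℝ} {x : E}
    (h : ContDiffAt ℝ ∞ f x) : ContDiffAt ℝ ∞ (fun y => (f y : ℂ)) x :=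
  Complex.ofRealCLM.contDiff.contDiffAt.comp x h

theorem smooth_fst {E F : Type*} [NormedAddCommGroup E] [NormedSpace ℝ E] [NormedAddCommGroup F]
    [NormedSpace ℝ F] {f : ℝ → F} {p : ℝ × E} (h : ContDiffAt ℝ ∞ f p.1) :
    ContDiffAt ℝ ∞ (fun p : ℝ × E => f p.1) p := ContDiffAt.comp p h contDiffAt_fst

theorem smooth_efac {p : ℝ × ℝ} (h : ParamsAt T X Θ Ψ ε p.1) :
    ContDiffAt ℝ ∞ (efac T X Θ Ψ ε) p := by
  have h1 := smooth_ofReal (((smooth_fst h.smooth_afun).mul (contDiffAt_snd.pow 2)).add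
    ((smooth_fst h.smooth_bfun).mul contDiffAt_snd))
  exact (((contDiffAt_const.mul h1).add (smooth_ofReal (smooth_fst h.smooth_Θ))).add
    (contDiffAt_const.mul (smooth_ofReal (smooth_fst h.smooth_Ψ)))).cexp

/-- Writing `T_t = σ r²` replaces the modulus, its square root and the sign by polynomial
expressions, so that the identities below become algebraic. -/
theorem ParamsAt.abs_eq (h : ParamsAt T X Θ Ψ ε t) :
    ∃ σ r : ℝ, (σ = 1 ∨ σ = -1) ∧ 0 < r ∧ deriv T t = σ * r ^ 2 ∧ |deriv T t| = r ^ 2 ∧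
      √|deriv T t| = r ∧ Real.sign (deriv T t) = σ := by
  have hr : √|deriv T t| ^ 2 = |deriv T t| := Real.sq_sqrt (abs_nonneg _)
  rcases lt_or_gt_of_ne h.2.1 with h' | h'
  · exact ⟨-1, _, Or.inr rfl, h.sqrt_pos, by rw [hr, abs_of_neg h']; ring, hr.symm, rfl,
      Real.sign_of_neg h'⟩
  · exact ⟨1, _, Or.inl rfl, h.sqrt_pos, by rw [hr, abs_of_pos h']; ring, hr.symm, rfl,
      Real.sign_of_pos h'⟩

theorem ParamsAt.hasDerivAt_abs (h : ParamsAt T X Θ Ψ ε t) :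
    HasDerivAt (fun s => |deriv T s|) (Real.sign (deriv T t) * deriv (deriv T) t) t := by
  have h1 := (smooth_differentiableAt (smooth_deriv h.smooth_T)).hasDerivAt
  have h2 : (fun s => |deriv T s|) =ᶠ[𝓝 t] fun s => Real.sign (deriv T t) * deriv T s := by
    filter_upwards [h.sign_eventually] with s hs
    rw [← hs.2, sign_mul_self_eq_abs]
  exact (h1.const_mul _).congr_of_eventuallyEq h2

theorem ParamsAt.hasDerivAt_sqrt (h : ParamsAt T X Θ Ψ ε t) :
    HasDerivAt (fun s => √|deriv T s|)
      (Real.sign (deriv T t) * deriv (deriv T) t / (2 * √|deriv T t|)) t :=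
  h.hasDerivAt_abs.sqrt (abs_pos.2 h.2.1).ne'

theorem ParamsAt.deriv_cfun (h : ParamsAt T X Θ Ψ ε t) :
    deriv (cfun T ε) t = ε * (Real.sign (deriv T t) * deriv (deriv T) t / (2 * √|deriv T t|)) :=
  (h.hasDerivAt_sqrt.const_mul ε).deriv

theorem ParamsAt.deriv_afun (h : ParamsAt T X Θ Ψ ε t) :
    deriv (afun T) t = 1 / 8 * ((deriv (deriv (deriv T)) t * |deriv T t| -
      deriv (deriv T) t * (Real.sign (deriv T t) * deriv (deriv T) t)) / |deriv T t| ^ 2) := by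
  have h1 := (smooth_differentiableAt (smooth_deriv (smooth_deriv h.smooth_T))).hasDerivAt
  exact ((h1.div h.hasDerivAt_abs (abs_pos.2 h.2.1).ne').const_mul _).deriv

theorem ParamsAt.deriv_bfun (h : ParamsAt T X Θ Ψ ε t) :
    deriv (bfun T X ε) t = 1 / 2 * ((ε * Real.sign (deriv T t) * deriv (deriv X) t * √|deriv T t| -
      ε * Real.sign (deriv T t) * deriv X t *
        (Real.sign (deriv T t) * deriv (deriv T) t / (2 * √|deriv T t|))) / √|deriv T t| ^ 2) := by
  have h1 := (smooth_differentiableAt (smooth_deriv h.smooth_X)).hasDerivAt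
  have h2 : bfun T X ε =ᶠ[𝓝 t]
      fun s => 1 / 2 * (ε * Real.sign (deriv T t) * deriv X s / √|deriv T s|) := by
    filter_upwards [h.sign_eventually] with s hs
    rw [bfun, hs.2]
  rw [h2.deriv_eq]
  exact (((h1.const_mul _).div h.hasDerivAt_sqrt h.sqrt_pos.ne').const_mul _).deriv

theorem ParamsAt.deriv_quot (h : ParamsAt T X Θ Ψ ε t) :
    deriv (fun s => deriv X s / deriv T s) t =
      (deriv (deriv X) t * deriv T t - deriv X t * deriv (deriv T) t) / deriv T t ^ 2 := by
  have h1 := (smooth_differentiableAt (smooth_deriv h.smooth_X)).hasDerivAt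
  have h2 := (smooth_differentiableAt (smooth_deriv h.smooth_T)).hasDerivAt
  exact (h1.div h2 h.2.1).deriv

/-- The ratio `ξ_t / ξ_x`. -/
noncomputable def kfun (T X : ℝ → ℝ) (ε : ℝ) (p : ℝ × ℝ) : ℝ :=
  2 * Real.sign (deriv T p.1) * (2 * afun T p.1 * p.2 + bfun T X ε p.1)

/-- This explains the exponent in `ψ̃`. With `σ = sign T_t` and `h = exp(i(a x² + b x))` times a
function of `t`, the condition `2 h_x = iσκ h` reads `2ax + b = σκ/2`. The function `kfun`, built
from the exponent, thus has to equal `ξ_t / ξ_x`. -/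
theorem kfun_mul_cfun {p : ℝ × ℝ} (h : ParamsAt T X Θ Ψ ε p.1) :
    kfun T X ε p * cfun T ε p.1 = deriv (cfun T ε) p.1 * p.2 + deriv X p.1 := by
  rw [h.deriv_cfun]
  unfold kfun cfun afun bfun
  have hε := h.eps_sq
  obtain ⟨σ, r, hσ, hr, h1, h2, h3, h4⟩ := h.abs_eq
  rw [h3, h4, h2]
  have hσ2 : σ ^ 2 = 1 := by rcases hσ with h | h <;> rw [h] <;> norm_num
  field_simp
  linear_combination (16 * r * deriv X p.1 * σ ^ 2) * hε + 16 * r * deriv X p.1 * hσ2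

theorem efac_dx {p : ℝ × ℝ} (h : ParamsAt T X Θ Ψ ε p.1) :
    dx (efac T X Θ Ψ ε) p =
      Complex.I * (2 * afun T p.1 * p.2 + bfun T X ε p.1) * efac T X Θ Ψ ε p := by
  refine dx_eq_of_hasDerivAt (smooth_differentiableAt (smooth_efac h)) ?_
  have h1 : HasDerivAt (fun s : ℝ => afun T p.1 * s ^ 2 + bfun T X ε p.1 * s)
      (2 * afun T p.1 * p.2 + bfun T X ε p.1) p.2 := by
    have := (((hasDerivAt_id p.2).pow 2).const_mul (afun T p.1)).add
      ((hasDerivAt_id p.2).const_mul (bfun T X ε p.1))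
    refine this.congr_deriv ?_
    simp; ring
  have h2 := (((h1.ofReal_comp.const_mul Complex.I).add_const (Θ p.1 : ℂ)).add_const
    (Complex.I * (Ψ p.1 : ℂ))).cexp
  refine h2.congr_deriv ?_
  unfold efac
  push_cast
  ring

theorem efac_dt {p : ℝ × ℝ} (h : ParamsAt T X Θ Ψ ε p.1) :
    dt (efac T X Θ Ψ ε) p =
      (Complex.I * (deriv (afun T) p.1 * p.2 ^ 2 + deriv (bfun T X ε) p.1 * p.2) +
        deriv Θ p.1 + Complex.I * deriv Ψ p.1) * efac T X Θ Ψ ε p := by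
  refine dt_eq_of_hasDerivAt (smooth_differentiableAt (smooth_efac h)) ?_
  have hd : ∀ {f : ℝ → ℝ}, ContDiffAt ℝ ∞ f p.1 → HasDerivAt f (deriv f p.1) p.1 := fun hf =>
    (smooth_differentiableAt hf).hasDerivAt
  have h1 := (((((((hd h.smooth_afun).mul_const (p.2 ^ 2)).add
    ((hd h.smooth_bfun).mul_const p.2)).ofReal_comp.const_mul Complex.I)).add
    (hd h.smooth_Θ).ofReal_comp).add ((hd h.smooth_Ψ).ofReal_comp.const_mul Complex.I)).cexp
  refine h1.congr_deriv ?_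
  simp only [efac, Pi.add_apply]
  push_cast
  ring

theorem efac_dx_dx {p : ℝ × ℝ} (h : ParamsAt T X Θ Ψ ε p.1) :
    dx (dx (efac T X Θ Ψ ε)) p =
      (2 * Complex.I * afun T p.1 - (2 * afun T p.1 * p.2 + bfun T X ε p.1) ^ 2) *
        efac T X Θ Ψ ε p := by
  refine dx_eq_of_hasDerivAt (smooth_differentiableAt (smooth_dx (smooth_efac h))) ?_
  have hfun : (fun s => dx (efac T X Θ Ψ ε) (p.1, s)) = fun s : ℝ =>
      Complex.I * (2 * afun T p.1 * s + bfun T X ε p.1) * efac T X Θ Ψ ε (p.1, s) := by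
    funext s
    exact efac_dx (p := (p.1, s)) h
  rw [hfun]
  have h1 : HasDerivAt (fun s : ℝ => ((p.1, s) : ℝ × ℝ)) (0, 1) p.2 :=
    (hasDerivAt_const _ _).prodMk (hasDerivAt_id _)
  have h2 : HasDerivAt (fun s : ℝ => efac T X Θ Ψ ε (p.1, s)) (dx (efac T X Θ Ψ ε) p) p.2 :=
    HasFDerivAt.comp_hasDerivAt p.2 (f := fun s : ℝ => ((p.1, s) : ℝ × ℝ))
      (smooth_differentiableAt (smooth_efac h)).hasFDerivAt h1
  have h3 : HasDerivAt (fun s : ℝ => Complex.I * (2 * afun T p.1 * s + bfun T X ε p.1))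
      (Complex.I * (2 * afun T p.1)) p.2 := by
    have := (((Complex.ofRealCLM.hasDerivAt (x := p.2)).const_mul (2 * afun T p.1 : ℂ)).add_const
      (bfun T X ε p.1 : ℂ)).const_mul Complex.I
    simpa using this
  refine (h3.mul h2).congr_deriv ?_
  rw [efac_dx h]
  linear_combination (2 * afun T p.1 * p.2 + bfun T X ε p.1 : ℂ) ^ 2 * efac T X Θ Ψ ε p *
    Complex.I_sq

/-- The source of the explicit summands in `S̃`: the coefficient of `ψ̂` in `prolong_affine` for `h
= efac` is, up to the factor `-|T_t| h`, the part of `sMap` that does not contain `S`. -/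
theorem lop_efac {z : Base} (h : ParamsAt T X Θ Ψ ε z.1) :
    lop (Real.sign (deriv T z.1)) (kfun T X ε (z.1, z.2.1)) (efac T X Θ Ψ ε) (z.1, z.2.1) =
      -((|deriv T z.1| : ℝ) * sMap T X Θ Ψ ε (z, 0) * efac T X Θ Ψ ε (z.1, z.2.1)) := by
  obtain ⟨t, x, u⟩ := z
  simp only at h ⊢
  have hε := h.eps_sq
  rw [lop, efac_dx_dx (p := (t, x)) h, efac_dt (p := (t, x)) h, efac_dx (p := (t, x)) h]
  simp only [sMap, hat_zero, zero_div, zero_add, iteratedDeriv_two', iteratedDeriv_three', kfun]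
  rw [h.deriv_quot, h.deriv_afun, h.deriv_bfun]
  unfold afun bfun
  obtain ⟨σ, r, hσ, hr, h1, h2, h3, h4⟩ := h.abs_eq
  rw [h3, h4, h2, h1]
  have hr0 : (r : ℂ) ≠ 0 := by exact_mod_cast hr.ne'
  have hεc : (ε : ℂ) ^ 2 = 1 := by exact_mod_cast hε
  have hI : Complex.I ^ 2 = -1 := Complex.I_sq
  rw [← neg_mul, ← mul_assoc, ← mul_assoc, ← sub_mul, ← mul_assoc, ← add_mul]
  congr 1
  generalize deriv (deriv (deriv T)) t = T3
  generalize deriv (deriv T) t = T2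
  generalize deriv (deriv X) t = X2
  generalize deriv X t = X1
  generalize deriv Ψ t = Ψ1
  -- After cancelling the exponential, what remains is a rational identity in `x`, `r` and the
  -- derivatives of the parameters, checked for each sign modulo `i² = -1` and `ε² = 1`.
  rcases hσ with hσ | hσ
  · rw [hσ]
    push_cast
    field_simp
    linear_combination ((8 * (x * (2 ^ 2 * x * (r ^ 2 * T3 -
      (T2 : ℂ) ^ 2) + 8 * r * ε * (2 * r ^ 2 * X2 -
      T2 * X1)) + 2 ^ 2 * 8 * (r : ℂ) ^ 4 * Ψ1) -
      2 * (2 ^ 2 * T2 * x + 8 * r * ε * X1 : ℂ) ^ 2) * 64) * hI +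
      64 * 64 * (r : ℂ) ^ 2 * (X1 : ℂ) ^ 2 * hεc
  · rw [hσ]
    push_cast
    field_simp
    linear_combination (-(8 * (x * (2 ^ 2 * x * (r ^ 2 * T3 +
      (T2 : ℂ) ^ 2) + 8 * r * ε * (-(2 * r ^ 2 * X2) -
      T2 * X1)) + 2 ^ 2 * 8 * (r : ℂ) ^ 4 * Ψ1) +
      2 * (2 ^ 2 * T2 * x - 8 * r * ε * X1 : ℂ) ^ 2) * 64) * hI +
      64 * 64 * (r : ℂ) ^ 2 * (X1 : ℂ) ^ 2 * hεc

end Params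

/-! ### The explicit transformations acting on jets. -/

/-- Near the point `z`, the map `φ` has the explicit form with some parameters. -/
def HasBaseForm (φ : Base → Base) (z : Base) : Prop :=
  ∃ (T X Θ Ψ : ℝ → ℝ) (ε : ℝ), ParamsAt T X Θ Ψ ε z.1 ∧ φ =ᶠ[𝓝 z] baseMap T X Θ Ψ 0 ε

theorem gr_tendsto {f : ℝ × ℝ → ℂ} {p : ℝ × ℝ} (hf : ContDiffAt ℝ ∞ f p) :
    Filter.Tendsto (gr f) (𝓝 p) (𝓝 (gr f p)) := (smooth_gr hf).continuousAt

/-- Every graph is transversal to a map that transforms `(t, x)` to `(T(t), c(t) x + X(t))`. -/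
theorem transversal_of_affine {φ : Base → Base} {z : Base} (hφ : DifferentiableAt ℝ φ z)
    {T c X : ℝ → ℝ} (hT : DifferentiableAt ℝ T z.1) (hc : DifferentiableAt ℝ c z.1)
    (hX : DifferentiableAt ℝ X z.1) (hT0 : deriv T z.1 ≠ 0) (hc0 : c z.1 ≠ 0)
    (hev : ∀ᶠ z' in 𝓝 z, prj (φ z') = (T z'.1, c z'.1 * z'.2.1 + X z'.1)) {V : Base}
    (hV : prj (fderiv ℝ φ z V) = 0) : (V.1, V.2.1) = ((0, 0) : ℝ × ℝ) := by
  have e1 : HasFDerivAt (fun z' : Base => z'.1) prt z := prt.hasFDerivAt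
  have e2 : HasFDerivAt (fun z' : Base => z'.2.1) prx z := prx.hasFDerivAt
  have h1 : HasFDerivAt (fun z' => prj (φ z')) _ z := prj.hasFDerivAt.comp z hφ.hasFDerivAt
  have hT' := hT.hasDerivAt.comp_hasFDerivAt z e1
  have hc' := hc.hasDerivAt.comp_hasFDerivAt z e1
  have hX' := hX.hasDerivAt.comp_hasFDerivAt z e1
  have h2 := hT'.prodMk ((hc'.mul e2).add hX')
  have h3 := DFunLike.congr_fun (h1.unique (h2.congr_of_eventuallyEq hev)) V
  rw [ContinuousLinearMap.comp_apply, hV] at h3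
  have a1 := congrArg Prod.fst h3
  have a2 := congrArg Prod.snd h3
  simp at a1 a2
  have a3 := a1.resolve_left hT0
  rw [a3] at a2
  simp at a2
  rw [a3, a2.resolve_left hc0]

theorem eventually_affine_of_baseMap {φ : Base → Base} {z : Base} {T X Θ Ψ : ℝ → ℝ} {ε : ℝ}
    (hev : φ =ᶠ[𝓝 z] baseMap T X Θ Ψ 0 ε) :
    ∀ᶠ z' in 𝓝 z, prj (φ z') = (T z'.1, cfun T ε z'.1 * z'.2.1 + X z'.1) := by
  filter_upwards [hev] with z' hz'
  rw [hz', baseMap_eq]; rfl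

theorem ParamsAt.cfun_ne {T X Θ Ψ : ℝ → ℝ} {ε t : ℝ} (h : ParamsAt T X Θ Ψ ε t) : cfun T ε t ≠ 0 :=
  mul_ne_zero h.eps_ne h.sqrt_pos.ne'

theorem ParamsAt.cfun_sq {T X Θ Ψ : ℝ → ℝ} {ε t : ℝ} (h : ParamsAt T X Θ Ψ ε t) :
    cfun T ε t ^ 2 = |deriv T t| := by
  rw [cfun, mul_pow, h.eps_sq, Real.sq_sqrt (abs_nonneg _), one_mul]

/-- A map of the explicit form maps every graph into a graph. -/
theorem exists_maps_of_baseMap {φ : Base → Base} {f : ℝ × ℝ → ℂ} {p : ℝ × ℝ}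
    (hf : ContDiffAt ℝ ∞ f p) (hφ : ContDiffAt ℝ ∞ φ (gr f p)) {T X Θ Ψ : ℝ → ℝ} {ε : ℝ}
    (h : ParamsAt T X Θ Ψ ε p.1) (hev : φ =ᶠ[𝓝 (gr f p)] baseMap T X Θ Ψ 0 ε) :
    ∃ g, Maps φ f g p ∧
      Filter.map (fun p' => prj (φ (gr f p'))) (𝓝 p) = 𝓝 (prj (φ (gr f p))) := by
  obtain ⟨g, h1, h2, h3⟩ := exists_image hf hφ fun v hv =>
    transversal_of_affine (smooth_differentiableAt hφ) (smooth_differentiableAt h.smooth_T)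
      (smooth_differentiableAt h.smooth_cfun) (smooth_differentiableAt h.smooth_X) h.2.1 h.cfun_ne
      (eventually_affine_of_baseMap hev) hv
  exact ⟨g, ⟨hf, hφ, h1, h2⟩, h3⟩

@[simp] theorem lop_zero (σ κ : ℝ) (p : ℝ × ℝ) : lop σ κ (fun _ => 0) p = 0 := by
  have hd : ∀ c : ℂ, dx (fun _ => c) = fun _ => 0 := fun c => funext fun r => by simp [dx]
  simp [lop, hd]
  simp [dt]

/-- The transformation of the left-hand side of the equation. -/
theorem prolong_baseMap {φ : OpenPartialHomeomorph Base Base} {z : Base} {T X Θ Ψ : ℝ → ℝ} {ε : ℝ}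
    (h : ParamsAt T X Θ Ψ ε z.1) (hev : φ =ᶠ[𝓝 z] baseMap T X Θ Ψ 0 ε) {j j' : Jet2}
    (hj : Prolongs φ j j') (hz : j.pt = z) (S : ℂ) :
    (|deriv T z.1| : ℝ) * (Complex.I * j'.ut + j'.uxx + sMap T X Θ Ψ ε (z, S) * j'.u) =
      efac T X Θ Ψ ε (z.1, z.2.1) * hat (deriv T z.1) (Complex.I * j.ut + j.uxx + S * j.u) := by
  obtain ⟨f, g, p, q, hf, hg, rfl, rfl, -, hpq, hgr⟩ := hj
  subst hz
  change ParamsAt T X Θ Ψ ε p.1 at h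
  have hev' : ∀ᶠ p' in 𝓝 p, φ (gr f p') = baseMap T X Θ Ψ 0 ε (gr f p') :=
    (gr_tendsto hf).eventually hev
  have hN : ∀ᶠ p' in 𝓝 p, g (T p'.1, cfun T ε p'.1 * p'.2 + X p'.1) =
      efac T X Θ Ψ ε p' * hat (deriv T p.1) (f p') + 0 := by
    have hs : ∀ᶠ p' in 𝓝 p, (0 < deriv T p'.1 ↔ 0 < deriv T p.1) :=
      (continuous_fst.tendsto p).eventually (h.sign_eventually.mono fun _ hs => hs.1)
    filter_upwards [hev', hgr, hs] with p' h1 ⟨q', h2⟩ h3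
    rw [baseMap_eq] at h1
    have h4 := h1.symm.trans h2
    simp only [gr, Prod.mk.injEq] at h4
    obtain ⟨a1, a2, a3⟩ := h4
    rw [a1, a2, show ((q'.1, q'.2) : ℝ × ℝ) = q' from rfl, ← a3, hat_congr h3]
    ring
  have h0 := hev'.self_of_nhds.symm.trans hpq
  rw [baseMap_eq] at h0
  simp only [gr, Prod.mk.injEq] at h0
  obtain ⟨a1, a2, a3⟩ := h0
  have hq : q = (T p.1, cfun T ε p.1 * p.2 + X p.1) := by rw [a1, a2]
  have key := prolong_affine hq hg hf (smooth_efac h) contDiffAt_const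
    (smooth_differentiableAt h.smooth_T) (smooth_differentiableAt h.smooth_cfun)
    (smooth_differentiableAt h.smooth_X) h.2.1 h.cfun_sq (kfun_mul_cfun h) hN
  have hl := lop_efac (z := gr f p) h
  change lop (Real.sign (deriv T p.1)) (kfun T X ε p) (efac T X Θ Ψ ε) p =
    -((|deriv T p.1| : ℝ) * sMap T X Θ Ψ ε (gr f p, 0) * efac T X Θ Ψ ε p) at hl
  rw [hl, lop_zero, efac_dx h] at key
  change ((|deriv T p.1| : ℝ) : ℂ) * (Complex.I * dt g q + dx (dx g) q + sMap T X Θ Ψ ε (gr f p, S) * g q) =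
    efac T X Θ Ψ ε p * hat (deriv T p.1) (Complex.I * dt f p + dx (dx f) p + S * f p)
  -- By this identity the coefficient of `ψ̂_x` in `key` vanishes.
  have hk : (kfun T X ε p : ℂ) * Real.sign (deriv T p.1) =
      2 * (2 * afun T p.1 * p.2 + bfun T X ε p.1) := by
    have : Real.sign (deriv T p.1) ^ 2 = 1 := by
      rcases Real.sign_apply_eq_of_ne_zero _ h.2.1 with h | h <;> rw [h] <;> norm_num
    have : kfun T X ε p * Real.sign (deriv T p.1) =
        2 * (2 * afun T p.1 * p.2 + bfun T X ε p.1) := by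
      rw [kfun]
      linear_combination (2 * (2 * afun T p.1 * p.2 + bfun T X ε p.1)) * this
    exact_mod_cast this
  have hne : ((|deriv T p.1| : ℝ) : ℂ) ≠ 0 := by exact_mod_cast (abs_pos.2 h.2.1).ne'
  have hsm : (|deriv T p.1| : ℝ) * sMap T X Θ Ψ ε (gr f p, S) = hat (deriv T p.1) S +
      (|deriv T p.1| : ℝ) * sMap T X Θ Ψ ε (gr f p, 0) := by
    rw [sMap_eq]
    change ((|deriv T p.1| : ℝ) : ℂ) * (hat (deriv T p.1) S / (|deriv T p.1| : ℝ) + _) = _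
    rw [mul_add, mul_div_cancel₀ _ hne]
  rw [hat_add _ (_ + _), hat_mul _ S]
  change _ * efac T X Θ Ψ ε p = _ at a3
  linear_combination key + g q * hsm - (hat (deriv T p.1) S +
    (|deriv T p.1| : ℝ) * sMap T X Θ Ψ ε (gr f p, 0)) * a3 -
    Complex.I * efac T X Θ Ψ ε p * hat (deriv T p.1) (dx f p) * hk

theorem prolongs_pt {φ : OpenPartialHomeomorph Base Base} {j j' : Jet2} (h : Prolongs φ j j') :
    j.pt ∈ φ.source ∧ j'.pt = φ j.pt := by
  obtain ⟨f, g, p, q, -, -, rfl, rfl, hz, hpq, -⟩ := h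
  exact ⟨hz, hpq.symm⟩

/-- The value of the transformed arbitrary element is determined by the explicit formula. -/
theorem AdmAt.eq_sMap {φ : OpenPartialHomeomorph Base Base} {z : Base} {F F' : ℂ}
    (h : AdmAt φ z F F') (hφ : IsPointTransf φ) (hz : z ∈ φ.source) (hu : z.2.2 ≠ 0)
    {T X Θ Ψ : ℝ → ℝ} {ε : ℝ} (hp : ParamsAt T X Θ Ψ ε z.1)
    (hev : φ =ᶠ[𝓝 z] baseMap T X Θ Ψ 0 ε) :
    F' = sMap T X Θ Ψ ε (z, F / z.2.2) * (φ z).2.2 := by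
  -- One jet is enough: zero first derivatives and `ψ_xx = -F` give a solution jet, and its image
  -- determines `F'`.
  have hgr : gr (qpoly (z.1, z.2.1) z.2.2 0 0 0 (-F)) (z.1, z.2.1) = z := gr_qpoly _ _ _ _ _ _
  obtain ⟨g, hM, -⟩ := exists_maps_of_baseMap (f := qpoly (z.1, z.2.1) z.2.2 0 0 0 (-F))
    (p := (z.1, z.2.1)) (contDiff_qpoly _ _ _ _ _ _).contDiffAt
    (by rw [hgr]; exact hφ.contDiffAt hz) hp (by rw [hgr]; exact hev)
  have hpr := hM.prolongs (by rw [hgr]; exact hz)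
  have hpt : (jet (qpoly (z.1, z.2.1) z.2.2 0 0 0 (-F)) (z.1, z.2.1)).pt = z := hgr
  have h1 := h _ _ hpr hpt (by rw [jet_qpoly]; simp)
  have h2 := prolong_baseMap hp hev hpr hpt (F / z.2.2)
  have h3 : (jet g (prj (φ (gr (qpoly (z.1, z.2.1) z.2.2 0 0 0 (-F)) (z.1, z.2.1))))).u =
      (φ z).2.2 := by
    have := (prolongs_pt hpr).2
    rw [hpt] at this
    rw [← this]; rfl
  rw [jet_qpoly] at h2
  have hne : ((|deriv T z.1| : ℝ) : ℂ) ≠ 0 := by exact_mod_cast (abs_pos.2 hp.2.1).ne'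
  simp only [mul_zero, zero_add, div_mul_cancel₀ _ hu, neg_add_cancel, hat_zero] at h2
  have h4 := (mul_eq_zero.1 h2).resolve_left hne
  rw [h3] at h4
  linear_combination h1 - h4

theorem admAt_of_baseMap {φ : OpenPartialHomeomorph Base Base} {z : Base}
    {T X Θ Ψ : ℝ → ℝ} {ε : ℝ} (hp : ParamsAt T X Θ Ψ ε z.1)
    (hev : φ =ᶠ[𝓝 z] baseMap T X Θ Ψ 0 ε) (S : ℂ) :
    AdmAt φ z (S * z.2.2) (sMap T X Θ Ψ ε (z, S) * (φ z).2.2) := by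
  intro j j' hj hz hs
  have h2 := prolong_baseMap hp hev hj hz S
  have h3 := (prolongs_pt hj).2
  rw [hz] at h3
  rw [← hz] at hs
  change Complex.I * j.ut + j.uxx + S * j.u = 0 at hs
  rw [hs, hat_zero, mul_zero] at h2
  have hne : ((|deriv T z.1| : ℝ) : ℂ) ≠ 0 := by exact_mod_cast (abs_pos.2 hp.2.1).ne'
  rw [← h3]
  exact (mul_eq_zero.1 h2).resolve_left hne

theorem baseMap_u_ne {T X Θ Ψ : ℝ → ℝ} {ε : ℝ} {z : Base} (hu : z.2.2 ≠ 0) :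
    (baseMap T X Θ Ψ 0 ε z).2.2 ≠ 0 := by
  rw [baseMap_eq]
  exact mul_ne_zero (by simpa using hu) (efac_ne _ _ _ _ _ _)

/-- The transformation of the arbitrary element is determined by the germ of the transformation of
the variables. -/
theorem sMap_unique {φ : OpenPartialHomeomorph Base Base} (hφ : IsPointTransf φ) {z : Base}
    (hz : z ∈ φ.source) (hu : z.2.2 ≠ 0) {T X Θ Ψ T' X' Θ' Ψ' : ℝ → ℝ} {ε ε' : ℝ}
    (hp : ParamsAt T X Θ Ψ ε z.1) (hev : φ =ᶠ[𝓝 z] baseMap T X Θ Ψ 0 ε)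
    (hp' : ParamsAt T' X' Θ' Ψ' ε' z.1) (hev' : φ =ᶠ[𝓝 z] baseMap T' X' Θ' Ψ' 0 ε') (S : ℂ) :
    sMap T X Θ Ψ ε (z, S) = sMap T' X' Θ' Ψ' ε' (z, S) := by
  have h1 := (admAt_of_baseMap hp hev S).eq_sMap hφ hz hu hp' hev'
  rw [mul_div_cancel_right₀ _ hu] at h1
  refine mul_right_cancel₀ ?_ h1
  rw [hev.self_of_nhds]
  exact baseMap_u_ne hu

/-! ### Rigidity of radial nonlinearities. -/

/-- Circles around a centre `a`. Along them a function radial about `a` is constant, so a derivative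
in the angular direction is available even when the radial profile is not known to be
differentiable. -/
theorem hasDerivAt_rot (a w : ℂ) :
    HasDerivAt (fun s : ℝ => a + w * Complex.exp (s * Complex.I)) (w * Complex.I) 0 := by
  have h1 : HasDerivAt (fun s : ℝ => (s : ℂ) * Complex.I) Complex.I (0 : ℝ) := by
    simpa using (Complex.ofRealCLM.hasDerivAt (x := (0 : ℝ))).mul_const Complex.I
  simpa using (h1.cexp.const_mul w).const_add a

theorem tendsto_rot (a w : ℂ) :
    Filter.Tendsto (fun s : ℝ => a + w * Complex.exp (s * Complex.I)) (𝓝 0) (𝓝 (a + w)) := by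
  simpa using (hasDerivAt_rot a w).continuousAt.tendsto

theorem norm_rot (w : ℂ) (s : ℝ) : ‖w * Complex.exp (s * Complex.I)‖ = ‖w‖ := by
  rw [norm_mul, Complex.norm_exp_ofReal_mul_I, mul_one]

/-- A radial nonlinearity that stays radial after a shift of the centre is linear. -/
theorem shift_eq_zero {s s' : ℝ → ℂ} {a B w₀ : ℂ} (hw₀ : w₀ ≠ 0)
    (hs : ∀ᶠ w in 𝓝 w₀, DifferentiableAt ℝ s ‖w‖) (hd : deriv s ‖w₀‖ ≠ 0)
    (h : ∀ᶠ w in 𝓝 w₀, s' ‖w + a‖ * (w + a) = s ‖w‖ * w + B) : a = 0 := by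
  -- Let `G(w) = s(|w|) w + B`. Its derivative along `iw` is computed from rotations about `0`, and
  -- along `i(w + a)` from rotations about `-a`, using the second expression for `G`. Their
  -- difference is the derivative along the constant direction `ia`, and it equals `iB`.
  have key : ∀ᶠ w in 𝓝 w₀, deriv s ‖w‖ * (inner ℝ w (Complex.I * a) / ‖w‖ : ℝ) * w +
      s ‖w‖ * (Complex.I * a) = Complex.I * B := by
    filter_upwards [hs, h.eventually_nhds, eventually_ne_nhds hw₀] with w hsw hw hw0
    have hn : HasFDerivAt (fun w : ℂ => ‖w‖) (fderiv ℝ (fun w : ℂ => ‖w‖) w) w :=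
      ((contDiffAt_norm ℝ hw0 (n := 1)).differentiableAt (by simp)).hasFDerivAt
    have hnv : ∀ v, fderiv ℝ (fun w : ℂ => ‖w‖) w v = inner ℝ w v / ‖w‖ := by
      intro v
      have h1 := hn.pow 2
      have h2 := (hasStrictFDerivAt_norm_sq w).hasFDerivAt
      have h3 := DFunLike.congr_fun (h1.unique h2) v
      have h4 : ‖w‖ ≠ 0 := norm_ne_zero_iff.2 hw0
      simp at h3
      simp only [Complex.inner]
      field_simp
      simp
      linarith
    have hG := ((hsw.hasDerivAt.hasFDerivAt.comp w hn).mul (hasFDerivAt_id w)).add_const B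
    obtain ⟨D, hD, hDv⟩ : ∃ D : ℂ →L[ℝ] ℂ, HasFDerivAt (fun w : ℂ => s ‖w‖ * w + B) D w ∧
        ∀ v, D v = deriv s ‖w‖ * (inner ℝ w v / ‖w‖ : ℝ) * w + s ‖w‖ * v := by
      refine ⟨_, hG, fun v => ?_⟩
      simp [hnv]
      ring
    have c1 : D (w * Complex.I) = s ‖w‖ * (w * Complex.I) := by
      have h1 := HasFDerivAt.comp_hasDerivAt (0 : ℝ)
        (f := fun s : ℝ => 0 + w * Complex.exp (s * Complex.I))
        (show HasFDerivAt (fun w : ℂ => s ‖w‖ * w + B) D _ by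
          rw [show (0 : ℂ) + w * Complex.exp ((0 : ℝ) * Complex.I) = w by simp]; exact hD)
        (hasDerivAt_rot 0 w)
      have h2 : HasDerivAt (fun r : ℝ => s ‖w‖ * (0 + w * Complex.exp (r * Complex.I)) + B)
          (s ‖w‖ * (w * Complex.I)) 0 := ((hasDerivAt_rot 0 w).const_mul _).add_const _
      refine h1.unique (h2.congr_of_eventuallyEq (Filter.Eventually.of_forall fun r => ?_))
      simp
    have c2 : D ((w + a) * Complex.I) = s' ‖w + a‖ * ((w + a) * Complex.I) := by
      have h1 := HasFDerivAt.comp_hasDerivAt (0 : ℝ)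
        (f := fun s : ℝ => -a + (w + a) * Complex.exp (s * Complex.I))
        (show HasFDerivAt (fun w : ℂ => s ‖w‖ * w + B) D _ by
          rw [show -a + (w + a) * Complex.exp ((0 : ℝ) * Complex.I) = w by simp]; exact hD)
        (hasDerivAt_rot (-a) (w + a))
      have h2 : HasDerivAt
          (fun r : ℝ => s' ‖w + a‖ * (a + (-a + (w + a) * Complex.exp (r * Complex.I))))
          (s' ‖w + a‖ * ((w + a) * Complex.I)) 0 :=
        ((hasDerivAt_rot (-a) (w + a)).const_add _).const_mul _
      have ht := tendsto_rot (-a) (w + a)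
      rw [neg_add_cancel_comm_assoc] at ht
      refine h1.unique (h2.congr_of_eventuallyEq ?_)
      filter_upwards [ht.eventually hw] with r hr
      have e : -a + (w + a) * Complex.exp (r * Complex.I) + a =
        (w + a) * Complex.exp (r * Complex.I) := by ring
      rw [e, norm_rot] at hr
      simp only [Function.comp]
      rw [← hr]; ring
    have c3 : D (Complex.I * a) = D ((w + a) * Complex.I) - D (w * Complex.I) := by
      rw [← map_sub]; congr 1; ring
    rw [← hDv, c3, c1, c2]
    linear_combination Complex.I * hw.self_of_nhds
  have hn0 : (‖w₀‖ : ℂ) ≠ 0 := by exact_mod_cast norm_ne_zero_iff.2 hw₀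
  have ht := tendsto_rot 0 w₀
  rw [zero_add] at ht
  -- Rotating `w₀` about `0` changes neither `|w|` nor the values of `s` and its derivative. Since
  -- the latter is nonzero, `⟨w, ia⟩ w` must be constant along the circle.
  have hrot : ∀ᶠ r : ℝ in 𝓝 0,
      ((inner ℝ (w₀ * Complex.exp (r * Complex.I)) (Complex.I * a) : ℝ) : ℂ) *
        (w₀ * Complex.exp (r * Complex.I)) = (inner ℝ w₀ (Complex.I * a) : ℝ) * w₀ := by
    filter_upwards [ht.eventually key] with r hr
    rw [zero_add, norm_rot] at hr
    have h1 := hr.trans key.self_of_nhds.symm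
    have h2 := add_right_cancel h1
    rw [mul_assoc, mul_assoc] at h2
    have h3 := mul_left_cancel₀ hd h2
    push_cast at h3
    field_simp at h3
    linear_combination w₀ * h3
  have d0 := hasDerivAt_rot 0 w₀
  simp only [zero_add] at d0
  have d1 : HasDerivAt (fun r : ℝ => inner ℝ (w₀ * Complex.exp (r * Complex.I)) (Complex.I * a))
      (inner ℝ (w₀ * Complex.I) (Complex.I * a)) 0 := by
    have := d0.inner ℝ (hasDerivAt_const (0 : ℝ) (Complex.I * a))
    simpa using this
  have d2 := d1.ofReal_comp.mul d0
  have hrot' : (fun r : ℝ =>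
      ((inner ℝ (w₀ * Complex.exp (r * Complex.I)) (Complex.I * a) : ℝ) : ℂ) *
        (w₀ * Complex.exp (r * Complex.I))) =ᶠ[𝓝 0]
        fun _ => (inner ℝ w₀ (Complex.I * a) : ℝ) * w₀ := hrot
  -- Differentiating along the circle gives `⟨iw₀, ia⟩ + i⟨w₀, ia⟩ = 0`, whose real and imaginary
  -- parts together say that the product of `a` and the conjugate of `w₀` is zero.
  have d3 := d2.unique ((hasDerivAt_const (0 : ℝ) _).congr_of_eventuallyEq hrot')
  simp only [Complex.ofReal_zero, zero_mul, Complex.exp_zero, mul_one] at d3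
  have d4 : ((inner ℝ (w₀ * Complex.I) (Complex.I * a) : ℝ) : ℂ) +
      (inner ℝ w₀ (Complex.I * a) : ℝ) * Complex.I = 0 := by
    have : w₀ * (((inner ℝ (w₀ * Complex.I) (Complex.I * a) : ℝ) : ℂ) +
      (inner ℝ w₀ (Complex.I * a) : ℝ) * Complex.I) = 0 := by linear_combination d3
    exact (mul_eq_zero.1 this).resolve_left hw₀
  have r1 := congrArg Complex.re d4
  have r2 := congrArg Complex.im d4
  simp [Complex.inner] at r1 r2
  have hw : w₀.re ^ 2 + w₀.im ^ 2 ≠ 0 := by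
    intro hz
    apply hw₀
    apply Complex.ext <;> simp <;> nlinarith [sq_nonneg w₀.re, sq_nonneg w₀.im]
  apply Complex.ext
  · have : (w₀.re ^ 2 + w₀.im ^ 2) * a.re = 0 := by linear_combination w₀.re * r1 + w₀.im * r2
    simpa [hw] using this
  · have : (w₀.re ^ 2 + w₀.im ^ 2) * a.im = 0 := by linear_combination w₀.im * r1 - w₀.re * r2
    simpa [hw] using this

/-! ### Integration of the determining equations and local classification. -/

theorem mem_ball_base {z z₀ : Base} {r : ℝ} :
    z ∈ Metric.ball z₀ r ↔ dist z.1 z₀.1 < r ∧ dist z.2.1 z₀.2.1 < r ∧ dist z.2.2 z₀.2.2 < r := by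
  simp [Metric.mem_ball, Prod.dist_eq]

theorem hasFDerivAt_prt_comp {φ : Base → Base} {z : Base} (hφ : DifferentiableAt ℝ φ z)
    (V : Base) : fderiv ℝ (fun z => (φ z).1) z V = (fderiv ℝ φ z V).1 := by
  have : HasFDerivAt (fun z => (φ z).1) _ z := prt.hasFDerivAt.comp z hφ.hasFDerivAt
  rw [this.fderiv]; rfl

theorem hasFDerivAt_prx_comp {φ : Base → Base} {z : Base} (hφ : DifferentiableAt ℝ φ z)
    (V : Base) : fderiv ℝ (fun z => (φ z).2.1) z V = (fderiv ℝ φ z V).2.1 := by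
  have : HasFDerivAt (fun z => (φ z).2.1) _ z := prx.hasFDerivAt.comp z hφ.hasFDerivAt
  rw [this.fderiv]; rfl

theorem hasFDerivAt_prc_comp {φ : Base → Base} {z : Base} (hφ : DifferentiableAt ℝ φ z)
    (V : Base) : fderiv ℝ (fun z => (φ z).2.2) z V = (fderiv ℝ φ z V).2.2 := by
  have : HasFDerivAt (fun z => (φ z).2.2) _ z := prc.hasFDerivAt.comp z hφ.hasFDerivAt
  rw [this.fderiv]; rfl

/-- The infinitesimal consequences of admissibility. -/
structure InfForm (φ : OpenPartialHomeomorph Base Base) : Prop where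
  time : ∀ z ∈ φ.source, ∀ x u, (fderiv ℝ φ z (0, x, u)).1 = 0
  time_ne : ∀ z ∈ φ.source, (fderiv ℝ φ z (1, 0, 0)).1 ≠ 0
  space : ∀ z ∈ φ.source, ∀ u, (fderiv ℝ φ z (0, 0, u)).2.1 = 0
  space_sq : ∀ z ∈ φ.source,
    (fderiv ℝ φ z (0, 1, 0)).2.1 ^ 2 = |(fderiv ℝ φ z (1, 0, 0)).1|
  conf : ∀ z ∈ φ.source, ∀ u, (fderiv ℝ φ z (0, 0, u)).2.2 =
    (fderiv ℝ φ z (0, 0, 1)).2.2 * hat (fderiv ℝ φ z (1, 0, 0)).1 u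
  conf_ne : ∀ z ∈ φ.source, (fderiv ℝ φ z (0, 0, 1)).2.2 ≠ 0
  affine : ∀ z ∈ φ.source, ∀ b, (fderiv ℝ (fderiv ℝ φ) z (0, 0, b) (0, 0, 1)).2.2 = 0

/-- The values `F`, `F'` may vary with the point. Each restriction, once known at all points of the
open source, holds on neighbourhoods and can therefore be differentiated in the derivation of the
next one. -/
theorem infForm_of_admAt {φ : OpenPartialHomeomorph Base Base} (hφ : IsPointTransf φ)
    (h : ∀ z ∈ φ.source, ∃ F F', AdmAt φ z F F') : InfForm φ := by
  have h1 : ∀ z ∈ φ.source, ∀ x u, (fderiv ℝ φ z (0, x, u)).1 = 0 := by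
    intro z hz
    obtain ⟨F, F', hF⟩ := h z hz
    exact hF.time hφ hz
  have h1' : ∀ z ∈ φ.source, ∀ᶠ z' in 𝓝 z, ∀ x u, (fderiv ℝ φ z' (0, x, u)).1 = 0 := by
    intro z hz
    filter_upwards [φ.open_source.mem_nhds hz] with z' hz' using h1 z' hz'
  have h2 : ∀ z ∈ φ.source, (fderiv ℝ φ z (1, 0, 0)).1 ≠ 0 := fun z hz =>
    AdmAt.time_ne hφ hz (h1 z hz)
  have h3 := fun z (hz : z ∈ φ.source) =>
    (h z hz).choose_spec.choose_spec.space hφ hz (h1' z hz) rfl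
  have h4 : ∀ z ∈ φ.source, ∀ᶠ z' in 𝓝 z, ∀ u, (fderiv ℝ φ z' (0, 0, u)).2.1 = 0 := by
    intro z hz
    filter_upwards [φ.open_source.mem_nhds hz] with z' hz' using (h3 z' hz').1
  refine ⟨h1, h2, fun z hz => (h3 z hz).1, fun z hz => (h3 z hz).2.1, ?_,
    fun z hz => (h3 z hz).2.2.2, ?_⟩
  · intro z hz u
    have hI := (h3 z hz).2.2.1 1
    have hT := h2 z hz
    have hTc : ((fderiv ℝ φ z (1, 0, 0)).1 : ℂ) ≠ 0 := by exact_mod_cast hT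
    rw [mul_one, show ((|(fderiv ℝ φ z (1, 0, 0)).1| : ℝ) : ℂ) =
      Real.sign (fderiv ℝ φ z (1, 0, 0)).1 * (fderiv ℝ φ z (1, 0, 0)).1 by
        exact_mod_cast sign_mul_self_eq_abs.symm] at hI
    have hI' : (fderiv ℝ φ z (0, 0, Complex.I)).2.2 =
        Complex.I * Real.sign (fderiv ℝ φ z (1, 0, 0)).1 * (fderiv ℝ φ z (0, 0, 1)).2.2 := by
      refine mul_left_cancel₀ hTc ?_
      rw [hI]; ring
    have hu : ((0, 0, u) : Base) = u.re • (0, 0, 1) + u.im • (0, 0, Complex.I) := by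
      simp [Complex.re_add_im]
    have hhat : hat (fderiv ℝ φ z (1, 0, 0)).1 u =
        u.re + Real.sign (fderiv ℝ φ z (1, 0, 0)).1 * Complex.I * u.im := by
      conv_lhs => rw [← Complex.re_add_im u]
      rw [mul_comm _ Complex.I, hat_add, hat_I_mul hT, hat_ofReal, hat_ofReal]
    rw [hu, map_add, map_smul, map_smul, hhat]
    simp only [Prod.snd_add, Prod.smul_snd, hI', Complex.real_smul]
    ring
  · intro z hz b
    obtain ⟨F, F', hF⟩ := h z hz
    have hq := hF.quadratic hφ hz (h1' z hz) (h4 z hz)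
    have hsym : IsSymmSndFDerivAt ℝ φ z := (hφ.contDiffAt hz).isSymmSndFDerivAt (by simp; norm_cast)
    -- Polarization: the quadratic form vanishes at `b`, `1` and `b + 1`. The value with second
    -- argument `1` suffices, since the `ψ`-derivative is determined by its value on `1`.
    have e := hq (b + 1)
    have hb : ((0, 0, b + 1) : Base) = (0, 0, b) + (0, 0, 1) := by simp
    rw [hb, map_add, map_add, _root_.add_apply, _root_.add_apply, hsym.eq (0, 0, 1) (0, 0, b)] at e
    simp only [Prod.snd_add, hq] at e
    linear_combination e / 2

/-- The normal form of an admissible transformation: affine in `x` and in `ψ̂`. -/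
theorem InfForm.exists_affine {φ : OpenPartialHomeomorph Base Base} (hφ : IsPointTransf φ)
    (h : InfForm φ) {z₀ : Base} (hz₀ : z₀ ∈ φ.source) :
    ∃ (T X : ℝ → ℝ) (ε : ℝ) (k y : ℝ × ℝ → ℂ) (r : ℝ), 0 < r ∧ Metric.ball z₀ r ⊆ φ.source ∧
      ∀ z ∈ Metric.ball z₀ r, ParamsAt T X (fun _ => 0) (fun _ => 0) ε z.1 ∧
        ContDiffAt ℝ ∞ k (z.1, z.2.1) ∧ ContDiffAt ℝ ∞ y (z.1, z.2.1) ∧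
        (0 < deriv T z.1 ↔ 0 < deriv T z₀.1) ∧ k (z.1, z.2.1) ≠ 0 ∧
        φ z = (T z.1, cfun T ε z.1 * z.2.1 + X z.1,
          k (z.1, z.2.1) * hat (deriv T z₀.1) z.2.2 + y (z.1, z.2.1)) := by
  obtain ⟨t₀, x₀, u₀⟩ := z₀
  set z₀ : Base := (t₀, x₀, u₀) with hz₀def
  have hdφ : ∀ z ∈ φ.source, DifferentiableAt ℝ φ z := fun z hz =>
    smooth_differentiableAt (hφ.contDiffAt hz)
  have hcont : ∀ (V : Base), ∀ z ∈ φ.source, ContinuousAt (fun z' => fderiv ℝ φ z' V) z :=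
    fun V z hz => (smooth_fderiv_apply (hφ.contDiffAt hz) V).continuousAt
  -- a ball on which the sign of `τ_t` is constant
  have hsgn : ∀ᶠ z in 𝓝 z₀, z ∈ φ.source ∧
      (0 < (fderiv ℝ φ z (1, 0, 0)).1 ↔ 0 < (fderiv ℝ φ z₀ (1, 0, 0)).1) := by
    have hc : ContinuousAt (fun z => (fderiv ℝ φ z (1, 0, 0)).1) z₀ :=
      (hcont (1, 0, 0) z₀ hz₀).fst
    have hs : ∀ᶠ z in 𝓝 z₀, z ∈ φ.source := φ.open_source.mem_nhds hz₀
    refine hs.and ?_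
    rcases lt_or_gt_of_ne (h.time_ne z₀ hz₀) with hn | hp
    · filter_upwards [hc.eventually_lt_const hn] with z hz
      simp [hz.not_gt, hn.not_gt]
    · filter_upwards [hc.eventually_const_lt hp] with z hz
      simp [hz, hp]
  obtain ⟨r, hr, hball⟩ := Metric.eventually_nhds_iff_ball.1 hsgn
  set U := Metric.ball z₀ r with hU
  have hUs : U ⊆ φ.source := fun z hz => (hball z hz).1
  have hUc : Convex ℝ U := convex_ball z₀ r
  have hUo : IsOpen U := Metric.isOpen_ball
  have hι : ∀ z ∈ U, ((z.1, x₀, u₀) : Base) ∈ U := fun z hz => by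
    rw [hU, mem_ball_base] at hz ⊢
    simpa [z₀, hr] using hz.1
  have hj : ∀ z ∈ U, ((z.1, z.2.1, u₀) : Base) ∈ U := fun z hz => by
    rw [hU, mem_ball_base] at hz ⊢
    exact ⟨hz.1, hz.2.1, by simpa [z₀] using hr⟩
  set T : ℝ → ℝ := fun t => (φ (t, x₀, u₀)).1 with hT
  have hιs : ∀ t : ℝ, ContDiffAt ℝ ∞ (fun t : ℝ => ((t, x₀, u₀) : Base)) t := fun t =>
    contDiffAt_id.prodMk contDiffAt_const
  have hφι : ∀ z ∈ U, ContDiffAt ℝ ∞ (fun t : ℝ => φ (t, x₀, u₀)) z.1 := fun z hz =>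
    ContDiffAt.comp z.1 (hφ.contDiffAt (hUs (hι z hz))) (hιs z.1)
  have hTs : ∀ z ∈ U, ContDiffAt ℝ ∞ T z.1 := fun z hz => (hφι z hz).fst
  have hTeq : ∀ z ∈ U, (φ z).1 = T z.1 := by
    intro z hz
    refine (eq_of_fderiv_eq_zero (f := fun z => (φ z).1) hUc
      (fun w hw => (hdφ w (hUs hw)).fst) (hι z hz) hz ?_).symm
    intro w hw
    rw [hasFDerivAt_prt_comp (hdφ w (hUs hw))]
    have : z - (z.1, x₀, u₀) = (0, z.2.1 - x₀, z.2.2 - u₀) := by ext <;> simp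
    rw [this]
    exact h.time w (hUs hw) _ _
  have hTd : ∀ z ∈ U, (fderiv ℝ φ z (1, 0, 0)).1 = deriv T z.1 := by
    intro z hz
    rw [← hasFDerivAt_prt_comp (hdφ z (hUs hz))]
    have h1 : (fun z => (φ z).1) =ᶠ[𝓝 z] fun z => T z.1 := by
      filter_upwards [hUo.mem_nhds hz] with w hw using hTeq w hw
    have h2 := (smooth_differentiableAt (hTs z hz)).hasDerivAt.comp_hasFDerivAt z
      (prt.hasFDerivAt (x := z))
    rw [h1.fderiv_eq]
    have h3 : fderiv ℝ (fun z : Base => T z.1) z = _ := h2.fderiv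
    rw [h3]
    simp
  have hsign : ∀ z ∈ U, (0 < deriv T z.1 ↔ 0 < deriv T t₀) := by
    intro z hz
    have := (hball z hz).2
    rwa [hTd z hz, hTd z₀ (Metric.mem_ball_self hr)] at this
  have hT0 : ∀ z ∈ U, deriv T z.1 ≠ 0 := fun z hz => by
    rw [← hTd z hz]; exact h.time_ne z (hUs hz)
  -- neighbouring times are times of points of the ball
  have hnear : ∀ z ∈ U, ∀ᶠ s in 𝓝 z.1, ((s, x₀, u₀) : Base) ∈ U := fun z hz =>
    (hιs z.1).continuousAt.eventually (hUo.mem_nhds (hι z hz))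
  -- the sign of `ξ_x`
  obtain ⟨ε, hε, hξ⟩ : ∃ ε : ℝ, (ε = 1 ∨ ε = -1) ∧
      ∀ z ∈ U, (fderiv ℝ φ z (0, 1, 0)).2.1 = cfun T ε z.1 := by
    have hsq : Set.EqOn ((fun z => (fderiv ℝ φ z (0, 1, 0)).2.1) ^ 2)
        ((fun z => √|(fderiv ℝ φ z (1, 0, 0)).1|) ^ 2) U := by
      intro z hz
      simp only [Pi.pow_apply]
      rw [h.space_sq z (hUs hz), Real.sq_sqrt (abs_nonneg _)]
    rcases hUc.isPreconnected.eq_or_eq_neg_of_sq_eq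
      (fun z hz => (hcont (0, 1, 0) z (hUs hz)).snd.fst.continuousWithinAt)
      (fun z hz => (hcont (1, 0, 0) z (hUs hz)).fst.abs.sqrt.continuousWithinAt) hsq
      (fun hz => (Real.sqrt_pos.2 (abs_pos.2 (h.time_ne _ (hUs hz)))).ne') with h1 | h1
    · refine ⟨1, Or.inl rfl, fun z hz => ?_⟩
      rw [cfun, ← hTd z hz, one_mul]
      exact h1 hz
    · refine ⟨-1, Or.inr rfl, fun z hz => ?_⟩
      rw [cfun, ← hTd z hz, neg_one_mul]
      exact h1 hz
  have hpT : ∀ z ∈ U, ParamsAt T (fun _ => 0) (fun _ => 0) (fun _ => 0) ε z.1 := by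
    intro z hz
    refine ⟨?_, hT0 z hz, hε⟩
    filter_upwards [hnear z hz] with s hs
    exact ⟨hTs _ hs, contDiffAt_const, contDiffAt_const, contDiffAt_const⟩
  set X : ℝ → ℝ := fun t => (φ (t, x₀, u₀)).2.1 - cfun T ε t * x₀ with hX
  have hXs : ∀ z ∈ U, ContDiffAt ℝ ∞ X z.1 := fun z hz =>
    (hφι z hz).snd.fst.sub ((hpT z hz).smooth_cfun.mul contDiffAt_const)
  have hp : ∀ z ∈ U, ParamsAt T X (fun _ => 0) (fun _ => 0) ε z.1 := by
    intro z hz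
    refine ⟨?_, hT0 z hz, hε⟩
    filter_upwards [hnear z hz] with s hs
    exact ⟨hTs _ hs, hXs _ hs, contDiffAt_const, contDiffAt_const⟩
  have hXeq : ∀ z ∈ U, (φ z).2.1 = cfun T ε z.1 * z.2.1 + X z.1 := by
    intro z hz
    set c := cfun T ε z.1 with hc
    have hd : ∀ w ∈ U, HasFDerivAt (fun w : Base => (φ w).2.1 - c * w.2.1)
        (fderiv ℝ (fun w => (φ w).2.1) w - c • prx) w := fun w hw =>
      (hdφ w (hUs hw)).snd.fst.hasFDerivAt.sub (prx.hasFDerivAt.const_mul c)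
    -- The comparison with the centre of the ball is made inside the slice of fixed time, where
    -- `cfun` takes the constant value `c`; the slice is convex, so it contains the segment.
    have hconv : Convex ℝ (U ∩ {w : Base | w.1 = z.1}) :=
      hUc.inter (convex_hyperplane (f := fun w : Base => w.1) prt.isLinear z.1)
    have key := eq_of_fderiv_eq_zero (f := fun w : Base => (φ w).2.1 - c * w.2.1) hconv
      (fun w hw => (hd w hw.1).differentiableAt) (x := (z.1, x₀, u₀)) (y := z) ⟨hι z hz, rfl⟩
      ⟨hz, rfl⟩ ?_
    · simp only [hX] at key ⊢
      rw [← hc]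
      linarith
    · intro w hw
      rw [(hd w hw.1).fderiv, _root_.sub_apply, hasFDerivAt_prx_comp (hdφ w (hUs hw.1))]
      have e1 : z - (z.1, x₀, u₀) = (0, z.2.1 - x₀, z.2.2 - u₀) := by ext <;> simp
      rw [e1, clm_split']
      have e2 := hξ w hw.1
      rw [show w.1 = z.1 from hw.2, ← hc] at e2
      simp [h.space w (hUs hw.1), e2]
      ring
  -- the derivative with respect to `ψ`
  set H : Base → ℂ := fun z => (fderiv ℝ φ z (0, 0, 1)).2.2 with hH
  have hHeq : ∀ z ∈ U, H z = H (z.1, z.2.1, u₀) := by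
    intro z hz
    have hd : ∀ w ∈ U, DifferentiableAt ℝ (fun w => fderiv ℝ φ w (0, 0, 1)) w := fun w hw =>
      smooth_differentiableAt (smooth_fderiv_apply (hφ.contDiffAt (hUs hw)) _)
    refine (eq_of_fderiv_eq_zero (f := H) hUc (fun w hw => (hd w hw).snd.snd) (hj z hz) hz ?_).symm
    intro w hw
    have : fderiv ℝ H w = _ := (prc.hasFDerivAt.comp w (hd w hw).hasFDerivAt).fderiv
    have e1 : z - (z.1, z.2.1, u₀) = (0, 0, z.2.2 - u₀) := by ext <;> simp
    rw [this, ContinuousLinearMap.comp_apply, fderiv_fderiv_apply (hφ.contDiffAt (hUs hw)), e1]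
    exact h.affine w (hUs hw) _
  set k : ℝ × ℝ → ℂ := fun p => H (p.1, p.2, u₀) with hk
  set y : ℝ × ℝ → ℂ := fun p => (φ (p.1, p.2, u₀)).2.2 - k p * hat (deriv T t₀) u₀ with hy
  have hjs : ∀ p : ℝ × ℝ, ContDiffAt ℝ ∞ (fun p : ℝ × ℝ => ((p.1, p.2, u₀) : Base)) p := fun p =>
    contDiffAt_fst.prodMk (contDiffAt_snd.prodMk contDiffAt_const)
  have hks : ∀ z ∈ U, ContDiffAt ℝ ∞ k (z.1, z.2.1) := fun z hz =>
    ContDiffAt.comp (z.1, z.2.1) (f := fun p : ℝ × ℝ => ((p.1, p.2, u₀) : Base)) (g := H)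
      (smooth_fderiv_apply (hφ.contDiffAt (hUs (hj z hz))) _).snd.snd (hjs _)
  have hys : ∀ z ∈ U, ContDiffAt ℝ ∞ y (z.1, z.2.1) := fun z hz =>
    (ContDiffAt.comp (z.1, z.2.1) (f := fun p : ℝ × ℝ => ((p.1, p.2, u₀) : Base))
      (g := fun z => (φ z).2.2) (hφ.contDiffAt (hUs (hj z hz))).snd.snd (hjs _)).sub
      ((hks z hz).mul contDiffAt_const)
  have hyeq : ∀ z ∈ U, (φ z).2.2 = k (z.1, z.2.1) * hat (deriv T t₀) z.2.2 + y (z.1, z.2.1) := by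
    intro z hz
    set c := k (z.1, z.2.1) with hc
    have hd : ∀ w ∈ U, HasFDerivAt (fun w : Base => (φ w).2.2 - c * hat (deriv T t₀) w.2.2)
        (fderiv ℝ (fun w => (φ w).2.2) w - c • ((hatL (deriv T t₀)).comp prc)) w := by
      intro w hw
      have h1 := ((hatL (deriv T t₀)).hasFDerivAt.comp w prc.hasFDerivAt).const_mul c
      have h2 := (hdφ w (hUs hw)).snd.snd.hasFDerivAt.sub h1
      refine h2.congr_of_eventuallyEq (Filter.Eventually.of_forall fun w' => ?_)
      simp
    -- On the slice with fixed `(t, x)` the derivative `H` is constant, so `ψ̃` is affine in `ψ̂`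
    -- there.
    have hconv : Convex ℝ (U ∩ {w : Base | prj w = (z.1, z.2.1)}) :=
      hUc.inter ((convex_singleton (z.1, z.2.1)).is_linear_preimage prj.isLinear)
    have key := eq_of_fderiv_eq_zero (f := fun w : Base => (φ w).2.2 - c * hat (deriv T t₀) w.2.2)
      hconv (fun w hw => (hd w hw.1).differentiableAt) (x := (z.1, z.2.1, u₀)) (y := z)
      ⟨hj z hz, rfl⟩ ⟨hz, rfl⟩ ?_
    · simp only [hy] at key ⊢
      rw [← hc]
      linear_combination -key
    · intro w hw
      rw [(hd w hw.1).fderiv, _root_.sub_apply, hasFDerivAt_prc_comp (hdφ w (hUs hw.1))]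
      have e1 : z - (z.1, z.2.1, u₀) = (0, 0, z.2.2 - u₀) := by ext <;> simp
      have e2 := hHeq w hw.1
      have e3 : ((w.1, w.2.1) : ℝ × ℝ) = (z.1, z.2.1) := hw.2
      simp only [Prod.mk.injEq] at e3
      rw [e3.1, e3.2] at e2
      rw [e1, h.conf w (hUs hw.1), hTd w hw.1, hat_congr (hsign w hw.1)]
      change H w * _ - _ = 0
      rw [e2]
      simp [hc, hk]
  refine ⟨T, X, ε, k, y, r, hr, hUs, fun z hz => ⟨hp z hz, hks z hz, hys z hz, hsign z hz, ?_, ?_⟩⟩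
  · exact h.conf_ne _ (hUs (hj z hz))
  · exact Prod.ext (hTeq z hz) (Prod.ext (hXeq z hz) (hyeq z hz))

/-- The transformed equation for a transformation in the affine normal form. -/
theorem AdmAt.affine_eq {φ : OpenPartialHomeomorph Base Base} (hφ : IsPointTransf φ) {z : Base}
    (hz : z ∈ φ.source) {F F' : ℂ} (h : AdmAt φ z F F') {T X : ℝ → ℝ} {ε : ℝ} {k y : ℝ × ℝ → ℂ}
    (hp : ParamsAt T X (fun _ => 0) (fun _ => 0) ε z.1) (hk : ContDiffAt ℝ ∞ k (z.1, z.2.1))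
    (hy : ContDiffAt ℝ ∞ y (z.1, z.2.1))
    (hev : ∀ᶠ z' in 𝓝 z, φ z' = (T z'.1, cfun T ε z'.1 * z'.2.1 + X z'.1,
      k (z'.1, z'.2.1) * hat (deriv T z.1) z'.2.2 + y (z'.1, z'.2.1))) (b : ℂ) :
    -((|deriv T z.1| : ℝ) * F') = -(k (z.1, z.2.1) * hat (deriv T z.1) F) +
      (2 * dx k (z.1, z.2.1) - Real.sign (deriv T z.1) * Complex.I * kfun T X ε (z.1, z.2.1) *
        k (z.1, z.2.1)) * hat (deriv T z.1) b +
      lop (Real.sign (deriv T z.1)) (kfun T X ε (z.1, z.2.1)) k (z.1, z.2.1) *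
        hat (deriv T z.1) z.2.2 +
      lop (Real.sign (deriv T z.1)) (kfun T X ε (z.1, z.2.1)) y (z.1, z.2.1) := by
  set p : ℝ × ℝ := (z.1, z.2.1) with hpdef
  -- Test functions with `ψ_t = 0`, so that only the dependence on `ψ_x = b` remains.
  set f := qpoly p z.2.2 0 b 0 (-F) with hf
  have hfs : ContDiffAt ℝ ∞ f p := (contDiff_qpoly _ _ _ _ _ _).contDiffAt
  have hgr : gr f p = z := gr_qpoly _ _ _ _ _ _
  have hφs : ContDiffAt ℝ ∞ φ (gr f p) := by rw [hgr]; exact hφ.contDiffAt hz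
  have haff : ∀ᶠ z' in 𝓝 (gr f p), prj (φ z') = (T z'.1, cfun T ε z'.1 * z'.2.1 + X z'.1) := by
    rw [hgr]
    filter_upwards [hev] with z' hz'
    rw [hz']; rfl
  obtain ⟨g, h1, h2, -⟩ := exists_image hfs hφs fun v hv =>
    transversal_of_affine (smooth_differentiableAt hφs) (smooth_differentiableAt hp.smooth_T)
      (smooth_differentiableAt hp.smooth_cfun) (smooth_differentiableAt hp.smooth_X) hp.2.1
      hp.cfun_ne haff hv
  have hM : Maps φ f g p := ⟨hfs, hφs, h1, h2⟩
  have hsol := h _ _ (hM.prolongs (by rw [hgr]; exact hz)) hgr (by rw [jet_qpoly]; simp)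
  have hq : prj (φ (gr f p)) = (T p.1, cfun T ε p.1 * p.2 + X p.1) := by
    rw [haff.self_of_nhds, hgr]
  have hN : ∀ᶠ p' in 𝓝 p, g (T p'.1, cfun T ε p'.1 * p'.2 + X p'.1) =
      k p' * hat (deriv T p.1) (f p') + y p' := by
    have hev' := (gr_tendsto hfs).eventually (by rw [hgr]; exact hev)
    filter_upwards [hev', h2] with p' e1 e2
    rw [e1] at e2
    exact (congrArg (fun w => w.2.2) e2).symm
  have key := prolong_affine hq h1 hfs hk hy (smooth_differentiableAt hp.smooth_T)
    (smooth_differentiableAt hp.smooth_cfun) (smooth_differentiableAt hp.smooth_X) hp.2.1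
    hp.cfun_sq (kfun_mul_cfun hp) hN
  have hj : jet f p = ⟨p.1, p.2, z.2.2, 0, b, 0, 0, -F⟩ := jet_qpoly _ _ _ _ _ _
  have j1 : dt f p = 0 := congrArg Jet2.ut hj
  have j2 : dx f p = b := congrArg Jet2.ux hj
  have j3 : dx (dx f) p = -F := congrArg Jet2.uxx hj
  have j4 : f p = z.2.2 := congrArg Jet2.u hj
  rw [j1, j2, j3, j4] at key
  change Complex.I * dt g _ + dx (dx g) _ + F' = 0 at hsol
  have hF : Complex.I * dt g (prj (φ (gr f p))) + dx (dx g) (prj (φ (gr f p))) = -F' := by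
    linear_combination hsol
  have hneg : hat (deriv T p.1) (-F) = -hat (deriv T p.1) F := by
    have := hat_sub (deriv T p.1) 0 F
    simpa using this
  rw [hF, mul_zero, zero_add, hneg] at key
  linear_combination key

/-- The parameters `Θ` and `Ψ` enter as one factor depending on `t` only; any smooth logarithm `L`
of such a factor supplies them as its real and imaginary parts. -/
theorem efac_mul_exp (T X : ℝ → ℝ) (ε : ℝ) (L : ℝ → ℂ) (p : ℝ × ℝ) :
    efac T X (fun t => (L t).re) (fun t => (L t).im) ε p =
      efac T X (fun _ => 0) (fun _ => 0) ε p * Complex.exp (L p.1) := by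
  rw [efac, efac, ← Complex.exp_add]
  congr 1
  have h := Complex.re_add_im (L p.1)
  simp
  linear_combination h

/-- A smooth nonvanishing function has a smooth logarithm near every point. -/
theorem exists_log {M : ℝ → ℂ} {t₀ : ℝ} (hM : ∀ᶠ t in 𝓝 t₀, ContDiffAt ℝ ∞ M t) (h0 : M t₀ ≠ 0) :
    ∃ L : ℝ → ℂ, ∀ᶠ t in 𝓝 t₀, ContDiffAt ℝ ∞ L t ∧ M t = Complex.exp (L t) := by
  -- Normalizing by the value at `t₀` brings the argument near `1`, away from the cut of the
  -- principal branch.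
  refine ⟨fun t => Complex.log (M t / M t₀) + Complex.log (M t₀), ?_⟩
  have hc : ContinuousAt (fun t => M t / M t₀) t₀ := hM.self_of_nhds.continuousAt.div_const _
  have hs : ∀ᶠ t in 𝓝 t₀, M t / M t₀ ∈ Complex.slitPlane :=
    hc.eventually (Complex.isOpen_slitPlane.mem_nhds (by simp [div_self h0]))
  filter_upwards [hM, hs] with t ht hst
  refine ⟨?_, ?_⟩
  · have h1 : ContDiffAt ℝ ∞ Complex.log (M t / M t₀) :=
      (Complex.contDiffAt_log hst).restrict_scalars ℝ
    exact (ContDiffAt.comp t h1 (ht.div_const _)).add contDiffAt_const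
  · rw [Complex.exp_add, Complex.exp_log (Complex.slitPlane_ne_zero hst), Complex.exp_log h0,
      div_mul_cancel₀ _ h0]

theorem admAt_of_mem_admTransf {θ θ' : ArbElt} {φ : OpenPartialHomeomorph Base Base}
    (h : φ ∈ classS.admTransf θ θ') {z : Base} (hz : z ∈ φ.source) :
    AdmAt φ z (θ.val z * z.2.2) (θ'.val (φ z) * (φ z).2.2) := by
  intro j j' hj hjz hs
  subst hjz
  have h1 := ((h.2.2.2 j j' hj).1 ⟨h.2.1 hz, hs⟩).2
  rw [(prolongs_pt hj).2] at h1
  have h2 : j'.u = (φ j.pt).2.2 := by rw [← (prolongs_pt hj).2]; rfl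
  rw [← h2]
  exact h1

theorem deriv_comp_clm_add {S : ℝ → ℂ} {r : ℝ} (L : ℂ →L[ℝ] ℂ) (c : ℂ)
    (hS : DifferentiableAt ℝ S r) : HasDerivAt (fun r => L (S r) + c) (L (deriv S r)) r :=
  (L.hasFDerivAt.comp_hasDerivAt r hS.hasDerivAt).add_const c

/-- Classification: an admissible transformation of the class has locally the explicit form. -/
theorem hasBaseForm_of_admTransf {θ θ' : ArbElt} (hθ : θ ∈ classS.elts) (hθ' : θ' ∈ classS.elts)
    {φ : OpenPartialHomeomorph Base Base} (h : φ ∈ classS.admTransf θ θ') {z₀ : Base}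
    (hz₀ : z₀ ∈ φ.source) : HasBaseForm φ z₀ := by
  have hφ := h.1
  have hadm := fun z (hz : z ∈ φ.source) => admAt_of_mem_admTransf h hz
  obtain ⟨T, X, ε, k, y, r, hr, hUs, hU⟩ :=
    (infForm_of_admAt hφ fun z hz => ⟨_, _, hadm z hz⟩).exists_affine hφ hz₀
  set U := Metric.ball z₀ r with hUdef
  have hUo : IsOpen U := Metric.isOpen_ball
  have heq : ∀ z ∈ U, ∀ b, _ := fun z hz b => (hadm z (hUs hz)).affine_eq hφ (hUs hz) (hU z hz).1
    (hU z hz).2.1 (hU z hz).2.2.1 (by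
      filter_upwards [hUo.mem_nhds hz] with z' hz'
      rw [(hU z' hz').2.2.2.2.2, hat_congr (hU z hz).2.2.2.1]) b
  -- the equation for the factor of `ψ̂`
  have hkx : ∀ z ∈ U, 2 * dx k (z.1, z.2.1) = Real.sign (deriv T z.1) * Complex.I *
      kfun T X ε (z.1, z.2.1) * k (z.1, z.2.1) := by
    intro z hz
    -- The relation is affine in `b`; its values at `0` and `1` isolate the coefficient of `ψ̂_x`.
    have e0 := heq z hz 0
    have e1 := heq z hz 1
    rw [hat_zero] at e0
    rw [hat_one] at e1
    linear_combination e0 - e1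
  -- the summand without `ψ` vanishes
  have hy0 : ∀ z ∈ U, y (z.1, z.2.1) = 0 := by
    obtain ⟨Ω, S, hΩ, -, hΩpos, hS, hSρ, hdom, hval⟩ := hθ
    obtain ⟨Ω', S', hΩ', -, hΩpos', hS', hSρ', hdom', hval'⟩ := hθ'
    intro z hz
    obtain ⟨t, x, u⟩ := z
    obtain ⟨hp, -, -, hsg, hk0, hform⟩ := hU _ hz
    set τ := deriv T z₀.1 with hτ
    simp only at hp hsg hk0 hform hz ⊢
    have hu0 : u ≠ 0 := by
      have h1 : ((t, x, u) : Base) ∈ θ.dom := h.2.1 (hUs hz)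
      rw [hdom] at h1
      exact norm_ne_zero_iff.1 (hΩpos _ h1).ne'
    have hne : ((|deriv T t| : ℝ) : ℂ) ≠ 0 := by exact_mod_cast (abs_pos.2 hp.2.1).ne'
    have hnear : ∀ᶠ w in 𝓝 (hat τ u), ((t, x, hat τ w) : Base) ∈ U := by
      have hc : Continuous fun w : ℂ => ((t, x, hatL τ w) : Base) := by fun_prop
      have := hc.continuousAt (x := hat τ u) |>.eventually (p := fun z => z ∈ U)
        (hUo.mem_nhds (by simpa using hz))
      simpa using this
    have hSd : ∀ᶠ w in 𝓝 (hat τ u), DifferentiableAt ℝ (fun ρ : ℝ => S (t, x, ρ)) ‖w‖ := by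
      filter_upwards [hnear] with w hw
      have h1 := h.2.1 (hUs hw)
      rw [hdom] at h1
      have h2 : (t, x, ‖w‖) ∈ Ω := by simpa using h1
      have h3 : DifferentiableAt ℝ S (t, x, ‖w‖) :=
        smooth_differentiableAt (hS.contDiffAt (hΩ.mem_nhds h2))
      exact DifferentiableAt.comp ‖w‖ (f := fun ρ : ℝ => ((t, x, ρ) : ℝ × ℝ × ℝ)) h3 (by fun_prop)
    set l := lop (Real.sign (deriv T t)) (kfun T X ε (t, x)) k (t, x) with hl
    set m := lop (Real.sign (deriv T t)) (kfun T X ε (t, x)) y (t, x) with hm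
    -- At fixed `(t, x)` let `w = ψ̂`. One side of the transformed equation is radial about `w = 0`.
    -- The other depends on `|ψ̃| = |k| |w + y/k|`, hence is radial about `-y/k`. So `y/k` is the
    -- displacement of the centre.
    have key := shift_eq_zero (w₀ := hat τ u) (a := y (t, x) / k (t, x)) (B := -m / k (t, x))
      (s := fun ρ => hatL τ (S (t, x, ρ)) + -l / k (t, x))
      (s' := fun ρ => (|deriv T t| : ℝ) * S' (T t, cfun T ε t * x + X t, ‖k (t, x)‖ * ρ))
      (by simpa using hu0)
      (hSd.mono fun w hw => (deriv_comp_clm_add (hatL τ) _ hw).differentiableAt) ?_ ?_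
    · simpa [hk0] using key
    · have hd := (deriv_comp_clm_add (hatL τ) (-l / k (t, x)) hSd.self_of_nhds).deriv
      rw [hd]
      have h1 := h.2.1 (hUs hz)
      rw [hdom] at h1
      simpa using hSρ _ h1
    · filter_upwards [hnear] with w hw
      have e := heq _ hw 0
      have f1 := (hU _ hw).2.2.2.2.2
      have v1 := hval _ (h.2.1 (hUs hw))
      have v2 := hval' _ (h.2.2.1 (φ.map_source (hUs hw)))
      have hh : hat (deriv T t) = hat τ := hat_congr hsg
      rw [v1, v2, f1] at e
      simp only [hh, hat_hat, hat_zero, hat_mul, norm_hat] at e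
      rw [← hl, ← hm] at e
      have hka : k (t, x) * (w + y (t, x) / k (t, x)) = k (t, x) * w + y (t, x) := by
        field_simp
      rw [← hka, norm_mul] at e
      simp only [hatL_apply]
      refine mul_left_cancel₀ hk0 ?_
      field_simp at e ⊢
      linear_combination -e
  -- the factor of `ψ̂`
  obtain ⟨t₀, x₀, u₀⟩ := z₀
  set D := Metric.ball ((t₀, x₀) : ℝ × ℝ) r with hD
  have hDU : ∀ p ∈ D, ((p.1, p.2, u₀) : Base) ∈ U := by
    intro p hp
    rw [hD, Metric.mem_ball, Prod.dist_eq, max_lt_iff] at hp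
    rw [hUdef, mem_ball_base]
    exact ⟨hp.1, hp.2, by simpa using hr⟩
  have hUD : ∀ z ∈ U, (z.1, z.2.1) ∈ D := by
    intro z hz
    rw [hUdef, mem_ball_base] at hz
    rw [hD, Metric.mem_ball, Prod.dist_eq, max_lt_iff]
    exact ⟨hz.1, hz.2.1⟩
  set e := efac T X (fun _ => 0) (fun _ => 0) ε with he
  have hmd : ∀ p ∈ D, HasFDerivAt (fun p => k p * (e p)⁻¹)
      (k p • (-(e p ^ 2)⁻¹ • fderiv ℝ e p) + (e p)⁻¹ • fderiv ℝ k p) p := by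
    intro p hp
    have h1 := (smooth_differentiableAt (hU _ (hDU p hp)).2.1).hasFDerivAt
    have h2 := (smooth_differentiableAt (smooth_efac (p := p) (hU _ (hDU p hp)).1)).hasFDerivAt
    exact h1.mul (((hasDerivAt_inv (efac_ne _ _ _ _ _ _)).comp_hasFDerivAt p (h2.restrictScalars ℝ)))
  -- `k` and the exponential factor satisfy the same linear differential equation in `x`, so their
  -- quotient depends on `t` only.
  have hmc : ∀ p ∈ D, k p * (e p)⁻¹ = k (p.1, x₀) * (e (p.1, x₀))⁻¹ := by
    intro p hp
    have hp0 : ((p.1, x₀) : ℝ × ℝ) ∈ D := by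
      rw [hD, Metric.mem_ball, Prod.dist_eq, max_lt_iff] at hp ⊢
      exact ⟨hp.1, by simpa using hr⟩
    refine (eq_of_fderiv_eq_zero (f := fun p => k p * (e p)⁻¹) (convex_ball _ r)
      (fun p hp => (hmd p hp).differentiableAt) hp0 hp fun q hq => ?_).symm
    have hv : p - (p.1, x₀) = (p.2 - x₀) • ((0 : ℝ), (1 : ℝ)) := by ext <;> simp
    rw [(hmd q hq).fderiv, hv, map_smul]
    have e1 := hkx _ (hDU q hq)
    have e2 := efac_dx (p := q) (hU _ (hDU q hq)).1
    have e3 : Real.sign (deriv T q.1) * Complex.I * kfun T X ε q =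
        2 * (Complex.I * (2 * afun T q.1 * q.2 + bfun T X ε q.1)) := by
      have : Real.sign (deriv T q.1) ^ 2 = 1 := by
        rcases Real.sign_apply_eq_of_ne_zero _ (hU _ (hDU q hq)).1.2.1 with h | h <;> rw [h] <;>
          norm_num
      have hc : (Real.sign (deriv T q.1) : ℂ) ^ 2 = 1 := by exact_mod_cast this
      rw [kfun]
      push_cast
      linear_combination (2 * Complex.I * (2 * afun T q.1 * q.2 + bfun T X ε q.1)) * hc
    simp only at e1
    rw [e3] at e1
    change 2 * fderiv ℝ k q (0, 1) = _ * k q at e1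
    change fderiv ℝ e q (0, 1) = _ * e q at e2
    have hne : e q ≠ 0 := efac_ne _ _ _ _ _ _
    simp only [_root_.add_apply, _root_.smul_apply, smul_eq_mul, e2]
    have e4 : fderiv ℝ k q (0, 1) =
      Complex.I * (2 * afun T q.1 * q.2 + bfun T X ε q.1) * k q := by linear_combination e1 / 2
    rw [e4]
    simp
    field_simp
    ring
  have hlog : ∀ᶠ t in 𝓝 t₀, ContDiffAt ℝ ∞ (fun t => k (t, x₀) * (e (t, x₀))⁻¹) t := by
    have hc : Continuous fun t : ℝ => ((t, x₀) : ℝ × ℝ) := by fun_prop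
    have hn : ∀ᶠ t in 𝓝 t₀, ((t, x₀) : ℝ × ℝ) ∈ D :=
      hc.continuousAt.eventually (Metric.isOpen_ball.mem_nhds (Metric.mem_ball_self hr))
    filter_upwards [hn] with t ht
    have h1 : ContDiffAt ℝ ∞ (fun p => k p * (e p)⁻¹) (t, x₀) :=
      (hU _ (hDU _ ht)).2.1.mul ((smooth_efac (p := (t, x₀)) (hU _ (hDU _ ht)).1).inv
        (efac_ne _ _ _ _ _ _))
    exact ContDiffAt.comp t (f := fun t : ℝ => ((t, x₀) : ℝ × ℝ)) h1
      (contDiffAt_id.prodMk contDiffAt_const)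
  have hz₀U : ((t₀, x₀, u₀) : Base) ∈ U := Metric.mem_ball_self hr
  obtain ⟨L, hL⟩ := exists_log hlog
    (mul_ne_zero (hU _ hz₀U).2.2.2.2.1 (inv_ne_zero (efac_ne _ _ _ _ _ _)))
  refine ⟨T, X, fun t => (L t).re, fun t => (L t).im, ε, ⟨?_, (hU _ hz₀U).1.2⟩, ?_⟩
  · filter_upwards [(hU _ hz₀U).1.1, hL] with t h1 h2
    exact ⟨h1.1, h1.2.1, Complex.reCLM.contDiff.contDiffAt.comp t h2.1,
      Complex.imCLM.contDiff.contDiffAt.comp t h2.1⟩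
  · filter_upwards [hUo.mem_nhds hz₀U, (continuous_fst.tendsto ((t₀, x₀, u₀) : Base)).eventually hL]
      with z hz hLz
    obtain ⟨-, -, -, hs, -, hf⟩ := hU z hz
    rw [hf, baseMap_eq, efac_mul_exp, ← hLz.2, hy0 z hz, ← hmc _ (hUD z hz), hat_congr hs]
    have hne : e (z.1, z.2.1) ≠ 0 := efac_ne _ _ _ _ _ _
    rw [← he]
    congr 2
    field_simp
    ring

/-! ### Construction of point transformations from the parameters. -/

/-- A smooth map with a smooth inverse, as a point transformation. -/
theorem exists_pointTransf {E : Type} [NormedAddCommGroup E] [NormedSpace ℝ E] {f g : E → E}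
    {U V : Set E} (hU : IsOpen U) (hV : IsOpen V) (hUV : Set.MapsTo f U V) (hVU : Set.MapsTo g V U)
    (hgf : ∀ x ∈ U, g (f x) = x) (hfg : ∀ y ∈ V, f (g y) = y)
    (hf : ∀ x ∈ U, ContDiffAt ℝ ∞ f x) (hg : ∀ y ∈ V, ContDiffAt ℝ ∞ g y) :
    ∃ e : OpenPartialHomeomorph E E, IsPointTransf e ∧ e.source = U ∧ e.target = V ∧
      (∀ x, e x = f x) ∧ ∀ y, e.symm y = g y := by
  refine ⟨{ toFun := f, invFun := g, source := U, target := V, map_source' := fun _ h => hUV h,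
            map_target' := fun _ h => hVU h, left_inv' := fun _ h => hgf _ h,
            right_inv' := fun _ h => hfg _ h, open_source := hU, open_target := hV,
            continuousOn_toFun := fun x hx => (hf x hx).continuousAt.continuousWithinAt,
            continuousOn_invFun := fun y hy => (hg y hy).continuousAt.continuousWithinAt },
    ⟨?_, ?_⟩, rfl, rfl, fun _ => rfl, fun _ => rfl⟩
  · exact fun x hx => (hf x hx).contDiffWithinAt
  · exact fun y hy => (hg y hy).contDiffWithinAt

/-- A smooth function with nonvanishing derivative on an open interval has a smooth inverse. -/
theorem exists_inverse {T : ℝ → ℝ} {I : Set ℝ} (hI : IsOpen I) (hc : I.OrdConnected)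
    (hT : ∀ t ∈ I, ContDiffAt ℝ ∞ T t) (h0 : ∀ t ∈ I, deriv T t ≠ 0) :
    ∃ g : ℝ → ℝ, IsOpen (T '' I) ∧ (∀ t ∈ I, g (T t) = t) ∧
      ∀ s ∈ T '' I, ContDiffAt ℝ ∞ g s := by
  -- By Rolle's theorem; the interval condition keeps the intermediate point in `I`.
  have hinj : Set.InjOn T I := by
    have key : ∀ a ∈ I, ∀ b ∈ I, T a = T b → ¬ a < b := by
      intro a ha b hb hab hlt
      have hs : Set.Icc a b ⊆ I := hc.out ha hb
      obtain ⟨c, hcm, hc0⟩ := exists_deriv_eq_zero hlt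
        (fun x hx => (hT x (hs hx)).continuousAt.continuousWithinAt) hab
      exact h0 c (hs (Set.Ioo_subset_Icc_self hcm)) hc0
    intro a ha b hb hab
    exact le_antisymm (not_lt.1 (key b hb a ha hab.symm)) (not_lt.1 (key a ha b hb hab))
  have hst : ∀ t ∈ I, HasStrictDerivAt T (deriv T t) t := fun t ht =>
    (hT t ht).hasStrictDerivAt (by simp)
  have hmap : ∀ t ∈ I, Filter.map T (𝓝 t) = 𝓝 (T t) := fun t ht =>
    (hst t ht).map_nhds_eq (h0 t ht)
  have himg : ∀ V ⊆ I, IsOpen V → IsOpen (T '' V) := by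
    intro V hV hVo
    rw [isOpen_iff_mem_nhds]
    rintro _ ⟨t, ht, rfl⟩
    rw [← hmap t (hV ht)]
    exact Filter.image_mem_map (hVo.mem_nhds ht)
  set g := Function.invFunOn T I
  have hg : ∀ t ∈ I, g (T t) = t := fun t ht => hinj.leftInvOn_invFunOn ht
  refine ⟨g, himg I le_rfl hI, hg, ?_⟩
  have hgc : ∀ s ∈ T '' I, ContinuousAt g s := by
    rintro _ ⟨t, ht, rfl⟩
    rw [ContinuousAt, hg t ht, ← hmap t ht, Filter.tendsto_map'_iff]
    refine Filter.Tendsto.congr' (f₁ := id) ?_ Filter.tendsto_id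
    filter_upwards [hI.mem_nhds ht] with s hs using (hg s hs).symm
  rintro _ ⟨t, ht, rfl⟩
  let e : OpenPartialHomeomorph ℝ ℝ :=
    { toFun := T, invFun := g, source := I, target := T '' I,
      map_source' := fun x hx => Set.mem_image_of_mem _ hx,
      map_target' := by rintro _ ⟨x, hx, rfl⟩; rwa [hg x hx],
      left_inv' := fun x hx => hg x hx,
      right_inv' := by rintro _ ⟨x, hx, rfl⟩; rw [hg x hx],
      open_source := hI, open_target := himg I le_rfl hI,
      continuousOn_toFun := fun x hx => (hT x hx).continuousAt.continuousWithinAt,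
      continuousOn_invFun := fun y hy => (hgc y hy).continuousWithinAt }
  exact e.contDiffAt_symm_deriv (f₀' := deriv T t) (h0 t ht) (Set.mem_image_of_mem _ ht)
    (show HasDerivAt T _ (g (T t)) by rw [hg t ht]; exact (hst t ht).hasDerivAt)
    (show ContDiffAt ℝ ∞ T (g (T t)) by rw [hg t ht]; exact hT t ht)

/-- Fibre-preserving point transformations over the explicit transformations of `(t, x)`. -/
theorem exists_fibre_pointTransf {V : Type} [NormedAddCommGroup V] [NormedSpace ℝ V]
    {T X Θ Ψ : ℝ → ℝ} {ε : ℝ} {I : Set ℝ} (hI : IsOpen I) (hc : I.OrdConnected)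
    (hp : ∀ t ∈ I, ParamsAt T X Θ Ψ ε t) {A : Set V} (hA : IsOpen A) (m n : ℝ × ℝ × V → V)
    (hmA : ∀ y, y.1 ∈ I → y.2.2 ∈ A → m y ∈ A) (hnA : ∀ y, y.1 ∈ I → y.2.2 ∈ A → n y ∈ A)
    (hnm : ∀ y, y.1 ∈ I → y.2.2 ∈ A → n (y.1, y.2.1, m y) = y.2.2)
    (hmn : ∀ y, y.1 ∈ I → y.2.2 ∈ A → m (y.1, y.2.1, n y) = y.2.2)
    (hm : ∀ y, y.1 ∈ I → y.2.2 ∈ A → ContDiffAt ℝ ∞ m y)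
    (hn : ∀ y, y.1 ∈ I → y.2.2 ∈ A → ContDiffAt ℝ ∞ n y) :
    ∃ e : OpenPartialHomeomorph (ℝ × ℝ × V) (ℝ × ℝ × V), IsPointTransf e ∧
      e.source = {y | y.1 ∈ I ∧ y.2.2 ∈ A} ∧
      ∀ y, e y = (T y.1, cfun T ε y.1 * y.2.1 + X y.1, m y) := by
  obtain ⟨g, hTI, hg, hgs⟩ := exists_inverse hI hc (fun t ht => (hp t ht).smooth_T)
    (fun t ht => (hp t ht).2.1)
  have hgI : ∀ s ∈ T '' I, g s ∈ I ∧ T (g s) = s := by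
    rintro _ ⟨t, ht, rfl⟩; rw [hg t ht]; exact ⟨ht, rfl⟩
  -- `b` undoes the change of `(t, x)` and keeps the fibre variable; the fibre inverse `n` is then
  -- evaluated at the old `(t, x)`.
  set b : ℝ × ℝ × V → ℝ × ℝ × V :=
    fun y => (g y.1, (y.2.1 - X (g y.1)) / cfun T ε (g y.1), y.2.2) with hb
  have hfst : Continuous fun y : ℝ × ℝ × V => y.1 := continuous_fst
  have hsnd : Continuous fun y : ℝ × ℝ × V => y.2.2 := by fun_prop
  refine Exists.imp (fun e h => ⟨h.1, h.2.1, h.2.2.2.1⟩) (exists_pointTransf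
    (f := fun y : ℝ × ℝ × V => (T y.1, cfun T ε y.1 * y.2.1 + X y.1, m y))
    (g := fun y => ((b y).1, (b y).2.1, n (b y)))
    (U := {y | y.1 ∈ I ∧ y.2.2 ∈ A}) (V := {y | y.1 ∈ T '' I ∧ y.2.2 ∈ A})
    ((hI.preimage hfst).inter (hA.preimage hsnd)) ((hTI.preimage hfst).inter (hA.preimage hsnd))
    (fun y hy => ⟨⟨_, hy.1, rfl⟩, hmA y hy.1 hy.2⟩)
    (fun y hy => ⟨(hgI _ hy.1).1, hnA _ (hgI _ hy.1).1 hy.2⟩) ?_ ?_ ?_ ?_)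
  · rintro ⟨t, x, v⟩ ⟨ht, hv⟩
    have hc0 := (hp t ht).cfun_ne
    simp only [hb, hg t ht]
    rw [show (cfun T ε t * x + X t - X t) / cfun T ε t = x by field_simp; ring]
    simp only [hnm (t, x, v) ht hv]
  · rintro ⟨s, x, v⟩ ⟨hs, hv⟩
    obtain ⟨h1, h2⟩ := hgI s hs
    have hc0 := (hp _ h1).cfun_ne
    simp only [hb, h2]
    rw [hmn (g s, (x - X (g s)) / cfun T ε (g s), v) h1 hv]
    congr 2
    field_simp
    ring
  · rintro y ⟨ht, hv⟩
    have hP := hp _ ht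
    exact (smooth_fst hP.smooth_T).prodMk ((((smooth_fst hP.smooth_cfun).mul
      (contDiffAt_fst.comp y contDiffAt_snd)).add (smooth_fst hP.smooth_X)).prodMk (hm y ht hv))
  · rintro y ⟨hs, hv⟩
    obtain ⟨h1, h2⟩ := hgI _ hs
    have hP := hp _ h1
    have a1 : ContDiffAt ℝ ∞ (fun y : ℝ × ℝ × V => g y.1) y := smooth_fst (hgs _ hs)
    have a2 : ContDiffAt ℝ ∞ (fun y : ℝ × ℝ × V => X (g y.1)) y :=
      ContDiffAt.comp y (f := fun y : ℝ × ℝ × V => g y.1) hP.smooth_X a1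
    have a3 : ContDiffAt ℝ ∞ (fun y : ℝ × ℝ × V => cfun T ε (g y.1)) y :=
      ContDiffAt.comp y (f := fun y : ℝ × ℝ × V => g y.1) hP.smooth_cfun a1
    have a4 : ContDiffAt ℝ ∞ (fun y : ℝ × ℝ × V => (y.2.1 - X (g y.1)) / cfun T ε (g y.1)) y :=
      ((contDiffAt_fst.comp y contDiffAt_snd).sub a2).div a3 hP.cfun_ne
    have a5 : ContDiffAt ℝ ∞ b y := a1.prodMk (a4.prodMk (contDiffAt_snd.comp y contDiffAt_snd))
    exact a1.prodMk (a4.prodMk (ContDiffAt.comp y (hn (b y) h1 hv) a5))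

/-- Every time has a neighbourhood that is an interval on which the parameters are good. -/
theorem ParamsAt.exists_interval {T X Θ Ψ : ℝ → ℝ} {ε t : ℝ} (h : ParamsAt T X Θ Ψ ε t) :
    ∃ I : Set ℝ, IsOpen I ∧ I.OrdConnected ∧ t ∈ I ∧ ∀ s ∈ I, ParamsAt T X Θ Ψ ε s := by
  obtain ⟨r, hr, hs⟩ := Metric.eventually_nhds_iff_ball.1 h.eventually
  refine ⟨Metric.ball t r, Metric.isOpen_ball, ?_, Metric.mem_ball_self hr, hs⟩
  rw [Real.ball_eq_Ioo]
  exact Set.ordConnected_Ioo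

theorem smooth_div {E : Type} [NormedAddCommGroup E] [NormedSpace ℝ E] {f g : E → ℂ} {x : E}
    (hf : ContDiffAt ℝ ∞ f x) (hg : ContDiffAt ℝ ∞ g x) (h0 : g x ≠ 0) :
    ContDiffAt ℝ ∞ (fun y => f y / g y) x := by
  simp only [div_eq_mul_inv]
  exact hf.mul (hg.inv h0)

theorem smooth_hat {E : Type} [NormedAddCommGroup E] [NormedSpace ℝ E] {τ : E → ℝ} {f : E → ℂ}
    {x : E} (hτ : ∀ᶠ y in 𝓝 x, (0 < τ y ↔ 0 < τ x)) (hf : ContDiffAt ℝ ∞ f x) :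
    ContDiffAt ℝ ∞ (fun y => hat (τ y) (f y)) x := by
  have h1 : ContDiffAt ℝ ∞ (fun y => hatL (τ x) (f y)) x := (hatL (τ x)).contDiff.contDiffAt.comp x hf
  refine h1.congr_of_eventuallyEq ?_
  filter_upwards [hτ] with y hy
  rw [hatL_apply, hat_congr hy]

theorem ParamsAt.sign_fst {E : Type} [NormedAddCommGroup E] {T X Θ Ψ : ℝ → ℝ} {ε : ℝ}
    {y : ℝ × E} (h : ParamsAt T X Θ Ψ ε y.1) :
    ∀ᶠ y' in 𝓝 y, (0 < deriv T y'.1 ↔ 0 < deriv T y.1) :=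
  (continuous_fst.tendsto y).eventually (h.sign_eventually.mono fun _ hs => hs.1)

/-- The transformation `(t, x, ρ) ↦ (T, ε x |T_t|^{1/2} + X, ρ exp Θ)`. -/
theorem exists_radial_pointTransf {T X Θ Ψ : ℝ → ℝ} {ε : ℝ} {I : Set ℝ} (hI : IsOpen I)
    (hc : I.OrdConnected) (hp : ∀ t ∈ I, ParamsAt T X Θ Ψ ε t) :
    ∃ e : OpenPartialHomeomorph (ℝ × ℝ × ℝ) (ℝ × ℝ × ℝ), IsPointTransf e ∧
      e.source = {y | y.1 ∈ I ∧ 0 < y.2.2} ∧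
      ∀ y, e y = (T y.1, cfun T ε y.1 * y.2.1 + X y.1, y.2.2 * Real.exp (Θ y.1)) := by
  have hs : ∀ y : ℝ × ℝ × ℝ, ContDiffAt ℝ ∞ (fun y : ℝ × ℝ × ℝ => y.2.2) y := fun y =>
    contDiffAt_snd.comp y contDiffAt_snd
  refine exists_fibre_pointTransf hI hc hp (A := Set.Ioi 0) isOpen_Ioi
    (fun y => y.2.2 * Real.exp (Θ y.1)) (fun y => y.2.2 * Real.exp (-Θ y.1)) ?_ ?_ ?_ ?_ ?_ ?_
  · exact fun y _ h => mul_pos h (Real.exp_pos _)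
  · exact fun y _ h => mul_pos h (Real.exp_pos _)
  · intro y _ _
    simp only
    rw [mul_assoc, ← Real.exp_add]; simp
  · intro y _ _
    simp only
    rw [mul_assoc, ← Real.exp_add]; simp
  · exact fun y ht _ => (hs y).mul (smooth_fst (hp _ ht).smooth_Θ).exp
  · exact fun y ht _ => (hs y).mul (smooth_fst (hp _ ht).smooth_Θ).neg.exp

/-- The explicit transformations on a time interval. -/
theorem exists_baseMap_pointTransf {T X Θ Ψ : ℝ → ℝ} {ε : ℝ} {I : Set ℝ} (hI : IsOpen I)
    (hc : I.OrdConnected) (hp : ∀ t ∈ I, ParamsAt T X Θ Ψ ε t) :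
    ∃ φ : OpenPartialHomeomorph Base Base, IsPointTransf φ ∧
      φ.source = {z | z.1 ∈ I ∧ z.2.2 ≠ 0} ∧ ∀ z, φ z = baseMap T X Θ Ψ 0 ε z := by
  have hs : ∀ y : Base, ContDiffAt ℝ ∞ (fun y : Base => y.2.2) y := fun y =>
    contDiffAt_snd.comp y contDiffAt_snd
  have he : ∀ y : Base, y.1 ∈ I → ContDiffAt ℝ ∞
      (fun y : Base => efac T X Θ Ψ ε (y.1, y.2.1)) y := fun y ht =>
    ContDiffAt.comp y (f := fun y : Base => (y.1, y.2.1)) (smooth_efac (p := (y.1, y.2.1)) (hp _ ht))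
      (contDiffAt_fst.prodMk (contDiffAt_fst.comp y contDiffAt_snd))
  refine Exists.imp (fun e h => ⟨h.1, h.2.1, fun z => by rw [h.2.2, baseMap_eq]⟩)
    (exists_fibre_pointTransf hI hc hp (A := {0}ᶜ) isOpen_compl_singleton
    (fun y => hat (deriv T y.1) y.2.2 * efac T X Θ Ψ ε (y.1, y.2.1))
    (fun y => hat (deriv T y.1) (y.2.2 / efac T X Θ Ψ ε (y.1, y.2.1))) ?_ ?_ ?_ ?_ ?_ ?_)
  · intro y _ h
    have : y.2.2 ≠ 0 := h
    simp [efac_ne, this]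
  · intro y _ h
    have : y.2.2 ≠ 0 := h
    simp [efac_ne, this]
  · intro y _ _
    simp [efac_ne]
  · intro y _ _
    simp [efac_ne]
  · exact fun y ht _ => (smooth_hat (hp _ ht).sign_fst (hs y)).mul (he y ht)
  · exact fun y ht _ => smooth_hat (hp _ ht).sign_fst (smooth_div (hs y) (he y ht) (efac_ne _ _ _ _ _ _))

/-- The transformed arbitrary element depends smoothly on its arguments. -/
theorem smooth_sMap {E : Type} [NormedAddCommGroup E] [NormedSpace ℝ E] {T X Θ Ψ : ℝ → ℝ} {ε : ℝ}
    {z : E → Base} {s : E → ℂ} {y : E} (h : ParamsAt T X Θ Ψ ε (z y).1)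
    (hz : ContDiffAt ℝ ∞ z y) (hs : ContDiffAt ℝ ∞ s y) :
    ContDiffAt ℝ ∞ (fun y => sMap T X Θ Ψ ε (z y, s y)) y := by
  have ht : ContDiffAt ℝ ∞ (fun y => (z y).1) y := contDiffAt_fst.comp y hz
  have hx : ContDiffAt ℝ ∞ (fun y => (z y).2.1) y :=
    contDiffAt_fst.comp y (contDiffAt_snd.comp y hz)
  have hc : ∀ {f : ℝ → ℝ}, ContDiffAt ℝ ∞ f (z y).1 → ContDiffAt ℝ ∞ (fun y => f (z y).1) y :=
    fun hf => ContDiffAt.comp y (f := fun y => (z y).1) hf ht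
  have h1 := smooth_deriv h.smooth_T
  have h2 := smooth_deriv h1
  have h3 := smooth_deriv h2
  have hX := smooth_deriv h.smooth_X
  have hquot := smooth_deriv (hX.div h1 h.2.1)
  have hT1 := hc h1
  have hT2 := hc h2
  have hT3 := hc h3
  have hsg := hc h.smooth_sign
  have hsg0 : Real.sign (deriv T (z y).1) ≠ 0 := by
    rcases Real.sign_apply_eq_of_ne_zero _ h.2.1 with h | h <;> rw [h] <;> norm_num
  have hev : ∀ᶠ y' in 𝓝 y, (0 < deriv T (z y').1 ↔ 0 < deriv T (z y).1) :=
    ht.continuousAt.eventually (h.sign_eventually.mono fun _ hs => hs.1)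
  simp only [sMap, iteratedDeriv_two', iteratedDeriv_three']
  refine ContDiffAt.sub (ContDiffAt.add (ContDiffAt.add (ContDiffAt.add ?_ ?_) ?_) ?_) ?_
  · have hd : ContDiffAt ℝ ∞ (fun y => ((|deriv T (z y).1| : ℝ) : ℂ)) y :=
      smooth_ofReal (hc h.smooth_abs)
    exact smooth_div (smooth_hat hev hs) hd (by exact_mod_cast (abs_pos.2 h.2.1).ne')
  · exact smooth_ofReal (((((contDiffAt_const.mul hT3).mul hT1).sub
      (contDiffAt_const.mul (hT2.pow 2))).div ((contDiffAt_const.mul hsg).mul (hT1.pow 3))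
      (mul_ne_zero (mul_ne_zero (by norm_num) hsg0) (pow_ne_zero _ h.2.1))).mul (hx.pow 2))
  · exact smooth_ofReal ((((contDiffAt_const.mul hsg).div (contDiffAt_const.mul (hc h.smooth_sqrt))
      (mul_ne_zero two_ne_zero h.sqrt_pos.ne')).mul (hc hquot)).mul hx)
  · have hd : ContDiffAt ℝ ∞ (fun y => ((deriv T (z y).1 : ℝ) : ℂ)) y := smooth_ofReal hT1
    exact smooth_div ((smooth_ofReal (hc (smooth_deriv h.smooth_Ψ))).sub
      (contDiffAt_const.mul (smooth_ofReal (hc (smooth_deriv h.smooth_Θ)))))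
      hd (by exact_mod_cast h.2.1)
  · have hd : ContDiffAt ℝ ∞ (fun y => ((4 * deriv T (z y).1 ^ 2 : ℝ) : ℂ)) y :=
      smooth_ofReal (contDiffAt_const.mul (hT1.pow 2))
    exact smooth_div
      ((smooth_ofReal ((hc hX).pow 2)).add (contDiffAt_const.mul (smooth_ofReal hT2)))
      hd (by exact_mod_cast mul_ne_zero four_ne_zero (pow_ne_zero 2 h.2.1))

/-! ### Admissibility of the explicit transformations and the transformed arbitrary elements. -/

theorem prolong_eq_zero_iff {φ : OpenPartialHomeomorph Base Base} {z : Base} {T X Θ Ψ : ℝ → ℝ}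
    {ε : ℝ} (h : ParamsAt T X Θ Ψ ε z.1) (hev : φ =ᶠ[𝓝 z] baseMap T X Θ Ψ 0 ε) {j j' : Jet2}
    (hj : Prolongs φ j j') (hz : j.pt = z) (S : ℂ) :
    Complex.I * j.ut + j.uxx + S * j.u = 0 ↔
      Complex.I * j'.ut + j'.uxx + sMap T X Θ Ψ ε (z, S) * j'.u = 0 := by
  have h1 := prolong_baseMap h hev hj hz S
  have hne : ((|deriv T z.1| : ℝ) : ℂ) ≠ 0 := by exact_mod_cast (abs_pos.2 h.2.1).ne'
  constructor
  · intro h0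
    rw [h0, hat_zero, mul_zero] at h1
    exact (mul_eq_zero.1 h1).resolve_left hne
  · intro h0
    rw [h0, mul_zero] at h1
    exact hat_eq_zero.1 ((mul_eq_zero.1 h1.symm).resolve_left (efac_ne _ _ _ _ _ _))

/-- A transformation of the explicit form is admissible if the arbitrary elements are related by the
explicit formula. -/
theorem mem_admTransf_of_baseMap {θ θ' : ArbElt} {φ : OpenPartialHomeomorph Base Base}
    (hφ : IsPointTransf φ) (hs : φ.source ⊆ θ.dom) (ht : φ.target ⊆ θ'.dom)
    (h : ∀ z ∈ φ.source, ∃ (T X Θ Ψ : ℝ → ℝ) (ε : ℝ), ParamsAt T X Θ Ψ ε z.1 ∧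
      φ =ᶠ[𝓝 z] baseMap T X Θ Ψ 0 ε ∧ θ'.val (φ z) = sMap T X Θ Ψ ε (z, θ.val z)) :
    φ ∈ classS.admTransf θ θ' := by
  refine ⟨hφ, hs, ht, fun j j' hj => ?_⟩
  obtain ⟨h1, h2⟩ := prolongs_pt hj
  obtain ⟨T, X, Θ, Ψ, ε, hp, hev, hval⟩ := h _ h1
  have key := prolong_eq_zero_iff hp hev hj rfl (θ.val j.pt)
  rw [← hval, ← h2] at key
  have hd : j'.pt ∈ θ'.dom := by rw [h2]; exact ht (φ.map_source h1)
  exact ⟨fun hm => ⟨hd, key.1 hm.2⟩, fun hm => ⟨hs h1, key.2 hm.2⟩⟩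

/-- At a point with `ψ ≠ 0` a value `F` is the same as the value `S = F/ψ`, so the pointwise
identity for `S` also serves the wider class, where `F` need not come from a radial function. -/
theorem mem_admTransf_F_of_baseMap {θ θ' : ArbElt} {φ : OpenPartialHomeomorph Base Base}
    (hφ : IsPointTransf φ) (hs : φ.source ⊆ θ.dom) (ht : φ.target ⊆ θ'.dom)
    (h : ∀ z ∈ φ.source, z.2.2 ≠ 0 ∧ ∃ (T X Θ Ψ : ℝ → ℝ) (ε : ℝ), ParamsAt T X Θ Ψ ε z.1 ∧
      φ =ᶠ[𝓝 z] baseMap T X Θ Ψ 0 ε ∧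
      θ'.val (φ z) = sMap T X Θ Ψ ε (z, θ.val z / z.2.2) * (φ z).2.2) :
    φ ∈ classF'.admTransf θ θ' := by
  refine ⟨hφ, hs, ht, fun j j' hj => ?_⟩
  obtain ⟨h1, h2⟩ := prolongs_pt hj
  obtain ⟨hu, T, X, Θ, Ψ, ε, hp, hev, hval⟩ := h _ h1
  have key := prolong_eq_zero_iff hp hev hj rfl (θ.val j.pt / j.pt.2.2)
  have h3 : j'.u = (φ j.pt).2.2 := by rw [← h2]; rfl
  rw [h3, ← hval, ← h2, show j.u = j.pt.2.2 from rfl, div_mul_cancel₀ _ hu] at key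
  have hd : j'.pt ∈ θ'.dom := by rw [h2]; exact ht (φ.map_source h1)
  exact ⟨fun hm => ⟨hd, key.1 hm.2⟩, fun hm => ⟨hs h1, key.2 hm.2⟩⟩

/-- The map `(t, x, ψ) ↦ (t, x, |ψ|)`. -/
noncomputable def pol (z : Base) : ℝ × ℝ × ℝ := (z.1, z.2.1, ‖z.2.2‖)

theorem continuous_pol : Continuous pol := by unfold pol; fun_prop

theorem pol_baseMap (T X Θ Ψ : ℝ → ℝ) (ε : ℝ) (z : Base) : pol (baseMap T X Θ Ψ 0 ε z) =
    (T (pol z).1, cfun T ε (pol z).1 * (pol z).2.1 + X (pol z).1,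
      (pol z).2.2 * Real.exp (Θ (pol z).1)) := by
  rw [baseMap_eq]
  simp [pol, norm_efac]

/-- The transformed arbitrary element is again in the class. -/
theorem exists_transformed_elt {T X Θ Ψ : ℝ → ℝ} {ε : ℝ} {I : Set ℝ} (hI : IsOpen I)
    (hc : I.OrdConnected) (hp : ∀ t ∈ I, ParamsAt T X Θ Ψ ε t) {B : Set (ℝ × ℝ × ℝ)}
    (hB : IsOpen B) (hBc : IsConnected B) (hBI : ∀ y ∈ B, y.1 ∈ I ∧ 0 < y.2.2) {S : ℝ × ℝ × ℝ → ℂ}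
    (hS : ContDiffOn ℝ ∞ S B) (hSρ : ∀ y ∈ B, deriv (fun ρ : ℝ => S (y.1, y.2.1, ρ)) y.2.2 ≠ 0) :
    ∃ θ' ∈ classS.elts, ∀ z, pol z ∈ B → baseMap T X Θ Ψ 0 ε z ∈ θ'.dom ∧
      θ'.val (baseMap T X Θ Ψ 0 ε z) = sMap T X Θ Ψ ε (z, S (pol z)) := by
  obtain ⟨e, he, hes, hee⟩ := exists_radial_pointTransf hI hc hp
  have hBs : B ⊆ e.source := fun y hy => by rw [hes]; exact hBI y hy
  -- The transformed function is read off at the preimage. The zero in the place of `ψ` is harmless,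
  -- because `sMap` does not use that entry.
  set S' : ℝ × ℝ × ℝ → ℂ := fun y =>
    sMap T X Θ Ψ ε (((e.symm y).1, (e.symm y).2.1, 0), S (e.symm y)) with hS'
  have hopen : IsOpen (e '' B) := e.isOpen_image_of_subset_source hB hBs
  have hsymm : ∀ y ∈ B, e.symm (e y) = y := fun y hy => e.left_inv (hBs hy)
  refine ⟨⟨{z | pol z ∈ e '' B}, fun z => S' (pol z)⟩, ⟨e '' B, S', hopen,
    hBc.image _ (e.continuousOn.mono hBs), ?_, ?_, ?_, rfl, fun z _ => rfl⟩, ?_⟩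
  · rintro _ ⟨y, hy, rfl⟩
    rw [hee]
    exact mul_pos (hBI y hy).2 (Real.exp_pos _)
  · rintro _ ⟨y, hy, rfl⟩
    have h1 : ContDiffAt ℝ ∞ e.symm (e y) :=
      he.2.contDiffAt (e.open_target.mem_nhds (e.map_source (hBs hy)))
    refine ContDiffAt.contDiffWithinAt (smooth_sMap ?_ ?_ ?_)
    · simp only [hsymm y hy]
      exact hp _ (hBI y hy).1
    · exact (contDiffAt_fst.comp _ h1).prodMk
        ((contDiffAt_fst.comp _ (contDiffAt_snd.comp _ h1)).prodMk contDiffAt_const)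
    · refine ContDiffAt.comp _ ?_ h1
      rw [hsymm y hy]
      exact hS.contDiffAt (hB.mem_nhds hy)
  -- `S̃_ρ̃` equals the hat of `S_ρ` times `exp(-Θ) / |T_t|`, because `ρ = ρ̃ exp(-Θ)`; so it does
  -- not vanish.
  · rintro _ ⟨b, hb, rfl⟩
    have hP := hp _ (hBI b hb).1
    have hSd : DifferentiableAt ℝ S (b.1, b.2.1, b.2.2) :=
      smooth_differentiableAt (hS.contDiffAt (hB.mem_nhds hb))
    have h1 : HasDerivAt (fun ρ : ℝ => S (b.1, b.2.1, ρ))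
        (deriv (fun ρ : ℝ => S (b.1, b.2.1, ρ)) b.2.2) b.2.2 :=
      (DifferentiableAt.comp b.2.2 (f := fun ρ : ℝ => ((b.1, b.2.1, ρ) : ℝ × ℝ × ℝ)) hSd
        (by fun_prop)).hasDerivAt
    set E := Real.exp (-Θ b.1) with hE
    have hval : b.2.2 * Real.exp (Θ b.1) * E = b.2.2 := by
      rw [hE, mul_assoc, ← Real.exp_add]; simp
    have h2 : HasDerivAt (fun ρ' : ℝ => ρ' * E) E (b.2.2 * Real.exp (Θ b.1)) := by
      simpa using (hasDerivAt_id (b.2.2 * Real.exp (Θ b.1))).mul_const E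
    have h3 : HasDerivAt (fun ρ' : ℝ => S (b.1, b.2.1, ρ' * E)) _ (b.2.2 * Real.exp (Θ b.1)) :=
      HasDerivAt.scomp (g₁ := fun ρ : ℝ => S (b.1, b.2.1, ρ)) (h := fun ρ' : ℝ => ρ' * E) (b.2.2 * Real.exp (Θ b.1))
        (by rw [hval]; exact h1) h2
    have h4 := (((hatL (deriv T b.1)).hasFDerivAt.comp_hasDerivAt _ h3).div_const
      ((|deriv T b.1| : ℝ) : ℂ)).add_const (sMap T X Θ Ψ ε ((b.1, b.2.1, 0), 0))
    rw [hee]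
    simp only
    have hev : (fun ρ' : ℝ => S' (T b.1, cfun T ε b.1 * b.2.1 + X b.1, ρ')) =ᶠ[𝓝
        (b.2.2 * Real.exp (Θ b.1))] fun ρ' => hatL (deriv T b.1) (S (b.1, b.2.1, ρ' * E)) /
          ((|deriv T b.1| : ℝ) : ℂ) + sMap T X Θ Ψ ε ((b.1, b.2.1, 0), 0) := by
      filter_upwards [isOpen_Ioi.mem_nhds (mul_pos (hBI b hb).2 (Real.exp_pos (Θ b.1)))] with ρ' hρ
      have hpos : 0 < ρ' * E := mul_pos hρ (Real.exp_pos _)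
      have h5 : e (b.1, b.2.1, ρ' * E) = (T b.1, cfun T ε b.1 * b.2.1 + X b.1, ρ') := by
        rw [hee, hE]
        simp only
        rw [mul_assoc, ← Real.exp_add]
        simp
      have h6 : e.symm (T b.1, cfun T ε b.1 * b.2.1 + X b.1, ρ') = (b.1, b.2.1, ρ' * E) := by
        rw [← h5]
        exact e.left_inv (by rw [hes]; exact ⟨(hBI b hb).1, hpos⟩)
      rw [hS']
      simp only [h6, hatL_apply]
      exact sMap_eq _ _ _ _ _ _ _
    rw [(h4.congr_of_eventuallyEq hev).deriv]
    refine div_ne_zero ?_ (by exact_mod_cast (abs_pos.2 hP.2.1).ne')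
    rw [hatL_apply, Ne, hat_eq_zero]
    exact smul_ne_zero (Real.exp_pos _).ne' (hSρ b hb)
  · intro z hz
    have h1 : pol (baseMap T X Θ Ψ 0 ε z) = e (pol z) := by rw [pol_baseMap, hee]
    refine ⟨⟨pol z, hz, h1.symm⟩, ?_⟩
    simp only [hS', h1, hsymm _ hz]
    rfl

theorem mem_target_restr {φ : OpenPartialHomeomorph Base Base} {W : Set Base} (hW : IsOpen W)
    {y : Base} (hy : y ∈ (φ.restr W).target) : ∃ z ∈ φ.source ∩ W, φ z = y := by
  have h1 := (φ.restr W).map_target hy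
  rw [φ.restr_source' _ hW] at h1
  exact ⟨_, h1, (φ.restr W).right_inv hy⟩

/-- A transformation of the explicit form is locally admissible for each equation of the class. -/
theorem exists_local_admTransf {θ : ArbElt} (hθ : θ ∈ classS.elts)
    {φ : OpenPartialHomeomorph Base Base} (hφ : IsPointTransf φ) {z : Base} (hzθ : z ∈ θ.dom)
    {T X Θ Ψ : ℝ → ℝ} {ε : ℝ} (hp : ParamsAt T X Θ Ψ ε z.1)
    (hev : φ =ᶠ[𝓝 z] baseMap T X Θ Ψ 0 ε) {N : Set Base} (hN : N ∈ 𝓝 z) :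
    ∃ θ' ∈ classS.elts, ∃ W : Set Base, IsOpen W ∧ z ∈ W ∧ W ⊆ N ∧
      φ.restr W ∈ classS.admTransf θ θ' ∧
      ∀ z' ∈ W, θ'.val (φ z') = sMap T X Θ Ψ ε (z', θ.val z') := by
  obtain ⟨Ω, S, hΩ, -, hΩpos, hS, hSρ, hdom, hval⟩ := hθ
  obtain ⟨I, hI, hIc, hzI, hpI⟩ := hp.exists_interval
  have hzΩ : pol z ∈ Ω := by rw [hdom] at hzθ; exact hzθ
  -- Passing to a ball in the `(t, x, ρ)`-space keeps the domain of the new arbitrary element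
  -- connected and its times inside `I`.
  obtain ⟨r, hr, hB⟩ := Metric.isOpen_iff.1 (hΩ.inter (hI.preimage continuous_fst)) (pol z)
    ⟨hzΩ, hzI⟩
  have hball : IsConnected (Metric.ball (pol z) r) :=
    ⟨⟨_, Metric.mem_ball_self hr⟩, (convex_ball _ _).isPreconnected⟩
  obtain ⟨θ', hθ', h'⟩ := exists_transformed_elt hI hIc hpI Metric.isOpen_ball hball
    (fun y hy => ⟨(hB hy).2, hΩpos _ (hB hy).1⟩) (hS.mono fun y hy => (hB hy).1)
    (fun y hy => hSρ y (hB hy).1)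
  set W := pol ⁻¹' Metric.ball (pol z) r ∩ interior {z' | φ z' = baseMap T X Θ Ψ 0 ε z'} ∩
    interior N with hW
  have hWo : IsOpen W :=
    ((Metric.isOpen_ball.preimage continuous_pol).inter isOpen_interior).inter isOpen_interior
  have hWv : ∀ z' ∈ W, z' ∈ θ.dom ∧ φ z' ∈ θ'.dom ∧
      θ'.val (φ z') = sMap T X Θ Ψ ε (z', θ.val z') := by
    rintro z' ⟨⟨h1, h2⟩, -⟩
    have h3 : z' ∈ θ.dom := by rw [hdom]; exact (hB h1).1
    have h4 : φ z' = baseMap T X Θ Ψ 0 ε z' :=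
      interior_subset (s := {z' | φ z' = baseMap T X Θ Ψ 0 ε z'}) h2
    rw [hval z' h3, h4]
    exact ⟨h3, h' z' h1⟩
  refine ⟨θ', hθ', W, hWo, ⟨⟨Metric.mem_ball_self hr, mem_interior_iff_mem_nhds.2 hev⟩,
    mem_interior_iff_mem_nhds.2 hN⟩, fun z' h => interior_subset h.2, ?_, fun z' h => (hWv z' h).2.2⟩
  refine mem_admTransf_of_baseMap (hφ.restr W) ?_ ?_ ?_
  · rw [φ.restr_source' _ hWo]
    exact fun z' h => (hWv z' h.2).1
  · intro y hy
    obtain ⟨z', h1, rfl⟩ := mem_target_restr hWo hy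
    exact (hWv z' h1.2).2.1
  · rw [φ.restr_source' _ hWo]
    rintro z' ⟨-, h⟩
    refine ⟨T, X, Θ, Ψ, ε, hpI _ (hB h.1.1).2, ?_, (hWv z' h).2.2⟩
    exact mem_interior_iff_mem_nhds.1 h.1.2

theorem IsPointTransf.trans {E : Type} [NormedAddCommGroup E] [NormedSpace ℝ E]
    {φ χ : OpenPartialHomeomorph E E} (hφ : IsPointTransf φ) (hχ : IsPointTransf χ) :
    IsPointTransf (φ.trans χ) := by
  refine ⟨?_, ?_⟩
  · rw [φ.trans_source]
    exact hχ.1.comp (hφ.1.mono Set.inter_subset_left) fun z hz => hz.2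
  · rw [φ.trans_target]
    exact hφ.2.comp (hχ.2.mono Set.inter_subset_left) fun z hz => hz.2

theorem isOpen_dom {θ : ArbElt} (hθ : θ ∈ classS.elts) : IsOpen θ.dom := by
  obtain ⟨Ω, S, hΩ, -, -, -, -, hdom, -⟩ := hθ
  rw [hdom]
  exact hΩ.preimage continuous_pol

theorem u_ne_of_mem_dom {θ : ArbElt} (hθ : θ ∈ classS.elts) {z : Base} (hz : z ∈ θ.dom) :
    z.2.2 ≠ 0 := by
  obtain ⟨Ω, S, -, -, hpos, -, -, hdom, -⟩ := hθ
  rw [hdom] at hz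
  exact norm_ne_zero_iff.1 (hpos _ hz).ne'

theorem continuousAt_val {θ : ArbElt} (hθ : θ ∈ classS.elts) {z : Base} (hz : z ∈ θ.dom) :
    ContinuousAt θ.val z := by
  have ho := isOpen_dom hθ
  obtain ⟨Ω, S, hΩ, -, -, hS, -, hdom, hval⟩ := hθ
  have h1 : θ.val =ᶠ[𝓝 z] fun z => S (pol z) := by
    filter_upwards [ho.mem_nhds hz] with z' hz' using hval z' hz'
  rw [hdom] at hz
  exact (ContinuousAt.comp (g := S) (f := pol) (hS.continuousOn.continuousAt (hΩ.mem_nhds hz))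
    continuous_pol.continuousAt).congr h1.symm

theorem isConnected_halfSpace : IsConnected {y : ℝ × ℝ × ℝ | 0 < y.2.2} := by
  refine ⟨⟨(0, 0, 1), zero_lt_one (α := ℝ)⟩, Convex.isPreconnected ?_⟩
  have h : IsLinearMap ℝ fun y : ℝ × ℝ × ℝ => y.2.2 := ⟨fun _ _ => rfl, fun _ _ => rfl⟩
  exact convex_halfSpace_gt h 0

theorem isOpen_halfSpace : IsOpen {y : ℝ × ℝ × ℝ | 0 < y.2.2} :=
  isOpen_lt continuous_const (continuous_snd.comp continuous_snd)

/-- Arbitrary elements of the class that are defined for all `(t, x, ρ)`. -/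
theorem mem_elts_of_global {S : ℝ × ℝ × ℝ → ℂ} (hS : ∀ y : ℝ × ℝ × ℝ, 0 < y.2.2 → ContDiffAt ℝ ∞ S y)
    (hSρ : ∀ y : ℝ × ℝ × ℝ, 0 < y.2.2 → deriv (fun ρ : ℝ => S (y.1, y.2.1, ρ)) y.2.2 ≠ 0) :
    (⟨{z | z.2.2 ≠ 0}, fun z => S (pol z)⟩ : ArbElt) ∈ classS.elts := by
  refine ⟨{y | 0 < y.2.2}, S, isOpen_halfSpace, isConnected_halfSpace, fun _ h => h,
    fun y hy => (hS y hy).contDiffWithinAt, hSρ, ?_, fun _ _ => rfl⟩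
  ext z
  exact norm_pos_iff.symm

theorem hasDerivAt_ofReal (r : ℝ) : HasDerivAt (fun ρ : ℝ => (ρ : ℂ)) 1 r :=
  Complex.ofRealCLM.hasDerivAt

/-- The witness is `ρ` plus a constant. Since the graphs of arbitrary elements fill the space over
`ψ ≠ 0`, the defining condition of the equivalence group restricts `Φ` at every point of its domain.
-/
theorem exists_elt_through {z : Base} (hz : z.2.2 ≠ 0) (s : ℂ) :
    ∃ θ ∈ classS.elts, z ∈ θ.dom ∧ θ.val z = s := by
  refine ⟨_, mem_elts_of_global (S := fun y => (y.2.2 : ℂ) + (s - ‖z.2.2‖)) ?_ ?_, hz, ?_⟩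
  · exact fun y _ => (smooth_ofReal (contDiffAt_snd.comp y contDiffAt_snd)).add contDiffAt_const
  · intro y _
    rw [((hasDerivAt_ofReal y.2.2).add_const (s - ‖z.2.2‖)).deriv]
    exact one_ne_zero
  · simp [pol]

/-- Admissible transformations can be composed. -/
theorem trans_mem_admTransf {θ₀ θ₁ θ₂ : ArbElt} (h₀ : θ₀ ∈ classS.elts) (h₁ : θ₁ ∈ classS.elts)
    {φ χ : OpenPartialHomeomorph Base Base} (hφ : φ ∈ classS.admTransf θ₀ θ₁)
    (hχ : χ ∈ classS.admTransf θ₁ θ₂) : φ.trans χ ∈ classS.admTransf θ₀ θ₂ := by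
  refine ⟨hφ.1.trans hχ.1, ?_, ?_, fun j j'' hj => ?_⟩
  · rw [φ.trans_source]; exact fun z hz => hφ.2.1 hz.1
  · rw [φ.trans_target]; exact fun z hz => hχ.2.2.1 hz.1
  obtain ⟨f, h, p, r, hf, hh, rfl, rfl, hz, hpr, hev⟩ := hj
  rw [φ.trans_source] at hz
  change gr f p ∈ _ at hz
  -- A prolongation of the composition factors only if the intermediate image of the graph of `f` is
  -- itself a graph; the explicit form of `φ` guarantees this.
  obtain ⟨T, X, Θ, Ψ, ε, hp, hb⟩ := hasBaseForm_of_admTransf h₀ h₁ hφ hz.1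
  obtain ⟨g, hM, hmap⟩ := exists_maps_of_baseMap hf (hφ.1.contDiffAt hz.1) hp hb
  have h1 := hM.prolongs hz.1
  have h2 := hM.eventually_eq.self_of_nhds
  have h3 : Prolongs χ (jet g (prj (φ (gr f p)))) (jet h r) := by
    refine ⟨g, h, _, r, hM.smooth_right, hh, rfl, rfl, ?_, ?_, ?_⟩
    · change gr g _ ∈ _
      rw [← h2]; exact hz.2
    · change χ (gr g _) = _
      rw [← h2]; exact hpr
    · rw [← hmap, Filter.eventually_map]
      filter_upwards [hev, hM.eventually_eq] with p' e1 e2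
      change ∃ q', χ (gr g _) = _
      rw [← e2]; exact e1
  exact (hφ.2.2.2 _ _ h1).trans (hχ.2.2.2 _ _ h3)

/-- The transformations of the explicit form can be composed. -/
theorem HasBaseForm.trans {φ χ : OpenPartialHomeomorph Base Base} (hφ : IsPointTransf φ)
    (hχ : IsPointTransf χ) {z : Base} (hz : z ∈ (φ.trans χ).source) (hu : z.2.2 ≠ 0)
    (h1 : HasBaseForm φ z) (h2 : HasBaseForm χ (φ z)) : HasBaseForm (φ.trans χ) z := by
  rw [φ.trans_source] at hz
  -- No parameters are composed by hand. Applied to a test equation, both germs are admissible,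
  -- hence so is their composition, and the classification yields its form.
  obtain ⟨θ₀, h₀, hz₀, -⟩ := exists_elt_through hu 0
  obtain ⟨T, X, Θ, Ψ, ε, hp, hev⟩ := h1
  obtain ⟨T', X', Θ', Ψ', ε', hp', hev'⟩ := h2
  obtain ⟨θ₁, h₁, W₁, hW₁, hzW₁, -, hm₁, -⟩ :=
    exists_local_admTransf h₀ hφ hz₀ hp hev Filter.univ_mem
  have hs₁ : z ∈ (φ.restr W₁).source := by rw [φ.restr_source' _ hW₁]; exact ⟨hz.1, hzW₁⟩
  have hz₁ : φ z ∈ θ₁.dom := hm₁.2.2.1 ((φ.restr W₁).map_source hs₁)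
  obtain ⟨θ₂, h₂, W₂, hW₂, hzW₂, -, hm₂, -⟩ :=
    exists_local_admTransf h₁ hχ hz₁ hp' hev' Filter.univ_mem
  refine hasBaseForm_of_admTransf h₀ h₂ (trans_mem_admTransf h₀ h₁ hm₁ hm₂) (z₀ := z) ?_
  rw [OpenPartialHomeomorph.trans_source]
  refine ⟨hs₁, ?_⟩
  change φ z ∈ (χ.restr W₂).source
  rw [χ.restr_source' _ hW₂]
  exact ⟨hz.2, hzW₂⟩

/-- The arbitrary element at the image point is forced by the germ of `φ`; this is why the
equivalence group has no freedom beyond its projection. -/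
theorem val_eq_sMap_of_mem_admTransf {θ θ' : ArbElt} {φ : OpenPartialHomeomorph Base Base}
    (h : φ ∈ classS.admTransf θ θ') {z : Base} (hz : z ∈ φ.source) (hu : z.2.2 ≠ 0)
    {T X Θ Ψ : ℝ → ℝ} {ε : ℝ} (hp : ParamsAt T X Θ Ψ ε z.1)
    (hev : φ =ᶠ[𝓝 z] baseMap T X Θ Ψ 0 ε) : θ'.val (φ z) = sMap T X Θ Ψ ε (z, θ.val z) := by
  have h1 := (admAt_of_mem_admTransf h hz).eq_sMap h.1 hz hu hp hev
  rw [mul_div_cancel_right₀ _ hu] at h1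
  refine mul_right_cancel₀ ?_ h1
  rw [hev.self_of_nhds]
  exact baseMap_u_ne hu

/-! ### Determination of the equivalence group. -/

/-- The explicit transformations belong to the equivalence group. -/
theorem mem_equivGroup_of_form {Φ : OpenPartialHomeomorph Ext Ext}
    {φ : OpenPartialHomeomorph Base Base} (hΦ : IsPointTransf Φ) (hpr : ProjectsTo Φ φ)
    (hne : ∀ w ∈ Φ.source, w.1.2.2 ≠ 0) (hform : HasEquivForm Φ) : Φ ∈ classS.equivGroup := by
  refine ⟨hΦ, hne, φ, hpr, fun θ hθ z hz hw => ?_⟩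
  obtain ⟨T, X, Θ, Ψ, ε, hp, hev⟩ := hform _ hw
  have hc : Filter.Tendsto (fun z' => (z', θ.val z')) (𝓝 z) (𝓝 (z, θ.val z)) :=
    continuousAt_id.prodMk (continuousAt_val hθ hz)
  have hN : ∀ᶠ z' in 𝓝 z, (z', θ.val z') ∈ Φ.source ∧
      Φ (z', θ.val z') = equivMap T X Θ Ψ ε (z', θ.val z') :=
    (hc.eventually (Φ.open_source.mem_nhds hw)).and (hc.eventually hev)
  have hφev : φ =ᶠ[𝓝 z] baseMap T X Θ Ψ 0 ε := by
    filter_upwards [hN] with z' h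
    rw [← hpr.2.2 _ h.1, h.2]; rfl
  obtain ⟨θ', hθ', W, hW, hzW, hWN, hm, hv⟩ :=
    exists_local_admTransf hθ hpr.1 hz hp hφev hN
  refine ⟨θ', hθ', W, hW, hzW, hm, fun z' h => ⟨(hWN h).1, ?_⟩⟩
  rw [hv z' h, (hWN h).2]; rfl

/-- The elements of the equivalence group have the explicit form. -/
theorem hasEquivForm_of_mem_equivGroup {Φ : OpenPartialHomeomorph Ext Ext}
    (h : Φ ∈ classS.equivGroup) : HasEquivForm Φ := by
  obtain ⟨hΦ, hne, φ, hpr, hall⟩ := h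
  have hsrc : ∀ w ∈ Φ.source, w.1 ∈ φ.source := fun w hw => by rw [hpr.2.1]; exact ⟨w, hw, rfl⟩
  rintro ⟨z, s⟩ hw
  obtain ⟨θ, hθ, hzθ, hs⟩ := exists_elt_through (hne _ hw) s
  obtain ⟨θ', hθ', W, hW, hzW, hm, -⟩ := hall θ hθ z hzθ (by rw [hs]; exact hw)
  obtain ⟨T, X, Θ, Ψ, ε, hp, hev⟩ := hasBaseForm_of_admTransf hθ hθ' hm (z₀ := z)
    (by rw [φ.restr_source' _ hW]; exact ⟨hsrc _ hw, hzW⟩)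
  refine ⟨T, X, Θ, Ψ, ε, hp, ?_⟩
  have h1 : ∀ᶠ w' in 𝓝 (z, s), φ =ᶠ[𝓝 w'.1] baseMap T X Θ Ψ 0 ε :=
    (continuous_fst.tendsto (z, s)).eventually (Filter.EventuallyEq.eventuallyEq_nhds hev)
  have h2 : ∀ᶠ w' in 𝓝 (z, s), ParamsAt T X Θ Ψ ε w'.1.1 :=
    ((continuous_fst.comp continuous_fst).tendsto (z, s)).eventually hp.eventually
  filter_upwards [h1, h2, Φ.open_source.mem_nhds hw] with w' e1 e2 hw'
  obtain ⟨z', s'⟩ := w'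
  -- The parameters were fixed by one test equation through the base point; at each nearby point
  -- another test equation, with the value `s'`, identifies the last component for these same
  -- parameters.
  obtain ⟨θ, hθ, hzθ, hs⟩ := exists_elt_through (hne _ hw') s'
  obtain ⟨θ', hθ', W, hW, hzW, hm, hv⟩ := hall θ hθ z' hzθ (by rw [hs]; exact hw')
  have h3 := val_eq_sMap_of_mem_admTransf hm
    (by rw [φ.restr_source' _ hW]; exact ⟨hsrc _ hw', hzW⟩) (hne _ hw') e2 e1
  have h4 := (hv z' hzW).2
  rw [hs] at h3 h4
  refine Prod.ext ((hpr.2.2 _ hw').trans e1.self_of_nhds) ?_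
  exact h4.symm.trans h3

theorem deriv_eq_of_baseMap {φ : Base → Base} {z : Base} {T X Θ Ψ T' X' Θ' Ψ' : ℝ → ℝ} {ε ε' : ℝ}
    (hev : φ =ᶠ[𝓝 z] baseMap T X Θ Ψ 0 ε) (hev' : φ =ᶠ[𝓝 z] baseMap T' X' Θ' Ψ' 0 ε') :
    deriv T z.1 = deriv T' z.1 := by
  have hc : Continuous fun t : ℝ => ((t, z.2) : Base) := by fun_prop
  refine Filter.EventuallyEq.deriv_eq ?_
  filter_upwards [hc.continuousAt.eventually (hev.symm.trans hev')] with t ht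
  exact congrArg Prod.fst ht

/-- A transformation of the explicit form lifts to an element of the equivalence group. -/
theorem exists_lift {φ : OpenPartialHomeomorph Base Base} (hφ : IsPointTransf φ)
    (hne : ∀ z ∈ φ.source, z.2.2 ≠ 0) (hform : ∀ z ∈ φ.source, HasBaseForm φ z) :
    ∃ Φ ∈ classS.equivGroup, ProjectsTo Φ φ ∧ Φ.source = {w | w.1 ∈ φ.source} ∧
      ∀ w ∈ Φ.source, ∀ T X Θ Ψ ε, ParamsAt T X Θ Ψ ε w.1.1 →
        φ =ᶠ[𝓝 w.1] baseMap T X Θ Ψ 0 ε → Φ w = equivMap T X Θ Ψ ε w := by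
  -- The parameters are chosen independently at each point and need not fit together. The quantities
  -- `D` and `R` built from them depend only on the germ of `φ` (`hloc`), so near each point they
  -- agree with the smooth expressions of a single choice.
  choose! T X Θ Ψ ε hp hev using hform
  set D : Base → ℝ := fun z => deriv (T z) z.1 with hD
  set R : Base → ℂ := fun z => sMap (T z) (X z) (Θ z) (Ψ z) (ε z) (z, 0) with hR
  have hD0 : ∀ z ∈ φ.source, ((|D z| : ℝ) : ℂ) ≠ 0 := fun z hz => by
    exact_mod_cast (abs_pos.2 (hp z hz).2.1).ne'
  have hloc : ∀ z ∈ φ.source, ∀ T' X' Θ' Ψ' ε', ParamsAt T' X' Θ' Ψ' ε' z.1 →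
      φ =ᶠ[𝓝 z] baseMap T' X' Θ' Ψ' 0 ε' →
        D z = deriv T' z.1 ∧ R z = sMap T' X' Θ' Ψ' ε' (z, 0) := fun z hz T' X' Θ' Ψ' ε' h1 h2 =>
    ⟨deriv_eq_of_baseMap (hev z hz) h2, sMap_unique hφ hz (hne z hz) (hp z hz) (hev z hz) h1 h2 0⟩
  have hnear : ∀ z ∈ φ.source, ∀ᶠ z' in 𝓝 z, D z' = deriv (T z) z'.1 ∧
      R z' = sMap (T z) (X z) (Θ z) (Ψ z) (ε z) (z', 0) := by
    intro z hz
    have h1 := (continuous_fst.tendsto z).eventually (hp z hz).eventually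
    filter_upwards [φ.open_source.mem_nhds hz, h1,
      Filter.EventuallyEq.eventuallyEq_nhds (hev z hz)] with z' a1 a2 a3
    exact hloc z' a1 _ _ _ _ _ a2 a3
  have hDs : ∀ z ∈ φ.source, ContDiffAt ℝ ∞ D z ∧ ContDiffAt ℝ ∞ (fun z => |D z|) z ∧
      ContDiffAt ℝ ∞ R z ∧ ∀ᶠ z' in 𝓝 z, (0 < D z' ↔ 0 < D z) := by
    intro z hz
    have hP := hp z hz
    have h1 : ContDiffAt ℝ ∞ D z := (smooth_fst (smooth_deriv hP.smooth_T)).congr_of_eventuallyEq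
      ((hnear z hz).mono fun _ h => h.1)
    have h0 : D z ≠ 0 := hP.2.1
    refine ⟨h1, (contDiffAt_abs h0).comp z h1, ?_, ?_⟩
    · exact (smooth_sMap (z := fun z : Base => z) (s := fun _ => 0) hP contDiffAt_id
        contDiffAt_const).congr_of_eventuallyEq ((hnear z hz).mono fun _ h => h.2)
    · have h2 : ∀ᶠ d in 𝓝 (D z), (0 < d ↔ 0 < D z) :=
        (sign_eventually continuousAt_id h0).mono fun _ h => h.1
      exact h1.continuousAt.eventually h2
  have hsymm : ∀ y ∈ φ.target, φ.symm y ∈ φ.source := fun y hy => φ.map_target hy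
  -- The lift is real-affine and invertible in `S` over each point, so it is defined over the whole
  -- source of `φ` with all values of `S`.
  obtain ⟨Φ, hΦ, hs, -, hf, -⟩ := exists_pointTransf (E := Ext)
    (f := fun w => (φ w.1, hat (D w.1) w.2 / (|D w.1| : ℝ) + R w.1))
    (g := fun w => (φ.symm w.1, hat (D (φ.symm w.1))
      ((|D (φ.symm w.1)| : ℝ) * (w.2 - R (φ.symm w.1)))))
    (U := {w | w.1 ∈ φ.source}) (V := {w | w.1 ∈ φ.target})
    (φ.open_source.preimage continuous_fst) (φ.open_target.preimage continuous_fst)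
    (fun w hw => φ.map_source hw) (fun w hw => φ.map_target hw)
    (fun w hw => by
      have h0 := hD0 _ hw
      have h1 : φ.symm (φ w.1) = w.1 := φ.left_inv hw
      simp only [h1, add_sub_cancel_right, mul_div_cancel₀ _ h0, hat_hat])
    (fun w hw => by
      have h0 := hD0 _ (hsymm _ hw)
      have h1 : φ (φ.symm w.1) = w.1 := φ.right_inv hw
      simp only [h1, hat_hat, mul_div_cancel_left₀ _ h0, sub_add_cancel])
    (fun w hw => by
      obtain ⟨-, h2, h3, h4⟩ := hDs _ hw
      refine ((hφ.contDiffAt hw).comp w contDiffAt_fst).prodMk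
        (ContDiffAt.add (smooth_div (smooth_hat ?_ contDiffAt_snd) ?_ (hD0 _ hw)) ?_)
      · exact (continuous_fst.tendsto w).eventually h4
      · exact smooth_ofReal (ContDiffAt.comp w (f := Prod.fst) h2 contDiffAt_fst)
      · exact ContDiffAt.comp w (f := Prod.fst) h3 contDiffAt_fst)
    (fun w hw => by
      obtain ⟨-, h2, h3, h4⟩ := hDs _ (hsymm _ hw)
      have h5 : ContDiffAt ℝ ∞ (fun w : Ext => φ.symm w.1) w :=
        (hφ.2.contDiffAt (φ.open_target.mem_nhds hw)).comp w contDiffAt_fst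
      refine h5.prodMk (smooth_hat ?_ (ContDiffAt.mul ?_ (ContDiffAt.sub contDiffAt_snd ?_)))
      · exact h5.continuousAt.eventually h4
      · exact smooth_ofReal (ContDiffAt.comp w (f := fun w : Ext => φ.symm w.1) h2 h5)
      · exact ContDiffAt.comp w (f := fun w : Ext => φ.symm w.1) h3 h5)
  have hpr : ProjectsTo Φ φ := by
    refine ⟨hφ, ?_, fun w _ => by rw [hf]⟩
    rw [hs]
    ext z
    exact ⟨fun h => ⟨(z, 0), h, rfl⟩, by rintro ⟨w, h, rfl⟩; exact h⟩
  have heq : ∀ w ∈ Φ.source, ∀ T X Θ Ψ ε, ParamsAt T X Θ Ψ ε w.1.1 →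
      φ =ᶠ[𝓝 w.1] baseMap T X Θ Ψ 0 ε → Φ w = equivMap T X Θ Ψ ε w := by
    rw [hs]
    intro w hw T' X' Θ' Ψ' ε' h1 h2
    obtain ⟨e1, e2⟩ := hloc w.1 hw _ _ _ _ _ h1 h2
    rw [hf, e1, e2, h2.self_of_nhds, ← sMap_eq]
    rfl
  refine ⟨Φ, mem_equivGroup_of_form hΦ hpr (by rw [hs]; exact fun w hw => hne _ hw) ?_, hpr, hs, heq⟩
  intro w hw
  have hw' : w.1 ∈ φ.source := by rw [hs] at hw; exact hw
  refine ⟨_, _, _, _, _, hp _ hw', ?_⟩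
  filter_upwards [Φ.open_source.mem_nhds hw, (continuous_fst.tendsto w).eventually
    (Filter.EventuallyEq.eventuallyEq_nhds (hev _ hw')),
    ((continuous_fst.comp continuous_fst).tendsto w).eventually (hp _ hw').eventually]
    with w' a1 a2 a3 using heq w' a1 _ _ _ _ _ a3 a2

theorem normalized_classS : classS.Normalized := by
  intro θ hθ θ' hθ' φ h
  have hu : ∀ z ∈ φ.source, z.2.2 ≠ 0 := fun z hz => u_ne_of_mem_dom hθ (h.2.1 hz)
  obtain ⟨Φ, hΦ, hpr, hs, heq⟩ := exists_lift h.1 hu fun z hz => hasBaseForm_of_admTransf hθ hθ' h hz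
  refine ⟨Φ, hΦ, hpr, fun z hz => ?_⟩
  have hw : (z, θ.val z) ∈ Φ.source := by rw [hs]; exact hz
  obtain ⟨T, X, Θ, Ψ, ε, hp, hev⟩ := hasBaseForm_of_admTransf hθ hθ' h hz
  refine ⟨hw, ?_⟩
  rw [heq _ hw _ _ _ _ _ hp hev, val_eq_sMap_of_mem_admTransf h hz (hu z hz) hp hev]
  rfl

theorem mem_equivGroup_iff (Φ : OpenPartialHomeomorph Ext Ext) :
    Φ ∈ classS.equivGroup ↔ IsPointTransf Φ ∧ (∃ φ, ProjectsTo Φ φ) ∧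
      (∀ w ∈ Φ.source, w.1.2.2 ≠ 0) ∧ HasEquivForm Φ := by
  constructor
  · intro h
    have h' := h
    obtain ⟨h1, h2, φ, h3, -⟩ := h'
    exact ⟨h1, ⟨φ, h3⟩, h2, hasEquivForm_of_mem_equivGroup h⟩
  · rintro ⟨h1, ⟨φ, h2⟩, h3, h4⟩
    exact mem_equivGroup_of_form h1 h2 h3 h4

theorem exists_mem_equivGroup (I : Set ℝ) (T X Θ Ψ : ℝ → ℝ) (ε : ℝ) (hI : IsOpen I)
    (hc : I.OrdConnected) (hp : ∀ t ∈ I, ParamsAt T X Θ Ψ ε t) :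
    ∃ Φ ∈ classS.equivGroup, Φ.source = {w | w.1.1 ∈ I ∧ w.1.2.2 ≠ 0} ∧
      ∀ w ∈ Φ.source, Φ w = equivMap T X Θ Ψ ε w := by
  obtain ⟨φ, hφ, hs, hv⟩ := exists_baseMap_pointTransf hI hc hp
  have hev : ∀ z, φ =ᶠ[𝓝 z] baseMap T X Θ Ψ 0 ε := fun z => Filter.Eventually.of_forall hv
  obtain ⟨Φ, hΦ, -, hs', heq⟩ := exists_lift hφ (by rw [hs]; exact fun z hz => hz.2)
    (by rw [hs]; exact fun z hz => ⟨T, X, Θ, Ψ, ε, hp _ hz.1, hev z⟩)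
  have hsrc : Φ.source = {w | w.1.1 ∈ I ∧ w.1.2.2 ≠ 0} := by rw [hs', hs]; rfl
  exact ⟨Φ, hΦ, hsrc, fun w hw => heq w hw _ _ _ _ _ (hp _ (by rw [hsrc] at hw; exact hw.1)) (hev _)⟩

/-! ### Products of symmetries and strong normalization. -/

theorem paramsAt_shift (c t : ℝ) :
    ParamsAt (fun t => t + c) (fun _ => 0) (fun _ => 0) (fun _ => 0) 1 t := by
  refine ⟨Filter.Eventually.of_forall fun s => ⟨?_, contDiffAt_const, contDiffAt_const,
    contDiffAt_const⟩, ?_, Or.inl rfl⟩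
  · exact contDiffAt_id.add contDiffAt_const
  · simp

theorem baseMap_shift (c : ℝ) (z : Base) :
    baseMap (fun t => t + c) (fun _ => 0) (fun _ => 0) (fun _ => 0) 0 1 z =
      (z.1 + c, z.2.1, z.2.2) := by
  rw [baseMap_eq]
  simp [cfun, efac, afun, bfun, hat]

theorem sMap_shift (c : ℝ) (z : Base) (s : ℂ) :
    sMap (fun t => t + c) (fun _ => 0) (fun _ => 0) (fun _ => 0) 1 (z, s) = s := by
  simp [sMap, iteratedDeriv_two', iteratedDeriv_three', hat]

theorem hasBaseForm_refl (z : Base) : HasBaseForm (OpenPartialHomeomorph.refl Base) z :=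
  ⟨_, _, _, _, _, paramsAt_shift 0 z.1, Filter.Eventually.of_forall fun z' => by
    rw [baseMap_shift]; simp⟩

theorem isPointTransf_refl : IsPointTransf (OpenPartialHomeomorph.refl Base) :=
  ⟨contDiff_id.contDiffOn, contDiff_id.contDiffOn⟩

/-- Time shifts are symmetries of the equation with `S = ρ`. -/
theorem exists_shift (c : ℝ) : ∃ σ : OpenPartialHomeomorph Base Base,
    σ.source = {z | z.2.2 ≠ 0} ∧ (∀ z, σ z = (z.1 + c, z.2.1, z.2.2)) ∧
      ∃ θ ∈ classS.elts, σ ∈ classS.admTransf θ θ := by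
  obtain ⟨σ, hσ, hs, hv⟩ := exists_baseMap_pointTransf isOpen_univ Set.ordConnected_univ
    (fun t _ => paramsAt_shift c t)
  have hs' : σ.source = {z | z.2.2 ≠ 0} := by rw [hs]; simp
  simp only [baseMap_shift] at hv
  refine ⟨σ, hs', hv, _, mem_elts_of_global (S := fun y => (y.2.2 : ℂ))
    (fun y _ => smooth_ofReal (contDiffAt_snd.comp y contDiffAt_snd)) (fun y _ => by
      rw [(hasDerivAt_ofReal y.2.2).deriv]; exact one_ne_zero), ?_⟩
  refine mem_admTransf_of_baseMap hσ hs'.subset ?_ ?_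
  · intro y hy
    obtain ⟨z, hz, rfl⟩ : ∃ z ∈ σ.source, σ z = y := ⟨_, σ.map_target hy, σ.right_inv hy⟩
    rw [hs'] at hz
    rw [hv]; exact hz
  · intro z _
    refine ⟨_, _, _, _, _, paramsAt_shift c z.1, Filter.Eventually.of_forall fun z' => ?_, ?_⟩
    · rw [baseMap_shift, hv]
    · rw [sMap_shift]; simp [hv, pol]

theorem hasBaseForm_foldr (l : List (OpenPartialHomeomorph Base Base))
    (hl : ∀ e ∈ l, ∃ θ ∈ classS.elts, e ∈ classS.admTransf θ θ) :
    IsPointTransf (l.foldr (fun e e' => e.trans e') (OpenPartialHomeomorph.refl Base)) ∧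
      ∀ z ∈ (l.foldr (fun e e' => e.trans e') (OpenPartialHomeomorph.refl Base)).source,
        HasBaseForm (l.foldr (fun e e' => e.trans e') (OpenPartialHomeomorph.refl Base) :
          OpenPartialHomeomorph Base Base) z := by
  induction l with
  | nil => exact ⟨isPointTransf_refl, fun z _ => hasBaseForm_refl z⟩
  | cons e l ih =>
    obtain ⟨h1, h2⟩ := ih fun e he => hl e (List.mem_cons_of_mem _ he)
    obtain ⟨θ, hθ, he⟩ := hl e List.mem_cons_self
    simp only [List.foldr_cons]
    refine ⟨he.1.trans h1, fun z hz => ?_⟩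
    have hz' := hz
    rw [OpenPartialHomeomorph.trans_source] at hz'
    exact HasBaseForm.trans he.1 h1 hz (u_ne_of_mem_dom hθ (he.2.1 hz'.1))
      (hasBaseForm_of_admTransf hθ hθ he hz'.1) (h2 _ hz'.2)

theorem symProduct_subset : classS.symProduct ⊆ classS.equivGroupProj := by
  rintro φ ⟨hφ, hall⟩
  obtain ⟨Φ, hΦ, hpr, -⟩ := exists_lift hφ (fun z hz => by
      obtain ⟨l, hl0, hl, hzl, -⟩ := hall z hz
      obtain _ | ⟨e, l⟩ := l
      · exact absurd rfl hl0
      · obtain ⟨θ, hθ, he⟩ := hl e List.mem_cons_self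
        rw [List.foldr_cons, OpenPartialHomeomorph.trans_source] at hzl
        exact u_ne_of_mem_dom hθ (he.2.1 hzl.1)) (fun z hz => by
      obtain ⟨l, -, hl, hzl, hev⟩ := hall z hz
      obtain ⟨T, X, Θ, Ψ, ε, hp, hb⟩ := (hasBaseForm_foldr l hl).2 z hzl
      exact ⟨T, X, Θ, Ψ, ε, hp, Filter.EventuallyEq.trans hev hb⟩)
  exact ⟨Φ, hΦ, hpr⟩

theorem hasBaseForm_of_mem_equivGroupProj {φ : OpenPartialHomeomorph Base Base}
    (h : φ ∈ classS.equivGroupProj) {z : Base} (hz : z ∈ φ.source) :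
    z.2.2 ≠ 0 ∧ HasBaseForm φ z := by
  obtain ⟨Φ, hΦ, hpr⟩ := h
  rw [hpr.2.1] at hz
  obtain ⟨⟨z, s⟩, hw, rfl⟩ := hz
  obtain ⟨T, X, Θ, Ψ, ε, hp, hev⟩ := hasEquivForm_of_mem_equivGroup hΦ _ hw
  refine ⟨hΦ.2.1 _ hw, T, X, Θ, Ψ, ε, hp, ?_⟩
  have hc : Filter.Tendsto (fun z' : Base => ((z', s) : Ext)) (𝓝 z) (𝓝 (z, s)) :=
    Filter.tendsto_id.prodMk_nhds tendsto_const_nhds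
  filter_upwards [hc.eventually (Φ.open_source.mem_nhds hw), hc.eventually hev] with z' h1 h2
  rw [← hpr.2.2 _ h1, h2]; rfl

theorem deriv_add_shift (T : ℝ → ℝ) (c : ℝ) : (deriv fun t => T t + c) = deriv T := by
  funext t; simp

theorem ParamsAt.add_shift {T X Θ Ψ : ℝ → ℝ} {ε t : ℝ} (h : ParamsAt T X Θ Ψ ε t) (c : ℝ) :
    ParamsAt (fun t => T t + c) X Θ Ψ ε t := by
  refine ⟨?_, by rw [deriv_add_shift]; exact h.2.1, h.2.2⟩
  filter_upwards [h.1] with s hs using ⟨hs.1.add contDiffAt_const, hs.2⟩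

theorem baseMap_add_shift (T X Θ Ψ : ℝ → ℝ) (ε c : ℝ) (z : Base) :
    baseMap (fun t => T t + c) X Θ Ψ 0 ε z = ((baseMap T X Θ Ψ 0 ε z).1 + c,
      (baseMap T X Θ Ψ 0 ε z).2.1, (baseMap T X Θ Ψ 0 ε z).2.2) := by
  rw [baseMap_eq, baseMap_eq]
  simp only [cfun, efac, afun, bfun, deriv_add_shift]

/-- A transformation of the explicit form that displaces the time is locally a symmetry of an equation
of the class. -/
theorem exists_symmetry {φ : OpenPartialHomeomorph Base Base} (hφ : IsPointTransf φ) {z : Base}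
    (hu : z.2.2 ≠ 0) {T X Θ Ψ : ℝ → ℝ} {ε : ℝ} (hp : ParamsAt T X Θ Ψ ε z.1)
    (hev : φ =ᶠ[𝓝 z] baseMap T X Θ Ψ 0 ε) (hT : T z.1 = z.1 + 1) :
    ∃ θ ∈ classS.elts, ∃ W : Set Base, IsOpen W ∧ z ∈ W ∧ φ.restr W ∈ classS.admTransf θ θ := by
  obtain ⟨I, hI, hIc, hzI, hpI⟩ := hp.exists_interval
  obtain ⟨g, hTI, hg, hgs⟩ := exists_inverse hI hIc (fun t ht => (hpI t ht).smooth_T)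
    (fun t ht => (hpI t ht).2.1)
  have hgI : ∀ s ∈ T '' I, g s ∈ I := by
    rintro _ ⟨t, ht, rfl⟩; rw [hg t ht]; exact ht
  -- The radius `1 / 2` separates the times near `z.1`, where the cutoff vanishes, from those near
  -- `z.1 + 1`, where the transformed function is prescribed; `g` is defined with control only on `T
  -- '' I`.
  obtain ⟨r, hr, hball⟩ := Metric.isOpen_iff.1 (hTI.inter (Metric.isOpen_ball (x := z.1 + 1)
    (ε := 1 / 2))) (z.1 + 1) ⟨⟨z.1, hzI, hT⟩, Metric.mem_ball_self (by norm_num)⟩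
  let χ : ContDiffBump (z.1 + 1) := ⟨r / 4, r / 2, by positivity, by linarith⟩
  have hχ0 : ∀ t, t ∉ T '' I ∩ Metric.ball (z.1 + 1) (1 / 2) → ∀ᶠ s in 𝓝 t, χ s = 0 := by
    intro t ht
    have h1 : t ∈ (Metric.closedBall (z.1 + 1) (r / 2))ᶜ := fun h =>
      ht (hball (Metric.closedBall_subset_ball (by linarith) h))
    filter_upwards [Metric.isClosed_closedBall.isOpen_compl.mem_nhds h1] with s hs
    refine χ.zero_of_le_dist ?_
    exact (not_le.1 (show ¬ dist s (z.1 + 1) ≤ r / 2 from hs)).le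
  set E : ℝ → ℝ := fun t => Real.exp (-Θ (g t)) / |deriv T (g t)| with hE
  set Q : ℝ × ℝ × ℝ → ℂ := fun y =>
    sMap T X Θ Ψ ε ((g y.1, (y.2.1 - X (g y.1)) / cfun T ε (g y.1), 0), 0) with hQ
  -- Where `χ = 0` this is `ρ`, and where `χ = 1` it is the transform of `ρ`. Being linear in `ρ`
  -- with a positive coefficient in both cases keeps `S_ρ`, a convex combination of `1` and `E > 0`,
  -- away from zero in between.
  set S : ℝ × ℝ × ℝ → ℂ := fun y =>
    (((1 - χ y.1) + χ y.1 * E y.1 : ℝ) : ℂ) * (y.2.2 : ℂ) + (χ y.1 : ℂ) * Q y with hS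
  have hsnd : ∀ y : ℝ × ℝ × ℝ, ContDiffAt ℝ ∞ (fun y : ℝ × ℝ × ℝ => (y.2.2 : ℂ)) y := fun y =>
    smooth_ofReal (contDiffAt_snd.comp y contDiffAt_snd)
  have helt := mem_elts_of_global (S := S) (fun y _ => by
      by_cases hy : y.1 ∈ T '' I
      · have hP := hpI _ (hgI _ hy)
        have a0 : ContDiffAt ℝ ∞ (fun y : ℝ × ℝ × ℝ => χ y.1) y := smooth_fst χ.contDiffAt
        have a1 : ContDiffAt ℝ ∞ (fun y : ℝ × ℝ × ℝ => g y.1) y := smooth_fst (hgs _ hy)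
        have hc : ∀ {f : ℝ → ℝ}, ContDiffAt ℝ ∞ f (g y.1) →
            ContDiffAt ℝ ∞ (fun y : ℝ × ℝ × ℝ => f (g y.1)) y :=
          fun hf => ContDiffAt.comp y (f := fun y : ℝ × ℝ × ℝ => g y.1) hf a1
        have a2 : ContDiffAt ℝ ∞ (fun y : ℝ × ℝ × ℝ => E y.1) y :=
          (hc hP.smooth_Θ).neg.exp.div (hc hP.smooth_abs) (abs_pos.2 hP.2.1).ne'
        have a3 : ContDiffAt ℝ ∞ Q y := by
          refine smooth_sMap hP (a1.prodMk (ContDiffAt.prodMk ?_ contDiffAt_const)) contDiffAt_const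
          exact ((contDiffAt_fst.comp y contDiffAt_snd).sub (hc hP.smooth_X)).div
            (hc hP.smooth_cfun) hP.cfun_ne
        exact ((smooth_ofReal ((contDiffAt_const.sub a0).add (a0.mul a2))).mul (hsnd y)).add
          ((smooth_ofReal a0).mul a3)
      -- Outside `T '' I` nothing is known about `E` and `Q`, but the cutoff vanishes in a
      -- neighbourhood.
      · refine (hsnd y).congr_of_eventuallyEq ?_
        filter_upwards [(continuous_fst.tendsto y).eventually (hχ0 y.1 fun h => hy h.1)] with y' h
        simp [hS, h])
    (fun y _ => by
      have h1 := ((hasDerivAt_ofReal y.2.2).const_mul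
        (((1 - χ y.1) + χ y.1 * E y.1 : ℝ) : ℂ)).add_const ((χ y.1 : ℂ) * Q y)
      have h2 : HasDerivAt (fun ρ : ℝ => S (y.1, y.2.1, ρ)) _ y.2.2 := h1
      rw [h2.deriv, mul_one]
      have h3 : (1 - χ y.1) + χ y.1 * E y.1 ≠ 0 := by
        by_cases hy : y.1 ∈ T '' I
        · have hP := hpI _ (hgI _ hy)
          have hE0 : 0 < E y.1 := div_pos (Real.exp_pos _) (abs_pos.2 hP.2.1)
          have b1 := χ.nonneg (x := y.1)
          have b2 := χ.le_one (x := y.1)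
          rcases b2.lt_or_eq with b2 | b2
          · have := mul_nonneg b1 hE0.le
            exact (by linarith : 0 < (1 - χ y.1) + χ y.1 * E y.1).ne'
          · rw [b2]; simpa using hE0.ne'
        · have := (hχ0 y.1 fun h => hy h.1).self_of_nhds
          rw [this]; simp
      exact_mod_cast h3)
  have hTc : ContinuousAt T z.1 := hp.smooth_T.continuousAt
  have hN : ∀ᶠ z' in 𝓝 z, φ =ᶠ[𝓝 z'] baseMap T X Θ Ψ 0 ε ∧ z'.2.2 ≠ 0 ∧ z'.1 ∈ I ∧
      dist z'.1 z.1 < 1 / 2 ∧ dist (T z'.1) (z.1 + 1) < r / 4 := by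
    have c1 : ContinuousAt (fun z' : Base => T z'.1) z := ContinuousAt.comp (f := Prod.fst) hTc
      continuous_fst.continuousAt
    refine (Filter.EventuallyEq.eventuallyEq_nhds hev).and (Filter.Eventually.and ?_
      (Filter.Eventually.and ?_ (Filter.Eventually.and ?_ ?_)))
    · exact (continuous_snd.comp continuous_snd).continuousAt.eventually_ne hu
    · exact (continuous_fst.tendsto z).eventually (hI.mem_nhds hzI)
    · exact (continuous_fst.tendsto z).eventually (Metric.ball_mem_nhds _ (by norm_num))
    · refine c1.eventually (p := fun s => dist s (z.1 + 1) < r / 4) ?_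
      simp only [hT]
      exact Metric.ball_mem_nhds _ (by positivity)
  obtain ⟨W, hW, hWo, hzW⟩ := eventually_nhds_iff.1 hN
  refine ⟨_, helt, W, hWo, hzW, mem_admTransf_of_baseMap (hφ.restr W) ?_ ?_ ?_⟩
  · rw [φ.restr_source' _ hWo]
    exact fun z' h => (hW z' h.2).2.1
  · intro y hy
    obtain ⟨z', h1, rfl⟩ := mem_target_restr hWo hy
    obtain ⟨b1, b2, -⟩ := hW z' h1.2
    rw [b1.self_of_nhds]
    exact baseMap_u_ne b2
  · rw [φ.restr_source' _ hWo]
    rintro z' ⟨-, h⟩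
    obtain ⟨b1, b2, b3, b4, b5⟩ := hW z' h
    have hP := hpI _ b3
    refine ⟨T, X, Θ, Ψ, ε, hP, b1, ?_⟩
    have hχz : χ z'.1 = 0 := by
      refine (hχ0 z'.1 fun h => ?_).self_of_nhds
      have h1 : dist z'.1 (z.1 + 1) < 1 / 2 := h.2
      have h2 := dist_triangle_left z.1 (z.1 + 1) z'.1
      have h3 : dist z.1 (z.1 + 1) = 1 := by simp
      linarith
    have hχφ : χ (T z'.1) = 1 := χ.one_of_mem_closedBall (Metric.mem_closedBall.2 b5.le)
    change S (pol (φ z')) = sMap T X Θ Ψ ε (z', S (pol z'))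
    have e1 : S (pol z') = (‖z'.2.2‖ : ℝ) := by
      simp [hS, pol, hχz]
    have hc0 := hP.cfun_ne
    have hx : (cfun T ε z'.1 * z'.2.1 + X z'.1 - X z'.1) / cfun T ε z'.1 = z'.2.1 := by
      rw [add_sub_cancel_right, mul_div_cancel_left₀ _ hc0]
    have hE1 : Real.exp (-Θ z'.1) / |deriv T z'.1| * (‖z'.2.2‖ * Real.exp (Θ z'.1)) =
        ‖z'.2.2‖ / |deriv T z'.1| := by
      have : Real.exp (-Θ z'.1) * Real.exp (Θ z'.1) = 1 := by rw [← Real.exp_add]; simp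
      linear_combination ‖z'.2.2‖ / |deriv T z'.1| * this
    rw [e1, b1.self_of_nhds, pol_baseMap, sMap_eq, hat_ofReal]
    simp only [hS, hQ, hE, pol, hχφ, hg _ b3, hx]
    have hE2 := congrArg (fun r : ℝ => (r : ℂ)) hE1
    push_cast at hE2 ⊢
    rw [sub_self, zero_add, one_mul, one_mul, hE2]
    rfl

/-- Near `z` the transformation is the composition of `φ` followed by a time shift by `c`, and the
shift back. The choice of `c` makes the first factor send the time of `z` exactly one unit ahead, so
`exists_symmetry` applies to it, while the shift back is a symmetry for `S = ρ`. -/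
theorem equivGroupProj_subset : classS.equivGroupProj ⊆ classS.symProduct := by
  intro φ h
  have hφ : IsPointTransf φ := by obtain ⟨Φ, -, hpr⟩ := h; exact hpr.1
  refine ⟨hφ, fun z hz => ?_⟩
  obtain ⟨hu, T, X, Θ, Ψ, ε, hp, hev⟩ := hasBaseForm_of_mem_equivGroupProj h hz
  set c := z.1 + 1 - T z.1 with hc
  obtain ⟨σ, hσs, hσv, θ₁, hθ₁, hσ⟩ := exists_shift c
  obtain ⟨σ', hσs', hσv', θ₂, hθ₂, hσ'⟩ := exists_shift (-c)
  have hev' : φ.trans σ =ᶠ[𝓝 z] baseMap (fun t => T t + c) X Θ Ψ 0 ε := by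
    filter_upwards [hev] with z' h
    change σ (φ z') = _
    rw [hσv, baseMap_add_shift, h]
  obtain ⟨θ, hθ, W, hWo, hzW, hm⟩ := exists_symmetry (hφ.trans hσ.1) hu (hp.add_shift c) hev'
    (by rw [hc]; ring)
  have hφu : (φ z).2.2 ≠ 0 := by rw [hev.self_of_nhds]; exact baseMap_u_ne hu
  have hcomp : ∀ z', σ' (σ (φ z')) = φ z' := by
    intro z'
    rw [hσv, hσv']
    simp
  refine ⟨[(φ.trans σ).restr W, σ'], by simp, ?_, ?_, ?_⟩
  · intro e he
    rcases List.mem_cons.1 he with rfl | he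
    · exact ⟨θ, hθ, hm⟩
    · rw [List.mem_singleton.1 he]
      exact ⟨θ₂, hθ₂, hσ'⟩
  · simp only [List.foldr_cons, List.foldr_nil, OpenPartialHomeomorph.trans_refl]
    rw [OpenPartialHomeomorph.trans_source, OpenPartialHomeomorph.restr_source' _ _ hWo,
      OpenPartialHomeomorph.trans_source]
    refine ⟨⟨⟨hz, ?_⟩, hzW⟩, ?_⟩
    · change φ z ∈ σ.source
      rw [hσs]; exact hφu
    · change σ (φ z) ∈ σ'.source
      rw [hσs', hσv]; exact hφu
  · refine Filter.Eventually.of_forall fun z' => ?_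
    simp only [List.foldr_cons, List.foldr_nil, OpenPartialHomeomorph.trans_refl]
    exact (hcomp z').symm

theorem stronglyNormalized_classS : classS.StronglyNormalized :=
  ⟨normalized_classS, Set.Subset.antisymm equivGroupProj_subset symProduct_subset⟩

/-! ### The equivalence group in terms of `F = Sψ`. -/

theorem IsPointTransf.symm {E : Type} [NormedAddCommGroup E] [NormedSpace ℝ E]
    {φ : OpenPartialHomeomorph E E} (hφ : IsPointTransf φ) : IsPointTransf φ.symm :=
  ⟨hφ.2, hφ.1⟩

/-- The inverse of `toF`. -/
noncomputable def ofF (w : Ext) : Ext := (w.1, w.2 / w.1.2.2)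

theorem ofF_toF {w : Ext} (hw : w.1.2.2 ≠ 0) : ofF (toF w) = w := by
  simp [ofF, toF, hw]

theorem toF_ofF {w : Ext} (hw : w.1.2.2 ≠ 0) : toF (ofF w) = w := by
  simp [ofF, toF, hw]

theorem smooth_u (w : Ext) : ContDiffAt ℝ ∞ (fun w : Ext => w.1.2.2) w :=
  contDiffAt_snd.comp w (contDiffAt_snd.comp w contDiffAt_fst)

theorem smooth_toF (w : Ext) : ContDiffAt ℝ ∞ toF w :=
  contDiffAt_fst.prodMk (contDiffAt_snd.mul (smooth_u w))

theorem smooth_ofF {w : Ext} (hw : w.1.2.2 ≠ 0) : ContDiffAt ℝ ∞ ofF w :=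
  contDiffAt_fst.prodMk (smooth_div contDiffAt_snd (smooth_u w) hw)

theorem exists_toF : ∃ τ : OpenPartialHomeomorph Ext Ext, IsPointTransf τ ∧
    τ.source = {w | w.1.2.2 ≠ 0} ∧ τ.target = {w | w.1.2.2 ≠ 0} ∧ (∀ w, τ w = toF w) ∧
      ∀ w, τ.symm w = ofF w := by
  have ho : IsOpen {w : Ext | w.1.2.2 ≠ 0} :=
    isOpen_ne_fun (continuous_snd.comp (continuous_snd.comp continuous_fst)) continuous_const
  exact exists_pointTransf ho ho (fun w hw => hw) (fun w hw => hw) (fun w hw => ofF_toF hw)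
    (fun w hw => toF_ofF hw) (fun w _ => smooth_toF w) (fun w hw => smooth_ofF hw)

theorem u_ne_of_form {Φ : OpenPartialHomeomorph Ext Ext} (hform : HasEquivForm Φ) {w : Ext}
    (hw : w ∈ Φ.source) (hu : w.1.2.2 ≠ 0) : (Φ w).1.2.2 ≠ 0 := by
  obtain ⟨T, X, Θ, Ψ, ε, -, hev⟩ := hform w hw
  rw [hev.self_of_nhds]
  exact baseMap_u_ne hu

/-- In terms of `F = S ψ`, the transformed arbitrary elements belong to the wider class. -/
theorem mem_equivGroup_F {Φ Φ' : OpenPartialHomeomorph Ext Ext} (h : Φ ∈ classS.equivGroup)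
    (hΦ' : IsPointTransf Φ') (hs : Φ'.source = toF '' Φ.source)
    (hv : ∀ w ∈ Φ.source, Φ' (toF w) = toF (Φ w)) : Φ' ∈ classF'.equivGroup := by
  have hform := hasEquivForm_of_mem_equivGroup h
  obtain ⟨-, hne, φ, hpr, -⟩ := h
  have hpr' : ProjectsTo Φ' φ := by
    refine ⟨hpr.1, ?_, ?_⟩
    · rw [hs, hpr.2.1, Set.image_image]; rfl
    · rw [hs]
      rintro _ ⟨w, hw, rfl⟩
      rw [hv w hw]
      exact hpr.2.2 w hw
  refine ⟨hΦ', fun _ _ => trivial, φ, hpr', fun θ hθ z hz hw => ?_⟩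
  have hw₀ := hw
  rw [hs] at hw₀
  obtain ⟨w₀, hw₀, hwz⟩ := hw₀
  have hu : z.2.2 ≠ 0 := by
    have := hne _ hw₀
    rwa [show w₀.1 = z from congrArg Prod.fst hwz] at this
  obtain rfl : w₀ = ofF (z, θ.val z) := by rw [← hwz, ofF_toF (hne _ hw₀)]
  obtain ⟨T, X, Θ, Ψ, ε, hp, hev⟩ := hform _ hw₀
  have hθs : ContDiffAt ℝ ∞ θ.val z := hθ.2.2.contDiffAt (hθ.1.mem_nhds hz)
  have hc : Filter.Tendsto (fun z' => (z', θ.val z')) (𝓝 z) (𝓝 (z, θ.val z)) :=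
    continuousAt_id.prodMk hθs.continuousAt
  have hc' : Filter.Tendsto (fun z' => ofF (z', θ.val z')) (𝓝 z) (𝓝 (ofF (z, θ.val z))) :=
    ((smooth_ofF (w := (z, θ.val z)) hu).continuousAt.tendsto).comp hc
  have hN : ∀ᶠ z' in 𝓝 z, z' ∈ θ.dom ∧ (z', θ.val z') ∈ Φ'.source ∧
      ofF (z', θ.val z') ∈ Φ.source ∧ ParamsAt T X Θ Ψ ε z'.1 ∧
      Φ (ofF (z', θ.val z')) = equivMap T X Θ Ψ ε (ofF (z', θ.val z')) :=
    Filter.Eventually.and (hθ.1.mem_nhds hz) <|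
      (hc.eventually (Φ'.open_source.mem_nhds hw)).and <|
      (hc'.eventually (Φ.open_source.mem_nhds hw₀)).and <|
      ((continuous_fst.tendsto z).eventually hp.eventually).and (hc'.eventually hev)
  obtain ⟨r, hr, hW⟩ := Metric.eventually_nhds_iff_ball.1 hN
  set W := Metric.ball z r with hWdef
  have hWo : IsOpen W := Metric.isOpen_ball
  have hWs : W ⊆ φ.source := fun z' h => by
    rw [hpr'.2.1]; exact ⟨_, (hW z' h).2.1, rfl⟩
  have hφW : ∀ z' ∈ W, φ z' = baseMap T X Θ Ψ 0 ε z' := by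
    intro z' h
    obtain ⟨-, -, h3, -, h5⟩ := hW z' h
    rw [show z' = (ofF (z', θ.val z')).1 from rfl, ← hpr.2.2 _ h3, h5]; rfl
  have hsym : ∀ z' ∈ W, φ.symm (φ z') = z' := fun z' h => φ.left_inv (hWs h)
  have hval : ∀ z' ∈ W, (Φ' (z', θ.val z')).2 =
      sMap T X Θ Ψ ε (z', θ.val z' / z'.2.2) * (φ z').2.2 := by
    intro z' h
    obtain ⟨-, -, h3, -, h5⟩ := hW z' h
    have h6 := hv _ h3
    rw [toF_ofF (w := (z', θ.val z')) (hne (ofF (z', θ.val z')) h3), h5] at h6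
    rw [h6, hφW z' h]
    rfl
  -- In the wider class only smoothness on a domain is required, so the function transported to the
  -- image of a ball is admissible as it stands.
  set θ' : ArbElt := ⟨φ '' W, fun y => (Φ' (φ.symm y, θ.val (φ.symm y))).2⟩ with hθ'
  have hθ'v : ∀ z' ∈ W, θ'.val (φ z') = (Φ' (z', θ.val z')).2 := by
    intro z' h
    simp only [hθ', hsym z' h]
  refine ⟨θ', ⟨φ.isOpen_image_of_subset_source hWo hWs, ?_, ?_⟩, W, hWo, Metric.mem_ball_self hr,
    mem_admTransf_F_of_baseMap (hpr.1.restr W) ?_ ?_ ?_, fun z' h => ⟨(hW z' h).2.1, hθ'v z' h⟩⟩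
  · exact IsConnected.image ⟨⟨z, Metric.mem_ball_self hr⟩, (convex_ball _ _).isPreconnected⟩ _
      (φ.continuousOn.mono hWs)
  · rintro _ ⟨z', h, rfl⟩
    have h1 : ContDiffAt ℝ ∞ φ.symm (φ z') :=
      hpr.1.symm.contDiffAt (φ.map_source (hWs h))
    have h2 : ContDiffAt ℝ ∞ (fun y => (φ.symm y, θ.val (φ.symm y))) (φ z') := by
      refine h1.prodMk (ContDiffAt.comp (φ z') ?_ h1)
      rw [hsym z' h]
      exact hθ.2.2.contDiffAt (hθ.1.mem_nhds (hW z' h).1)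
    refine ContDiffAt.contDiffWithinAt (contDiffAt_snd.comp (φ z') (ContDiffAt.comp (φ z') ?_ h2))
    rw [hsym z' h]
    exact hΦ'.contDiffAt (hW z' h).2.1
  · rw [φ.restr_source' _ hWo]
    exact fun z' h => (hW z' h.2).1
  · intro y hy
    obtain ⟨z', h1, rfl⟩ := mem_target_restr hWo hy
    exact ⟨z', h1.2, rfl⟩
  · rw [φ.restr_source' _ hWo]
    rintro z' ⟨-, h⟩
    refine ⟨hne _ (hW z' h).2.2.1, T, X, Θ, Ψ, ε, (hW z' h).2.2.2.1, ?_, ?_⟩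
    · filter_upwards [hWo.mem_nhds h] with z'' h'' using hφW z'' h''
    · exact (hθ'v z' h).trans (hval z' h)

theorem exists_correspondsInF {Φ : OpenPartialHomeomorph Ext Ext} (h : Φ ∈ classS.equivGroup) :
    ∃ Φ' ∈ classF'.equivGroup, CorrespondsInF Φ Φ' ∧ VanishingΦ0 Φ' := by
  have hform := hasEquivForm_of_mem_equivGroup h
  have hne : ∀ w ∈ Φ.source, w.1.2.2 ≠ 0 := h.2.1
  obtain ⟨τ, hτ, hτs, hτt, hτv, hτi⟩ := exists_toF
  -- Conjugation by the change of arbitrary element; no points are lost, since `Φ` preserves `ψ ≠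
  -- 0`.
  set Φ' := (τ.symm.trans Φ).trans τ with hΦ'def
  have hΦ' : IsPointTransf Φ' := (hτ.symm.trans h.1).trans hτ
  have happ : ∀ w, Φ' w = toF (Φ (ofF w)) := fun w => by
    change τ (Φ (τ.symm w)) = _
    rw [hτv, hτi]
  have hsrc : Φ'.source = toF '' Φ.source := by
    ext w
    rw [hΦ'def, OpenPartialHomeomorph.trans_source, OpenPartialHomeomorph.trans_source,
      OpenPartialHomeomorph.symm_source, hτt, hτs]
    constructor
    · rintro ⟨⟨h1, h2⟩, -⟩
      have h1' : w.1.2.2 ≠ 0 := h1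
      rw [Set.mem_preimage, hτi] at h2
      exact ⟨_, h2, toF_ofF h1'⟩
    · rintro ⟨w, hw, rfl⟩
      have h1 : τ.symm (toF w) = w := by rw [hτi, ofF_toF (hne w hw)]
      refine ⟨⟨hne w hw, ?_⟩, ?_⟩
      · rw [Set.mem_preimage, h1]; exact hw
      · change (Φ (τ.symm (toF w))).1.2.2 ≠ 0
        rw [h1]
        exact u_ne_of_form hform hw (hne w hw)
  have hv : ∀ w ∈ Φ.source, Φ' (toF w) = toF (Φ w) := fun w hw => by
    rw [happ, ofF_toF (hne w hw)]
  refine ⟨Φ', mem_equivGroup_F h hΦ' hsrc hv, ⟨hne, hsrc, hv⟩, ?_⟩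
  rw [VanishingΦ0, hsrc]
  rintro _ ⟨w, hw, rfl⟩
  obtain ⟨T, X, Θ, Ψ, ε, hp, hev⟩ := hform w hw
  refine ⟨T, X, Θ, Ψ, ε, hp, ?_⟩
  have hc : ContinuousAt ofF (toF w) := (smooth_ofF (w := toF w) (hne w hw)).continuousAt
  rw [ContinuousAt, ofF_toF (hne w hw)] at hc
  filter_upwards [hc.eventually hev] with w' h1
  rw [happ, h1]
  rfl

theorem admAt_of_mem_admTransf_F {θ θ' : ArbElt} {φ : OpenPartialHomeomorph Base Base}
    (h : φ ∈ classF'.admTransf θ θ') {z : Base} (hz : z ∈ φ.source) :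
    AdmAt φ z (θ.val z) (θ'.val (φ z)) := by
  intro j j' hj hjz hs
  subst hjz
  have h1 := ((h.2.2.2 j j' hj).1 ⟨h.2.1 hz, hs⟩).2
  rw [(prolongs_pt hj).2] at h1
  exact h1

/-- The smoothness of `Φ` and of its inverse is recovered by expressing both through `Φ'` and
division by `ψ`. The `(t, x, ψ)`-part has the explicit form by hypothesis, and admissibility in the
wider class then determines the `S`-component. -/
theorem mem_equivGroup_of_correspondsInF {Φ Φ' : OpenPartialHomeomorph Ext Ext}
    (h : Φ' ∈ classF'.equivGroup) (hcor : CorrespondsInF Φ Φ') (hvan : VanishingΦ0 Φ') :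
    Φ ∈ classS.equivGroup := by
  obtain ⟨hΦ', -, φ, hpr, hall⟩ := h
  obtain ⟨hne, hsrc, hv⟩ := hcor
  have hmem : ∀ w ∈ Φ.source, toF w ∈ Φ'.source := fun w hw => by rw [hsrc]; exact ⟨w, hw, rfl⟩
  have hu : ∀ w ∈ Φ.source, (Φ w).1.2.2 ≠ 0 := by
    intro w hw
    obtain ⟨T, X, Θ, Ψ, ε, -, hev⟩ := hvan _ (hmem w hw)
    have h1 := hev.self_of_nhds
    rw [hv w hw] at h1
    change (Φ w).1 = _ at h1
    rw [h1]
    exact baseMap_u_ne (hne w hw)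
  have hinv : ∀ v ∈ Φ.target, Φ.symm v = ofF (Φ'.symm (toF v)) ∧ toF v ∈ Φ'.target := by
    intro v hv'
    have h1 := Φ.map_target hv'
    have h2 := hv _ h1
    rw [Φ.right_inv hv'] at h2
    rw [← h2, Φ'.left_inv (hmem _ h1), ofF_toF (hne _ h1)]
    exact ⟨rfl, Φ'.map_source (hmem _ h1)⟩
  have hΦ : IsPointTransf Φ := by
    refine ⟨fun w hw => ?_, fun v hv' => ?_⟩
    · have h1 : ContDiffAt ℝ ∞ (fun w => Φ' (toF w)) w :=
        (hΦ'.contDiffAt (hmem w hw)).comp w (smooth_toF w)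
      have h2 : ContDiffAt ℝ ∞ (fun w => ofF (Φ' (toF w))) w := by
        refine ContDiffAt.comp w (g := ofF) (smooth_ofF ?_) h1
        rw [hv w hw]
        exact hu w hw
      refine (h2.congr_of_eventuallyEq ?_).contDiffWithinAt
      filter_upwards [Φ.open_source.mem_nhds hw] with w' hw'
      rw [hv w' hw', ofF_toF (hu w' hw')]
    · have h1 : ContDiffAt ℝ ∞ (fun v => Φ'.symm (toF v)) v :=
        (hΦ'.symm.contDiffAt (hinv v hv').2).comp v (smooth_toF v)
      have h2 : ContDiffAt ℝ ∞ (fun v => ofF (Φ'.symm (toF v))) v := by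
        refine ContDiffAt.comp v (g := ofF) (smooth_ofF ?_) h1
        change (ofF (Φ'.symm (toF v))).1.2.2 ≠ 0
        rw [← (hinv v hv').1]
        exact hne _ (Φ.map_target hv')
      refine (h2.congr_of_eventuallyEq ?_).contDiffWithinAt
      filter_upwards [Φ.open_target.mem_nhds hv'] with v' h' using (hinv v' h').1
  have hpr' : ProjectsTo Φ φ := by
    refine ⟨hpr.1, ?_, fun w hw => ?_⟩
    · rw [hpr.2.1, hsrc, Set.image_image]; rfl
    · have h1 := hpr.2.2 _ (hmem w hw)
      rw [hv w hw] at h1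
      exact h1
  refine mem_equivGroup_of_form hΦ hpr' hne fun w hw => ?_
  obtain ⟨T, X, Θ, Ψ, ε, hp, hev⟩ := hvan _ (hmem w hw)
  change ParamsAt T X Θ Ψ ε w.1.1 at hp
  refine ⟨T, X, Θ, Ψ, ε, hp, ?_⟩
  have hφ : φ =ᶠ[𝓝 w.1] baseMap T X Θ Ψ 0 ε := by
    have hc : Filter.Tendsto (fun z : Base => ((z, (toF w).2) : Ext)) (𝓝 w.1) (𝓝 (toF w)) :=
      Filter.tendsto_id.prodMk_nhds tendsto_const_nhds
    filter_upwards [hc.eventually (Φ'.open_source.mem_nhds (hmem w hw)), hc.eventually hev]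
      with z h1 h2
    rw [← h2, hpr.2.2 _ h1]
  filter_upwards [Φ.open_source.mem_nhds hw, (continuous_fst.tendsto w).eventually
    (Filter.EventuallyEq.eventuallyEq_nhds hφ),
    ((continuous_fst.comp continuous_fst).tendsto w).eventually hp.eventually] with w' hw' e1 e2
  -- A constant `F` through the given point is a sufficient test equation.
  have hθ : (⟨Set.univ, fun _ => (toF w').2⟩ : ArbElt) ∈ classF'.elts :=
    ⟨isOpen_univ, isConnected_univ, contDiffOn_const⟩
  obtain ⟨θ', -, W, hWo, hzW, hm, hval⟩ := hall _ hθ w'.1 trivial (hmem w' hw')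
  have hs : w'.1 ∈ (φ.restr W).source := by
    rw [φ.restr_source' _ hWo, hpr'.2.1]
    exact ⟨⟨w', hw', rfl⟩, hzW⟩
  have h1 := (admAt_of_mem_admTransf_F hm hs).eq_sMap hm.1 hs (hne w' hw') e2 e1
  have h2 := (hval w'.1 hzW).2
  have h3 := hv w' hw'
  change θ'.val (φ w'.1) = (Φ' (toF w')).2 at h2
  rw [h3] at h2
  change θ'.val (φ w'.1) = (Φ w').2 * (Φ w').1.2.2 at h2
  change θ'.val (φ w'.1) = sMap T X Θ Ψ ε (w'.1, w'.2 * w'.1.2.2 / w'.1.2.2) * (φ w'.1).2.2 at h1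
  rw [mul_div_cancel_right₀ _ (hne w' hw'), h2, ← hpr'.2.2 w' hw'] at h1
  refine Prod.ext ?_ (mul_right_cancel₀ (hu w' hw') h1)
  rw [hpr'.2.2 w' hw', e1.self_of_nhds]
  rfl

theorem mem_equivGroup_iff_F (Φ : OpenPartialHomeomorph Ext Ext) : Φ ∈ classS.equivGroup ↔
    ∃ Φ' ∈ classF'.equivGroup, CorrespondsInF Φ Φ' ∧ VanishingΦ0 Φ' :=
  ⟨exists_correspondsInF, fun ⟨_, h1, h2, h3⟩ => mem_equivGroup_of_correspondsInF h1 h2 h3⟩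

end NLS

theorem mainTheorem2 :
    -- the class is strongly normalized
    NLS.classS.StronglyNormalized ∧
    -- its equivalence group is the subgroup of the equivalence group of the class of equations
    -- `iψ_t + ψ_xx + F(t, x, ψ, ψ*) = 0` singled out by `Φ⁰ = 0`
    (∀ Φ : OpenPartialHomeomorph NLS.Ext NLS.Ext,
      Φ ∈ NLS.classS.equivGroup ↔
        ∃ Φ' ∈ NLS.classF'.equivGroup, NLS.CorrespondsInF Φ Φ' ∧ NLS.VanishingΦ0 Φ') ∧
    -- i.e., it is formed by the explicit transformations
    (∀ Φ : OpenPartialHomeomorph NLS.Ext NLS.Ext,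
      Φ ∈ NLS.classS.equivGroup ↔
        NLS.IsPointTransf Φ ∧ (∃ φ, NLS.ProjectsTo Φ φ) ∧
          (∀ w ∈ Φ.source, w.1.2.2 ≠ 0) ∧ NLS.HasEquivForm Φ) ∧
    -- and every choice of the parameters on an open interval defines an element of it
    (∀ (I : Set ℝ) (T X Θ Ψ : ℝ → ℝ) (ε : ℝ), IsOpen I → I.OrdConnected →
      (∀ t ∈ I, NLS.ParamsAt T X Θ Ψ ε t) →
      ∃ Φ ∈ NLS.classS.equivGroup, Φ.source = {w | w.1.1 ∈ I ∧ w.1.2.2 ≠ 0} ∧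
        ∀ w ∈ Φ.source, Φ w = NLS.equivMap T X Θ Ψ ε w) := by
  exact ⟨NLS.stronglyNormalized_classS, NLS.mem_equivGroup_iff_F, NLS.mem_equivGroup_iff,
    NLS.exists_mem_equivGroup⟩
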